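/- **Theorem 4.5 (castel-scroll).** Let $k$ be an infinite field with algebraic closure $\overline k$, let $r\ge 3$ and $1\le s\le r-2$ be integers, and let $\Gamma\subset\mathbf P^r_k$ be a finite Gorenstein closed subscheme of degree $\gamma=\dim_k H^0(\mathcal O_\Gamma)$ (Gorenstein means that all local rings of $\Gamma$ are Gorenstein). Suppose that $\Gamma$ is geometrically in linearly general position: every closed subscheme of $\Gamma_{\overline k}=\Gamma\times_k\overline k$ that lies on a linear subspace of $\mathbf P^r_{\overline k}$ of dimension $d<r$ has degree at most $d+1$. If $\gamma\le r+2$, suppose in addition that $\Gamma$ is geometrically curvilinear: every local ring of $\Gamma_{\overline k}$ is isomorphic to $F[t]/(t^n)$ for some field $F$ and some $n\ge 1$. a) If $\gamma\le r+s+2$, then $\Gamma$ is contained (as a subscheme) in an $s$-dimensional rational normal scroll in $\mathbf P^r_k$, possibly singular. b) If $\gamma\le r+s+2$ and moreover $s\le \frac{r+1}{2}$, then $\Gamma$ is contained in an $s$-dimensional rational normal scroll in $\mathbf P^r_k$ that is smooth over $k$. Here an $s$-dimensional rational normal scroll in $\mathbf P^r_k$ is the image of $\mathbf P(\mathcal E)$,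 where $\mathcal E=\bigoplus_{i=1}^s\mathcal O_{\mathbf P^1_k}(a_i)$ with integers $a_i\ge 0$ not all zero and $\sum_{i=1}^s(a_i+1)=r+1$, under the morphism to $\mathbf P^r_k$ given by some basis of $H^0(\mathcal O_{\mathbf P(\mathcal E)}(1))$. -/

import Mathlib

open CategoryTheory AlgebraicGeometry

universe u

noncomputable section

namespace GaleScroll

attribute [local instance] MvPolynomial.gradedAlgebra

/-- The standard grading of `k[x₀, …, x_r]`; its piece of degree `d` is the space of forms of
degree `d`. -/
abbrev forms (r : ℕ) (k : Type u) [Field k] : ℕ → Submodule k (MvPolynomial (Fin (r + 1)) k) :=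
  MvPolynomial.homogeneousSubmodule (Fin (r + 1)) k

/-- Projective space `P^r_k = Proj k[x₀, …, x_r]`. -/
abbrev PSpace (r : ℕ) (k : Type u) [Field k] : Scheme.{u} := Proj (forms r k)

/-- The structure morphism `P^r_k ⟶ Spec k`. -/
def PSpace.toSpec (r : ℕ) (k : Type u) [Field k] : PSpace r k ⟶ Spec (.of k) :=
  Proj.toSpecZero (forms r k) ≫ Spec.map (CommRingCat.ofHom (algebraMap k (forms r k 0)))

/-- The graded ring homomorphism `k[x₀, …, x_r] → K[x₀, …, x_r]` of a field extension. -/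
def extendScalars (r : ℕ) (k K : Type u) [Field k] [Field K] [Algebra k K] :
    GradedRingHom (forms r k) (forms r K) where
  toRingHom := MvPolynomial.map (algebraMap k K)
  map_mem {_ _} h := MvPolynomial.IsHomogeneous.map h _

theorem irrelevant_le_extendScalars (r : ℕ) (k K : Type u) [Field k] [Field K] [Algebra k K] :
    HomogeneousIdeal.irrelevant (forms r K) ≤
      (HomogeneousIdeal.irrelevant (forms r k)).map (extendScalars r k K) := by
  rw [HomogeneousIdeal.irrelevant_le]
  intro d hd p hp
  have hp' : MvPolynomial.IsHomogeneous p d := hp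
  change p ∈ Ideal.map (extendScalars r k K) (HomogeneousIdeal.irrelevant (forms r k)).toIdeal
  rw [p.as_sum]
  refine Ideal.sum_mem _ fun m hm => ?_
  have hm0 : m ≠ 0 := by
    rintro rfl
    have h := hp' (MvPolynomial.mem_support_iff.mp hm)
    simp at h
    omega
  obtain ⟨j, hj⟩ := Finsupp.ne_iff.mp hm0
  have hdvd : (MvPolynomial.X j : MvPolynomial (Fin (r + 1)) K) ∣
      MvPolynomial.monomial m (MvPolynomial.coeff m p) :=
    MvPolynomial.X_dvd_monomial.mpr (Or.inr hj)
  refine Ideal.mem_of_dvd _ hdvd ?_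
  have hX : (extendScalars r k K) (MvPolynomial.X j) = MvPolynomial.X j :=
    MvPolynomial.map_X _ _
  rw [← hX]
  exact Ideal.mem_map_of_mem _
    (HomogeneousIdeal.mem_irrelevant_of_mem _ Nat.one_pos (MvPolynomial.isHomogeneous_X k j))

/-- The base change morphism `P^r_K ⟶ P^r_k` of a field extension. -/
def PSpace.baseChange (r : ℕ) (k K : Type u) [Field k] [Field K] [Algebra k K] :
    PSpace r K ⟶ PSpace r k :=
  Proj.map (extendScalars r k K) (irrelevant_le_extendScalars r k K)

theorem X_mem_forms (r : ℕ) (k : Type u) [Field k] (j : Fin (r + 1)) :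
    (MvPolynomial.X j : MvPolynomial (Fin (r + 1)) k) ∈ forms r k 1 :=
  (MvPolynomial.mem_homogeneousSubmodule _ _).mpr (MvPolynomial.isHomogeneous_X k j)

theorem form_mem_forms_smul {r : ℕ} {k : Type u} [Field k] {d : ℕ} (p : forms r k d) :
    (p : MvPolynomial (Fin (r + 1)) k) ∈ forms r k (d • 1) := by
  simp

/-- The element `p / x_j ^ d` of the coordinate ring of the standard open set `x_j ≠ 0`, for a
form `p` of degree `d`. -/
def dehomogenize {r : ℕ} {k : Type u} [Field k] {d : ℕ} (p : forms r k d) (j : Fin (r + 1)) :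
    HomogeneousLocalization.Away (forms r k) (MvPolynomial.X j) :=
  HomogeneousLocalization.Away.mk (forms r k) (X_mem_forms r k j) d p.1 (form_mem_forms_smul p)

/-- The form `p` of degree `d` vanishes on `Z`, for a morphism `z : Z ⟶ P^r_k`: on each standard
open set `x_j ≠ 0`, the function `p / x_j ^ d` pulls back to `0`. -/
def Vanishes {r : ℕ} {k : Type u} [Field k] {Z : Scheme.{u}} (z : Z ⟶ PSpace r k)
    {d : ℕ} (p : forms r k d) : Prop :=
  ∀ j : Fin (r + 1),
    z.app (Proj.basicOpen (forms r k) (MvPolynomial.X j))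
      (Proj.awayToSection (forms r k) (MvPolynomial.X j) (dehomogenize p j)) = 0

/-- The degree `dim_k Γ(Z, O_Z)` of a finite `k`-scheme `Z`. -/
def degree {k : Type u} [Field k] {Z : Scheme.{u}} (f : Z ⟶ Spec (.of k)) : ℕ :=
  letI : Algebra k Γ(Z, ⊤) := ((Scheme.ΓSpecIso (.of k)).inv ≫ f.appTop).hom.toAlgebra
  Module.finrank k Γ(Z, ⊤)

/-- A zero-dimensional scheme is (locally) Gorenstein if each of its local rings is
injective as a module over itself. -/
def IsGorenstein (Z : Scheme.{u}) : Prop :=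
  ∀ x : Z, Module.Injective (Z.presheaf.stalk x) (Z.presheaf.stalk x)

/-- A zero-dimensional scheme is curvilinear if each of its local rings is isomorphic to
`F[t] / (t ^ n)` for some field `F` and some `n`. -/
def IsCurvilinear (Z : Scheme.{u}) : Prop :=
  ∀ x : Z, ∃ (F : Type u) (_ : Field F) (n : ℕ),
    Nonempty (Z.presheaf.stalk x ≃+*
      Polynomial F ⧸ Ideal.span {(Polynomial.X : Polynomial F) ^ n})

/-- A finite subscheme `i : Y ⟶ P^r_k` is in linearly general position if every closed subscheme
of `Y` that lies on a linear subspace of dimension `d < r` has degree at most `d + 1`.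
A linear subspace of dimension `d` is cut out by an `(r - d)`-dimensional space of linear forms. -/
def InLinearlyGeneralPosition {r : ℕ} {k : Type u} [Field k] {Y : Scheme.{u}}
    (i : Y ⟶ PSpace r k) : Prop :=
  ∀ (Z : Scheme.{u}) (z : Z ⟶ Y) [IsClosedImmersion z] (d : ℕ) (W : Submodule k (forms r k 1)),
    d < r → Module.finrank k W + d = r → (∀ ℓ ∈ W, Vanishes (z ≫ i) ℓ) →
      degree (z ≫ i ≫ PSpace.toSpec r k) ≤ d + 1

/-- The base change `Y_K` of `i : Y ⟶ P^r_k` to the algebraic closure `K` of `k`. -/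
def geometricFiber {r : ℕ} {k : Type u} [Field k] {Y : Scheme.{u}} (i : Y ⟶ PSpace r k) :
    Scheme.{u} :=
  Limits.pullback i (PSpace.baseChange r k (AlgebraicClosure k))

/-- The morphism `Y_K ⟶ P^r_K`, with `K` the algebraic closure of `k`. -/
def geometricFiberMap {r : ℕ} {k : Type u} [Field k] {Y : Scheme.{u}} (i : Y ⟶ PSpace r k) :
    geometricFiber i ⟶ PSpace r (AlgebraicClosure k) :=
  Limits.pullback.snd i (PSpace.baseChange r k (AlgebraicClosure k))

/-- The space `⊕ t_i k[u, v]_{a_i}` of global sections of `O(1)` on `P(E)`, where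
`E = ⊕ O(a_i)` on the projective line with homogeneous coordinates `u, v`. It is written inside
the polynomial ring `k[u, v, t_1, …, t_s]`. -/
def scrollSections (k : Type u) [Field k] {s : ℕ} (a : Fin s → ℕ) :
    Submodule k (MvPolynomial (Fin 2 ⊕ Fin s) k) :=
  Submodule.span k {m | ∃ (i : Fin s) (b c : ℕ), b + c = a i ∧
    m = MvPolynomial.X (.inr i) * MvPolynomial.X (.inl 0) ^ b * MvPolynomial.X (.inl 1) ^ c}

/-- The closed subscheme `j : X ⟶ P^r_k` is a (possibly singular) `s`-dimensional rational normal
scroll: for some integers `a_1, …, a_s ≥ 0`, not all zero, it is the image of `P(E)`,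
`E = ⊕ O(a_i)` on the projective line, under the complete linear series of `O(1)`, mapped to
`P^r_k` by some basis `ℓ_0, …, ℓ_r` of `H⁰(O(1))`. That is, the forms vanishing on `X`
are the forms `p` with `p(ℓ_0, …, ℓ_r) = 0` in `⊕ H⁰(O(d)) ⊆ k[u, v, t_1, …, t_s]`. -/
def IsRationalNormalScroll {r : ℕ} {k : Type u} [Field k] (s : ℕ) {X : Scheme.{u}}
    (j : X ⟶ PSpace r k) : Prop :=
  IsClosedImmersion j ∧
    ∃ (a : Fin s → ℕ) (ℓ : Module.Basis (Fin (r + 1)) k (scrollSections k a)),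
      (∃ i, 0 < a i) ∧
      ∀ (d : ℕ) (p : forms r k d),
        Vanishes j p ↔ MvPolynomial.aeval (fun m => (ℓ m : MvPolynomial (Fin 2 ⊕ Fin s) k)) p.1 = 0

end GaleScroll

end

/-!
Since `k` is infinite, some hyperplane misses `Γ = Spec A`, and the homogeneous coordinates become
a linear system `ρ : k ^ (r + 1) → A` with `1` in its image `M`. The scroll is found by linear
algebra in `A`: if for some `t : A` the space `k ^ (r + 1)` has a basis made of `s` strings on
which `ρ` takes the values `x_j, t x_j, …, t ^ a_j x_j` (`HasBlocks`), then the substitution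
`u = 1`, `v = t`, `t_j = x_j` takes the basis `t_j u ^ b v ^ c` of `H⁰(O(1))` to these values, so
that `Γ` lies on the scroll with invariants `a_j` (`HasBlocks.exists_scrollEmbedding`). The scroll
is `Proj` of the subring of `k[u, v, t_1, …, t_s]` generated by `H⁰(O(1))`. When all `a_j` are
positive it is covered by the open sets `t_j u ^ a_j ≠ 0` and `t_j v ^ a_j ≠ 0`, which are affine
spaces, so it is smooth (`smooth_scrollEmbedding_toSpec`).

The strings come from Gale duality. As the local rings of `A` are self-injective, `A` has a
functional `τ` for which `(x, y) ↦ τ (x y)` is nondegenerate (`exists_isTrace`). Let `V = M^⊥`,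
of dimension `γ - r - 1 ≤ s + 1`. General position of `M` dualizes: geometrically, a nonzero
element of `V` generates an ideal of dimension greater than `dim M`
(`InGeneralPosition.lt_idim_span_of_mem_orth`), and `V` contains a unit
(`InGeneralPosition.exists_isUnit_mem_orth`). Take independent `u₀, u₁ = t u₀` in `V` with `u₀` a
unit. Then `{n ∈ M | t n ∈ M} = (V + t V)^⊥` has codimension at most `dim V - 1 ≤ s` in `M`
(`finrank_le_finrank_stepIn`), and `M` contains no nonzero `t`-stable subspace, as an eigenvector
in it would vanish on too large a subscheme of `Γ` (`InGeneralPosition.eq_bot_of_stable`). Hence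
the Kronecker normal form of the partially defined operator `t` on `M` has at most `s` strings and
no other blocks (`exists_strings`). Long strings can be cut, which gives exactly `s` of them
(`HasBlocks.exists_of_le`).

For a smooth scroll, strings of length one have to be avoided, that is, `M` has to be spanned by
`{n ∈ M | t n ∈ M}` and its image under `t`. This holds when `V + t V + t² V` has the expected
dimension `3 dim V - 2` (`stepIn_sup_map_eq`). The condition is open on pencils, so over the
infinite field `k` it suffices to find one over the algebraic closure (`descend_pencil`). There,
with `dim V = s + 1`, every ideal of colength `s` is generated by an element of `V`, unique up to
scalars, and `exists_pencil` uses either the generators of two coprime such ideals, or, when `A` is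
so concentrated at a point that there are none, a unit and a generator of the annihilator of a
square-zero ideal of dimension `s`.

If `γ ≤ r + 2`, then `dim V ≤ 1` and there are no pencils. Instead, curvilinearity makes `A`
generated by one element `t` (`exists_linearIndependent_pow`, `descend_generator`), and
multiplication by this `t` needs a single string.
-/

namespace GaleScroll

open Module

/-! ### Pencils of linear maps and block bases -/

section Kronecker

variable {k E : Type*} [Field k] [AddCommGroup E] [Module k E]

/-- The vectors of a submodule that an endomorphism maps back into it. -/
def stepIn (T : E →ₗ[k] E) (M : Submodule k E) : Submodule k E := M ⊓ M.comap T

theorem stepIn_le (T : E →ₗ[k] E) (M : Submodule k E) : stepIn T M ≤ M := inf_le_left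

theorem map_stepIn_le (T : E →ₗ[k] E) (M : Submodule k E) : (stepIn T M).map T ≤ M :=
  Submodule.map_le_iff_le_comap.mpr inf_le_right

/-- The map `(p, q) ↦ p + T q` on `N × N` has image `N + T N` and kernel `{q ∈ N | T q ∈ N}`. -/
theorem finrank_sup_map_add_finrank_stepIn [FiniteDimensional k E] (T : E →ₗ[k] E)
    (N : Submodule k E) :
    finrank k ↥(N ⊔ N.map T) + finrank k (stepIn T N) = 2 * finrank k N := by
  let f : (N × N) →ₗ[k] E := LinearMap.coprod N.subtype (T ∘ₗ N.subtype)
  have hr : LinearMap.range f = N ⊔ N.map T := by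
    rw [LinearMap.range_coprod, Submodule.range_subtype, LinearMap.range_comp,
      Submodule.range_subtype]
  have hk : finrank k (LinearMap.ker f) = finrank k (stepIn T N) := by
    refine LinearEquiv.finrank_eq (LinearEquiv.ofBijective
      (LinearMap.codRestrict (stepIn T N) (N.subtype ∘ₗ LinearMap.snd k N N ∘ₗ
        (LinearMap.ker f).subtype) ?_) ⟨?_, ?_⟩)
    · rintro ⟨⟨p, q⟩, h⟩
      have h' : (p : E) + T q = 0 := h
      refine ⟨q.2, ?_⟩
      change T q ∈ N
      rw [eq_neg_of_add_eq_zero_right h']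
      exact N.neg_mem p.2
    · rintro ⟨⟨p, q⟩, h⟩ ⟨⟨p', q'⟩, h'⟩ e
      have h1 : (p : E) + T q = 0 := h
      have h2 : (p' : E) + T q' = 0 := h'
      have e' : q = q' := Subtype.ext (congrArg (fun z : stepIn T N => (z : E)) e)
      have : (p : E) = p' := by
        rw [eq_neg_of_add_eq_zero_left h1, eq_neg_of_add_eq_zero_left h2, e']
      simp [Subtype.ext_iff, e', this]
    · rintro ⟨q, hq, hq'⟩
      refine ⟨⟨(-⟨T q, hq'⟩, ⟨q, hq⟩), ?_⟩, ?_⟩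
      · change (-(T q) + T q : E) = 0
        simp
      · rfl
  have := LinearMap.finrank_range_add_finrank_ker f
  rw [hr, hk, finrank_prod] at this
  omega

/-- Kronecker's normal form of the pencil `N → M`, `n ↦ c n + d T n`, where
`N = {n ∈ M | T n ∈ M}`: if `M` contains no nonzero `T`-stable subspace, then `M` has a basis
consisting of strings `x, T x, …, T ^ a x`. The strings are counted by `dim M - dim N`. -/
theorem exists_strings [FiniteDimensional k E] (T : E →ₗ[k] E) (d : ℕ) :
    ∀ M : Submodule k E, finrank k M ≤ d →
      (∀ P : Submodule k E, P ≤ M → P.map T ≤ P → P = ⊥) →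
      ∃ (n : ℕ) (a : Fin n → ℕ) (x : Fin n → E),
        M = Submodule.span k {y | ∃ j l, l ≤ a j ∧ y = (T ^ l) (x j)} ∧
        ∑ j, (a j + 1) = finrank k M ∧ n + finrank k (stepIn T M) = finrank k M ∧
        (stepIn T M ⊔ (stepIn T M).map T = M → ∀ j, 1 ≤ a j) := by
  induction d with
  | zero =>
    intro M hM hP
    have hM0 : M = ⊥ := Submodule.finrank_eq_zero.mp (by omega)
    subst hM0
    refine ⟨0, Fin.elim0, Fin.elim0, ?_, ?_, ?_, fun _ j => j.elim0⟩
    · symm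
      rw [Submodule.span_eq_bot]
      rintro y ⟨j, -⟩
      exact j.elim0
    · simp
    · have : stepIn T (⊥ : Submodule k E) = ⊥ := by simp [stepIn]
      rw [this]; simp
  | succ d ih =>
    intro M hM hP
    set N := stepIn T M with hN
    have hNM : N ≤ M := stepIn_le T M
    by_cases hM0 : finrank k M ≤ d
    · exact ih M hM0 hP
    have hlt : finrank k N < finrank k M := by
      rcases eq_or_lt_of_le hNM with h | h
      · have := hP M le_rfl (Submodule.map_le_iff_le_comap.mpr (inf_eq_left.mp h))
        rw [this] at hM0
        simp at hM0
      · exact Submodule.finrank_lt_finrank_of_lt h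
    obtain ⟨n, a, x, hspan, hsum, hn, -⟩ := ih N (by omega) fun P h h' => hP P (h.trans hNM) h'
    set S := N ⊔ N.map T with hS
    have hSM : S ≤ M := sup_le hNM (map_stepIn_le T M)
    have hSdim : finrank k S = finrank k N + n := by
      have := finrank_sup_map_add_finrank_stepIn T N
      rw [← hS] at this
      omega
    obtain ⟨C, hC⟩ := Submodule.exists_isCompl (Submodule.comap M.subtype S)
    set p := finrank k C with hp
    have hpM : finrank k S + p = finrank k M := by
      have h1 := Submodule.finrank_add_eq_of_isCompl hC
      rwa [(Submodule.comapSubtypeEquivOfLe hSM).finrank_eq] at h1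
    let b := finBasis k C
    have hCS : M = S ⊔ C.map M.subtype := by
      have := congrArg (Submodule.map M.subtype) hC.sup_eq_top
      rw [Submodule.map_sup, Submodule.map_comap_subtype, Submodule.map_subtype_top,
        inf_eq_right.mpr hSM] at this
      exact this.symm
    have hCspan : C.map M.subtype = Submodule.span k (Set.range fun j => ((b j : M) : E)) := by
      have h1 : Submodule.span k (Set.range fun j => (b j : M)) = C := by
        have := congrArg (Submodule.map C.subtype) b.span_eq
        rw [Submodule.map_span, Submodule.map_subtype_top, ← Set.range_comp] at this
        exact this
      have h2 := congrArg (Submodule.map M.subtype) h1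
      rw [Submodule.map_span, ← Set.range_comp] at h2
      exact h2.symm
    refine ⟨n + p, Fin.append (fun j => a j + 1) fun _ => 0,
      Fin.append x fun j => ((b j : M) : E), ?_, ?_, ?_, ?_⟩
    · apply le_antisymm
      · refine hCS.le.trans (sup_le_iff.mpr ?_)
        constructor
        · rw [hS, sup_le_iff]
          constructor
          · rw [hspan, Submodule.span_le]
            rintro _ ⟨j, l, hl, rfl⟩
            exact Submodule.subset_span ⟨Fin.castAdd p j, l, by
              rw [Fin.append_left]; omega, by rw [Fin.append_left]⟩
          · rw [hspan, Submodule.map_span, Submodule.span_le]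
            rintro _ ⟨_, ⟨j, l, hl, rfl⟩, rfl⟩
            exact Submodule.subset_span ⟨Fin.castAdd p j, l + 1, by
              rw [Fin.append_left]; omega, by rw [Fin.append_left, pow_succ']; rfl⟩
        · rw [hCspan, Submodule.span_le]
          rintro _ ⟨j, rfl⟩
          exact Submodule.subset_span ⟨Fin.natAdd n j, 0, by simp, by simp⟩
      · rw [Submodule.span_le]
        rintro _ ⟨j, l, hl, rfl⟩
        induction j using Fin.addCases with
        | left j =>
          rw [Fin.append_left] at hl ⊢
          rcases Nat.lt_or_ge (a j) l with h | h
          · obtain ⟨l, rfl⟩ : ∃ l', l = l' + 1 := ⟨l - 1, by omega⟩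
            rw [pow_succ']
            refine hSM (Submodule.mem_sup_right (Submodule.mem_map_of_mem ?_))
            rw [hspan]
            exact Submodule.subset_span ⟨j, l, by omega, rfl⟩
          · apply hNM
            rw [hspan]
            exact Submodule.subset_span ⟨j, l, h, rfl⟩
        | right j =>
          rw [Fin.append_right] at hl ⊢
          obtain rfl : l = 0 := by omega
          exact (b j : M).2
    · rw [Fin.sum_univ_add]
      simp only [Fin.append_left, Fin.append_right]
      rw [Finset.sum_congr rfl fun j _ => (by ring : a j + 1 + 1 = (a j + 1) + 1),
        Finset.sum_add_distrib, hsum]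
      simp
      omega
    · omega
    · intro h j
      have hp0 : p = 0 := by rw [h] at hpM; omega
      induction j using Fin.addCases with
      | left j => rw [Fin.append_left]; omega
      | right j => exact absurd j.2 (by omega)

end Kronecker

section Blocks

variable {k E A : Type*} [Field k] [AddCommGroup E] [Module k E] [CommRing A] [Algebra k A]

/-- `E` has a basis made of strings `y_{j,0}, …, y_{j,a_j}` on which `ρ` takes the values
`x_j, t x_j, …, t ^ a_j x_j`. The basis condition is recorded as spanning by `dim E` vectors. -/
def HasBlocks (ρ : E →ₗ[k] A) (t : A) {n : ℕ} (a : Fin n → ℕ) : Prop :=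
  ∃ (x : Fin n → A) (y : Fin n → ℕ → E),
    (∀ j l, l ≤ a j → ρ (y j l) = t ^ l * x j) ∧
    Submodule.span k {e | ∃ j l, l ≤ a j ∧ e = y j l} = ⊤ ∧
    ∑ j, (a j + 1) = finrank k E

/-- The splitting of a string of length `b + c + 2` into strings of lengths `b + 1`, `c + 1`. -/
theorem HasBlocks.split {ρ : E →ₗ[k] A} {t : A} {n : ℕ} {a : Fin n → ℕ} (h : HasBlocks ρ t a)
    (i : Fin n) (b c : ℕ) (hbc : a i = b + c + 1) :
    HasBlocks ρ t (Fin.cons c (Function.update a i b) : Fin (n + 1) → ℕ) := by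
  obtain ⟨x, y, hxy, hspan, hsum⟩ := h
  refine ⟨Fin.cons (t ^ (b + 1) * x i) x, Fin.cons (fun l => y i (l + b + 1)) y, ?_, ?_, ?_⟩
  · intro j l hl
    induction j using Fin.cases with
    | zero =>
      simp only [Fin.cons_zero] at hl ⊢
      rw [hxy i _ (by omega)]
      ring
    | succ j =>
      simp only [Fin.cons_succ] at hl ⊢
      refine hxy j l (hl.trans ?_)
      rcases eq_or_ne j i with rfl | hj
      · simp; omega
      · simp [hj]
  · rw [eq_top_iff, ← hspan, Submodule.span_le]
    rintro _ ⟨j, l, hl, rfl⟩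
    apply Submodule.subset_span
    rcases eq_or_ne j i with rfl | hj
    · rcases Nat.lt_or_ge b l with h | h
      · exact ⟨0, l - b - 1, by simp; omega, by
          simp only [Fin.cons_zero]; congr 1; omega⟩
      · exact ⟨j.succ, l, by simpa using h, by simp⟩
    · exact ⟨j.succ, l, by simpa [hj] using hl, by simp⟩
  · rw [Fin.sum_univ_succ, ← hsum]
    simp only [Fin.cons_zero, Fin.cons_succ]
    rw [← Finset.add_sum_erase _ _ (Finset.mem_univ i),
      ← Finset.add_sum_erase _ (fun j => a j + 1) (Finset.mem_univ i)]
    have : ∑ j ∈ Finset.univ.erase i, (Function.update a i b j + 1) =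
        ∑ j ∈ Finset.univ.erase i, (a j + 1) :=
      Finset.sum_congr rfl fun j hj => by simp [Finset.ne_of_mem_erase hj]
    rw [this, Function.update_self]
    omega

/-- Two strings of length three can be rearranged into three strings of length two. The middle
one starts at `y_{i,1} + y_{i',0}`. -/
theorem HasBlocks.split_two {ρ : E →ₗ[k] A} {t : A} {n : ℕ} {a : Fin n → ℕ}
    (h : HasBlocks ρ t a) {i i' : Fin n} (hne : i ≠ i') (hi : a i = 2) (hi' : a i' = 2) :
    HasBlocks ρ t
      (Fin.cons 1 (Function.update (Function.update a i 1) i' 1) : Fin (n + 1) → ℕ) := by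
  obtain ⟨x, y, hxy, hspan, hsum⟩ := h
  refine ⟨Fin.cons (t * x i + x i') (Function.update x i' (t * x i')),
    Fin.cons (fun l => y i (l + 1) + y i' l) (Function.update y i' fun l => y i' (l + 1)),
    ?_, ?_, ?_⟩
  · intro j l hl
    induction j using Fin.cases with
    | zero =>
      simp only [Fin.cons_zero] at hl ⊢
      rw [map_add, hxy i _ (by omega), hxy i' _ (by omega)]
      ring
    | succ j =>
      simp only [Fin.cons_succ] at hl ⊢
      rcases eq_or_ne j i' with rfl | hj
      · simp only [Function.update_self] at hl ⊢
        rw [hxy j _ (by omega)]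
        ring
      · simp only [Function.update_of_ne hj] at hl ⊢
        refine hxy j l (hl.trans ?_)
        rcases eq_or_ne j i with rfl | hj'
        · simp; omega
        · simp [hj']
  · rw [eq_top_iff, ← hspan, Submodule.span_le]
    set S := Submodule.span k {e | ∃ (j : Fin (n + 1)) (l : ℕ),
      l ≤ (Fin.cons 1 (Function.update (Function.update a i 1) i' 1) : Fin (n + 1) → ℕ) j ∧
      e = (Fin.cons (fun l => y i (l + 1) + y i' l)
        (Function.update y i' fun l => y i' (l + 1)) : Fin (n + 1) → ℕ → E) j l}
    have hmid : ∀ l ≤ 1, y i (l + 1) + y i' l ∈ S := fun l hl =>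
      Submodule.subset_span ⟨0, l, by simpa using hl, by simp⟩
    have hfst : ∀ l ≤ 1, y i l ∈ S := fun l hl =>
      Submodule.subset_span ⟨i.succ, l, by simpa [hne] using hl, by simp [hne]⟩
    have hsnd : ∀ l ≤ 1, y i' (l + 1) ∈ S := fun l hl =>
      Submodule.subset_span ⟨i'.succ, l, by simpa using hl, by simp⟩
    rintro _ ⟨j, l, hl, rfl⟩
    change y j l ∈ S
    rcases eq_or_ne j i with rfl | hj
    · rcases Nat.lt_or_ge 1 l with h | h
      · obtain rfl : l = 2 := by omega
        exact (Submodule.add_mem_iff_left _ (hsnd 0 (by omega))).mp (hmid 1 le_rfl)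
      · exact hfst l h
    rcases eq_or_ne j i' with rfl | hj'
    · rcases Nat.lt_or_ge 0 l with h | h
      · obtain ⟨l, rfl⟩ : ∃ l', l = l' + 1 := ⟨l - 1, by omega⟩
        exact hsnd l (by omega)
      · obtain rfl : l = 0 := by omega
        exact (Submodule.add_mem_iff_right _ (hfst 1 le_rfl)).mp (hmid 0 (by omega))
    · exact Submodule.subset_span ⟨j.succ, l, by simpa [hj, hj'] using hl, by simp [hj']⟩
  · rw [Fin.sum_univ_succ, ← hsum]
    simp only [Fin.cons_zero, Fin.cons_succ]
    have hmem : i' ∈ Finset.univ.erase i := by simp [hne.symm]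
    rw [← Finset.add_sum_erase _ _ (Finset.mem_univ i), ← Finset.add_sum_erase _ _ hmem,
      ← Finset.add_sum_erase _ (fun j => a j + 1) (Finset.mem_univ i),
      ← Finset.add_sum_erase _ (fun j => a j + 1) hmem]
    have : ∑ j ∈ (Finset.univ.erase i).erase i',
        (Function.update (Function.update a i 1) i' 1 j + 1) =
        ∑ j ∈ (Finset.univ.erase i).erase i', (a j + 1) :=
      Finset.sum_congr rfl fun j hj => by
        simp only [Finset.mem_erase] at hj
        simp [hj.1, hj.2.1]
    rw [this, Function.update_self, Function.update_of_ne hne, Function.update_self, hi, hi']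
    ring

/-- Cutting off the last vectors of strings raises their number to any value up to `dim E`. -/
theorem HasBlocks.exists_of_le {ρ : E →ₗ[k] A} {t : A} {n : ℕ} {a : Fin n → ℕ}
    (h : HasBlocks ρ t a) {s : ℕ} (hn : n ≤ s) (hs : s ≤ finrank k E) :
    ∃ a' : Fin s → ℕ, HasBlocks ρ t a' := by
  induction s, hn using Nat.le_induction with
  | base => exact ⟨a, h⟩
  | succ s _ ih =>
    obtain ⟨a', h'⟩ := ih (by omega)
    obtain ⟨i, hi⟩ : ∃ i, 1 ≤ a' i := by
      by_contra! hc
      obtain ⟨x, y, -, -, hsum⟩ := h'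
      rw [Finset.sum_congr rfl fun i _ => by rw [Nat.lt_one_iff.mp (hc i)]] at hsum
      simp at hsum
      omega
    exact ⟨_, h'.split i (a' i - 1) 0 (by omega)⟩

/-- Strings of length at least two can be cut into `s` strings of length at least two, as long as
`2 s ≤ dim E`. If no string has length four, two strings of length three are recombined. -/
theorem HasBlocks.exists_pos_of_le {ρ : E →ₗ[k] A} {t : A} {n : ℕ} {a : Fin n → ℕ}
    (h : HasBlocks ρ t a) (ha : ∀ i, 1 ≤ a i) {s : ℕ} (hn : n ≤ s) (hs : 2 * s ≤ finrank k E) :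
    ∃ a' : Fin s → ℕ, HasBlocks ρ t a' ∧ ∀ i, 1 ≤ a' i := by
  induction s, hn using Nat.le_induction with
  | base => exact ⟨a, h, ha⟩
  | succ s _ ih =>
    obtain ⟨a', h', ha'⟩ := ih (by omega)
    by_cases h3 : ∃ i, 3 ≤ a' i
    · obtain ⟨i, hi⟩ := h3
      refine ⟨_, h'.split i (a' i - 2) 1 (by omega), fun j => ?_⟩
      induction j using Fin.cases with
      | zero => simp
      | succ j =>
        rcases eq_or_ne j i with rfl | hj
        · simp; omega
        · simpa [hj] using ha' j
    push Not at h3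
    -- All strings have length two or three, and `2 * s + 2 ≤ dim E` leaves two of length three.
    obtain ⟨i, i', hne, hi, hi'⟩ : ∃ i i', i ≠ i' ∧ a' i = 2 ∧ a' i' = 2 := by
      by_contra! hc
      have hsum := h'.choose_spec.choose_spec.2.2
      have : ∑ i, (a' i + 1) ≤ 2 * s + 1 := by
        by_cases hex : ∃ i, a' i = 2
        · obtain ⟨i, hi⟩ := hex
          rw [← Finset.add_sum_erase _ _ (Finset.mem_univ i), hi]
          have : ∑ j ∈ Finset.univ.erase i, (a' j + 1) ≤ (Finset.univ.erase i).card • 2 :=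
            Finset.sum_le_card_nsmul _ _ _ fun j hj => by
              have := hc i j (Finset.ne_of_mem_erase hj).symm hi
              have := h3 j
              omega
          rw [Finset.card_erase_of_mem (Finset.mem_univ i), Finset.card_univ,
            Fintype.card_fin, smul_eq_mul] at this
          have := i.2
          omega
        · push Not at hex
          have : ∑ j, (a' j + 1) ≤ (Finset.univ : Finset (Fin s)).card • 2 :=
            Finset.sum_le_card_nsmul _ _ _ fun j _ => by
              have := hex j
              have := h3 j
              omega
          rw [Finset.card_univ, Fintype.card_fin, smul_eq_mul] at this
          omega
      omega
    refine ⟨_, h'.split_two hne hi hi', fun j => ?_⟩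
    induction j using Fin.cases with
    | zero => simp
    | succ j =>
      rcases eq_or_ne j i' with rfl | hj
      · simp
      rcases eq_or_ne j i with rfl | hj'
      · simp [hne]
      · simpa [hj, hj'] using ha' j

end Blocks

/-! ### Ideals of finite-dimensional algebras with a nondegenerate trace -/

section Ideals

variable {K B : Type*} [Field K] [CommRing B] [Algebra K B]

variable (K) in
/-- The dimension over `K` of an ideal. -/
noncomputable def idim (J : Ideal B) : ℕ := finrank K (J.restrictScalars K)

variable [FiniteDimensional K B]

theorem idim_mono {I J : Ideal B} (h : I ≤ J) : idim K I ≤ idim K J :=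
  Submodule.finrank_mono (s := I.restrictScalars K) (t := J.restrictScalars K) h

theorem eq_of_le_of_idim_le {I J : Ideal B} (h : I ≤ J) (h' : idim K J ≤ idim K I) : I = J := by
  have := Submodule.eq_of_le_of_finrank_le (S₁ := I.restrictScalars K)
    (S₂ := J.restrictScalars K) h h'
  exact Submodule.restrictScalars_injective K B B this

omit [FiniteDimensional K B] in
theorem idim_top : idim K (⊤ : Ideal B) = finrank K B := by
  rw [idim, Submodule.restrictScalars_top, finrank_top]

omit [FiniteDimensional K B] in
theorem idim_bot : idim K (⊥ : Ideal B) = 0 := by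
  rw [idim, Submodule.restrictScalars_bot, finrank_bot]

theorem idim_sup_add_idim_inf (I J : Ideal B) :
    idim K (I ⊔ J) + idim K (I ⊓ J) = idim K I + idim K J := by
  have := Submodule.finrank_sup_add_finrank_inf_eq (I.restrictScalars K) (J.restrictScalars K)
  rwa [← Submodule.restrictScalars_sup, ← Submodule.restrictScalars_inf] at this

omit [FiniteDimensional K B] in
theorem range_mulLeft (u : B) :
    LinearMap.range (LinearMap.mulLeft K u) = (Ideal.span {u}).restrictScalars K := by
  ext x
  simp only [LinearMap.mem_range, LinearMap.mulLeft_apply, Submodule.restrictScalars_mem,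
    Ideal.mem_span_singleton]
  exact ⟨fun ⟨y, h⟩ => ⟨y, h.symm⟩, fun ⟨y, h⟩ => ⟨y, h.symm⟩⟩

theorem mem_torsionOf {u a : B} : a ∈ Ideal.torsionOf B B u ↔ a * u = 0 := Iff.rfl

omit [FiniteDimensional K B] in
theorem ker_mulLeft (u : B) :
    LinearMap.ker (LinearMap.mulLeft K u) = (Ideal.torsionOf B B u).restrictScalars K := by
  ext x
  simp [mul_comm]

theorem idim_span_add_idim_torsionOf (u : B) :
    idim K (Ideal.span {u}) + idim K (Ideal.torsionOf B B u) = finrank K B := by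
  have := LinearMap.finrank_range_add_finrank_ker (LinearMap.mulLeft K u)
  rwa [range_mulLeft, ker_mulLeft] at this

theorem idim_torsionOf_mul_le (x y : B) :
    idim K (Ideal.torsionOf B B (x * y)) ≤
      idim K (Ideal.torsionOf B B x) + idim K (Ideal.torsionOf B B y) := by
  let f : (Ideal.torsionOf B B (x * y)).restrictScalars K →ₗ[K]
      (Ideal.torsionOf B B x).restrictScalars K :=
    LinearMap.codRestrict _ (LinearMap.mulLeft K y ∘ₗ Submodule.subtype _) fun z => by
      have := mem_torsionOf.mp z.2
      change y * (z : B) ∈ Ideal.torsionOf B B x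
      rw [mem_torsionOf, ← this]
      ring
  have h1 := LinearMap.finrank_range_add_finrank_ker f
  have h2 : finrank K (LinearMap.range f) ≤ idim K (Ideal.torsionOf B B x) :=
    Submodule.finrank_le _
  have h3 : finrank K (LinearMap.ker f) ≤ idim K (Ideal.torsionOf B B y) := by
    refine (LinearEquiv.finrank_eq (Submodule.equivMapOfInjective (Submodule.subtype _)
      (Submodule.injective_subtype _) (LinearMap.ker f))).trans_le (Submodule.finrank_mono ?_)
    rintro _ ⟨z, hz, rfl⟩
    have : y * (z : B) = 0 := congrArg Subtype.val (LinearMap.mem_ker.mp hz)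
    change (z : B) ∈ Ideal.torsionOf B B y
    rw [mem_torsionOf, mul_comm, this]
  rw [idim, ← h1]
  omega

omit [FiniteDimensional K B] in
theorem finrank_map_mulLeft_of_isUnit {u : B} (hu : IsUnit u) (V : Submodule K B) :
    finrank K (V.map (LinearMap.mulLeft K u)) = finrank K V := by
  refine (Submodule.equivMapOfInjective _ ?_ V).finrank_eq.symm
  exact fun x y h => hu.mul_left_cancel h

/-- A linear functional whose kernel contains no nonzero ideal: the pairing `τ (x y)` is
nondegenerate. A finite-dimensional algebra has one if and only if it is Gorenstein. -/
def IsTrace (τ : B →ₗ[K] K) : Prop := ∀ x, (∀ y, τ (x * y) = 0) → x = 0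

/-- The bilinear form `τ (x y)`. -/
noncomputable def traceForm (τ : B →ₗ[K] K) : LinearMap.BilinForm K B :=
  (LinearMap.mul K B).compr₂ τ

omit [FiniteDimensional K B] in
theorem traceForm_apply (τ : B →ₗ[K] K) (x y : B) : traceForm τ x y = τ (x * y) := rfl

omit [FiniteDimensional K B] in
theorem traceForm_isSymm (τ : B →ₗ[K] K) : (traceForm τ).IsSymm :=
  ⟨fun x y => by simp [traceForm_apply, mul_comm]⟩

omit [FiniteDimensional K B] in
theorem IsTrace.nondegenerate {τ : B →ₗ[K] K} (h : IsTrace τ) : (traceForm τ).Nondegenerate :=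
  ⟨fun x hx => h x hx, fun x hx => h x fun y => by rw [mul_comm]; exact hx y⟩

/-- The orthogonal complement for the trace pairing. -/
noncomputable def orth (τ : B →ₗ[K] K) (V : Submodule K B) : Submodule K B :=
  (traceForm τ).orthogonal V

omit [FiniteDimensional K B] in
theorem mem_orth {τ : B →ₗ[K] K} {V : Submodule K B} {x : B} :
    x ∈ orth τ V ↔ ∀ y ∈ V, τ (y * x) = 0 := LinearMap.BilinForm.mem_orthogonal_iff

theorem IsTrace.finrank_orth {τ : B →ₗ[K] K} (h : IsTrace τ) (V : Submodule K B) :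
    finrank K (orth τ V) + finrank K V = finrank K B := by
  have := LinearMap.BilinForm.finrank_orthogonal h.nondegenerate V
  have := Submodule.finrank_le V
  rw [orth]
  omega

theorem IsTrace.orth_orth {τ : B →ₗ[K] K} (h : IsTrace τ) (V : Submodule K B) :
    orth τ (orth τ V) = V :=
  LinearMap.BilinForm.orthogonal_orthogonal h.nondegenerate (traceForm_isSymm τ).isRefl V

omit [FiniteDimensional K B] in
theorem IsTrace.orth_ideal {τ : B →ₗ[K] K} (h : IsTrace τ) (J : Ideal B) :
    orth τ (J.restrictScalars K) = J.annihilator.restrictScalars K := by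
  ext x
  rw [mem_orth, Submodule.restrictScalars_mem, Submodule.mem_annihilator]
  constructor
  · intro hx y hy
    refine h _ fun z => ?_
    rw [smul_eq_mul, show x * y * z = (y * z) * x by ring]
    exact hx _ (J.mul_mem_right z hy)
  · intro hx y hy
    rw [mul_comm, ← smul_eq_mul, hx y hy, map_zero]

theorem IsTrace.idim_annihilator {τ : B →ₗ[K] K} (h : IsTrace τ) (J : Ideal B) :
    idim K J.annihilator + idim K J = finrank K B := by
  rw [idim, ← h.orth_ideal, idim, h.finrank_orth]

theorem IsTrace.annihilator_annihilator {τ : B →ₗ[K] K} (h : IsTrace τ) (J : Ideal B) :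
    J.annihilator.annihilator = J := by
  refine (eq_of_le_of_idim_le (K := K) ?_ ?_).symm
  · intro x hx
    rw [Submodule.mem_annihilator]
    intro y hy
    rw [smul_eq_mul, mul_comm]
    exact Submodule.mem_annihilator.mp hy x hx
  · have := h.idim_annihilator J
    have := h.idim_annihilator J.annihilator
    omega

omit [FiniteDimensional K B] in
theorem torsionOf_eq_annihilator (u : B) :
    Ideal.torsionOf B B u = (Ideal.span {u}).annihilator := by
  ext x
  rw [Ideal.span, Submodule.mem_annihilator_span_singleton, mem_torsionOf, smul_eq_mul]

end Ideals

section Characters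

variable {K B : Type*} [Field K] [IsAlgClosed K] [CommRing B] [Algebra K B]
  [FiniteDimensional K B]

/-- Over an algebraically closed field the maximal ideals are the kernels of the characters. -/
theorem exists_character (m : Ideal B) [m.IsMaximal] : ∃ χ : B →ₐ[K] K, ∀ a, χ a = 0 ↔ a ∈ m := by
  have hb : Function.Bijective (algebraMap K (B ⧸ m)) :=
    IsAlgClosed.algebraMap_bijective_of_isIntegral
  let e : K ≃ₐ[K] (B ⧸ m) := AlgEquiv.ofBijective (Algebra.ofId K (B ⧸ m)) hb
  refine ⟨(e.symm : (B ⧸ m) →ₐ[K] K).comp (Ideal.Quotient.mkₐ K m), fun a => ?_⟩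
  simp [Ideal.Quotient.eq_zero_iff_mem]

/-- A common eigenvector modulo `I`: a proper inclusion of ideals can be refined by an ideal
`I + K v`. -/
theorem exists_eigenvector {I Q : Ideal B} (hIQ : I < Q) :
    ∃ v ∈ Q, v ∉ I ∧ ∃ χ : B →ₐ[K] K, ∀ a, a * v - χ a • v ∈ I := by
  have : IsArtinianRing B := IsArtinianRing.of_finite K B
  obtain ⟨P, ⟨hIP, hPQ⟩, hmin⟩ := exists_minimal_of_wellFoundedLT
    (fun P : Ideal B => I < P ∧ P ≤ Q) ⟨Q, hIQ, le_rfl⟩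
  obtain ⟨v, hvP, hvI⟩ := SetLike.exists_of_lt hIP
  let c : Ideal B := Submodule.comap (LinearMap.mulRight B v) I
  have hc : ∀ a, a ∈ c ↔ a * v ∈ I := fun a => Iff.rfl
  have hmax : c.IsMaximal := by
    rw [Ideal.isMaximal_iff]
    refine ⟨by rwa [hc, one_mul], fun J a hcJ hac haJ => ?_⟩
    have h1 : I < I ⊔ Ideal.span {a * v} := by
      refine lt_of_le_of_ne le_sup_left fun h => hac ?_
      rw [hc, h]
      exact Ideal.mem_sup_right (Ideal.mem_span_singleton_self _)
    have h2 : I ⊔ Ideal.span {a * v} ≤ P :=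
      sup_le hIP.le ((Ideal.span_singleton_le_iff_mem _).mpr (P.mul_mem_left a hvP))
    have h3 := hmin ⟨h1, h2.trans hPQ⟩ h2 hvP
    obtain ⟨i, hi, w, hw, hiw⟩ := Submodule.mem_sup.mp h3
    obtain ⟨b, rfl⟩ := Ideal.mem_span_singleton.mp hw
    have h4 : 1 - b * a ∈ c := by
      rw [hc, show (1 - b * a) * v = i by rw [← sub_eq_zero]; linear_combination -hiw]
      exact hi
    have := J.add_mem (hcJ h4) (J.mul_mem_left b haJ)
    simpa using this
  obtain ⟨χ, hχ⟩ := exists_character (K := K) c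
  refine ⟨v, hPQ hvP, hvI, χ, fun a => ?_⟩
  have : a - algebraMap K B (χ a) ∈ c := by
    rw [← hχ]
    simp
  rw [hc, sub_mul, ← Algebra.smul_def] at this
  exact this

omit [IsAlgClosed K] in
theorem idim_sup_span_of_eigenvector {I : Ideal B} {v : B} (hv : v ∉ I) {χ : B →ₐ[K] K}
    (h : ∀ a, a * v - χ a • v ∈ I) : idim K (I ⊔ Ideal.span {v}) = idim K I + 1 := by
  have h1 : (I ⊔ Ideal.span {v}).restrictScalars K =
      I.restrictScalars K ⊔ Submodule.span K {v} := by
    apply le_antisymm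
    · rw [Submodule.restrictScalars_sup, sup_le_iff]
      refine ⟨le_sup_left, fun x hx => ?_⟩
      obtain ⟨b, rfl⟩ := Ideal.mem_span_singleton'.mp hx
      rw [← sub_add_cancel (b * v) (χ b • v)]
      exact add_mem (Submodule.mem_sup_left (h b)) (Submodule.mem_sup_right
        (Submodule.smul_mem _ _ (Submodule.mem_span_singleton_self v)))
    · rw [Submodule.restrictScalars_sup, sup_le_iff]
      refine ⟨le_sup_left, Submodule.span_le.mpr ?_⟩
      rw [Set.singleton_subset_iff]
      exact Submodule.mem_sup_right (Ideal.mem_span_singleton_self v)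
  have h2 := Submodule.finrank_sup_add_finrank_inf_eq (I.restrictScalars K) (Submodule.span K {v})
  have h3 : I.restrictScalars K ⊓ Submodule.span K {v} = ⊥ := by
    rw [← disjoint_iff]
    exact Submodule.disjoint_span_singleton_of_notMem hv
  have hv0 : v ≠ 0 := fun h0 => hv (h0 ▸ I.zero_mem)
  rw [h3, finrank_bot, finrank_span_singleton hv0] at h2
  rw [idim, h1, idim]
  omega

theorem exists_ideal_between {I Q : Ideal B} (hIQ : I ≤ Q) (d : ℕ) (hI : idim K I ≤ d)
    (hQ : d ≤ idim K Q) : ∃ P, I ≤ P ∧ P ≤ Q ∧ idim K P = d := by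
  induction d, hI using Nat.le_induction with
  | base => exact ⟨I, le_rfl, hIQ, rfl⟩
  | succ d _ ih =>
    obtain ⟨P, hIP, hPQ, rfl⟩ := ih (by omega)
    have hlt : P < Q := lt_of_le_of_ne hPQ (by rintro rfl; omega)
    obtain ⟨v, hvQ, hvP, χ, hχ⟩ := exists_eigenvector (K := K) hlt
    exact ⟨P ⊔ Ideal.span {v}, hIP.trans le_sup_left,
      sup_le hPQ ((Ideal.span_singleton_le_iff_mem _).mpr hvQ),
      idim_sup_span_of_eigenvector hvP hχ⟩

theorem idim_maximal (m : Ideal B) [m.IsMaximal] : idim K m + 1 = finrank K B := by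
  obtain ⟨χ, hχ⟩ := exists_character (K := K) m
  have h1 := LinearMap.finrank_range_add_finrank_ker χ.toLinearMap
  have h2 : LinearMap.ker χ.toLinearMap = m.restrictScalars K := by
    ext x
    exact hχ x
  have h3 : LinearMap.range χ.toLinearMap = ⊤ := by
    rw [LinearMap.range_eq_top]
    exact fun c => ⟨algebraMap K B c, by simp⟩
  rw [h2, h3, finrank_top, finrank_self] at h1
  rw [idim]
  omega

end Characters

section Idempotents

variable {K B : Type*} [Field K] [CommRing B] [Algebra K B] [FiniteDimensional K B]

omit [FiniteDimensional K B] in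
theorem torsionOf_idempotent {e : B} (he : e * e = e) :
    Ideal.torsionOf B B e = Ideal.span {1 - e} := by
  ext x
  rw [mem_torsionOf, Ideal.mem_span_singleton']
  constructor
  · intro h
    exact ⟨x, by rw [mul_sub, h, mul_one, sub_zero]⟩
  · rintro ⟨b, rfl⟩
    linear_combination -b * he

theorem idim_idempotent {e : B} (he : e * e = e) :
    idim K (Ideal.span {e}) + idim K (Ideal.span {1 - e}) = finrank K B := by
  rw [← torsionOf_idempotent he, idim_span_add_idim_torsionOf]

/-- A subset sum argument on the local factors of `B`: either they can be split into two groups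
of dimension at least `s` each, or a single one has dimension at least `2 s`. -/
theorem exists_idempotent {s : ℕ} (hs : 3 * s + 1 ≤ finrank K B) :
    ∃ e : B, e * e = e ∧ s ≤ idim K (Ideal.span {e}) ∧
      (s ≤ idim K (Ideal.span {1 - e}) ∨
        2 * s ≤ idim K (Ideal.span {e}) ∧ ∀ f, f * f = f → f * e = f → f = 0 ∨ f = e) := by
  obtain ⟨e, ⟨he, hse⟩, hmin⟩ := WellFounded.has_min
    (InvImage.wf (fun e : B => idim K (Ideal.span {e})) Nat.lt_wfRel.wf)
    {e : B | e * e = e ∧ s ≤ idim K (Ideal.span {e})}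
    ⟨1, one_mul 1, by rw [Ideal.span_singleton_one, idim_top]; omega⟩
  refine ⟨e, he, hse, ?_⟩
  by_cases h : s ≤ idim K (Ideal.span {1 - e})
  · exact Or.inl h
  right
  have h2 := idim_idempotent (K := K) he
  refine ⟨by omega, fun f hf hfe => ?_⟩
  by_contra! hne
  have hlt : ∀ g : B, g * g = g → g * e = g → g ≠ e → idim K (Ideal.span {g}) < s := by
    intro g hg hge hgne
    by_contra! hsg
    refine hmin g ⟨hg, hsg⟩ (lt_of_not_ge fun hle => hgne ?_)
    have hle' : Ideal.span {g} ≤ Ideal.span {e} := by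
      rw [Ideal.span_singleton_le_span_singleton]
      exact ⟨g, by rw [mul_comm, hge]⟩
    have hmem : e ∈ Ideal.span {g} := by
      rw [eq_of_le_of_idim_le hle' hle]
      exact Ideal.mem_span_singleton_self e
    obtain ⟨b, hb⟩ := Ideal.mem_span_singleton.mp hmem
    rw [← hge, hb, ← mul_assoc, hg]
  have hf' := hlt f hf hfe hne.2
  have hg' := hlt (e - f) (by linear_combination he + hf - 2 * hfe)
    (by linear_combination he - hfe) fun h => hne.1 (by simpa using h)
  have hle : Ideal.span {e} ≤ Ideal.span {f} ⊔ Ideal.span {e - f} := by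
    rw [Ideal.span_singleton_le_iff_mem]
    have := add_mem (Ideal.mem_sup_left (Ideal.mem_span_singleton_self f))
      (Ideal.mem_sup_right (S := Ideal.span {f}) (Ideal.mem_span_singleton_self (e - f)))
    rwa [add_sub_cancel] at this
  have h3 := idim_mono (K := K) hle
  have h4 := idim_sup_add_idim_inf (K := K) (Ideal.span {f}) (Ideal.span {e - f})
  omega

/-- On the local factor of a primitive idempotent, every element outside the units is nilpotent;
so there is only one character. -/
theorem character_eq_of_primitive {e : B} (hprim : ∀ f, f * f = f → f * e = f → f = 0 ∨ f = e)
    {χ χ' : B →ₐ[K] K} (h : χ e = 1) (h' : χ' e = 1) (he : e * e = e) : χ = χ' := by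
  have key : ∀ a, χ a = 0 → χ' a = 0 := by
    intro a ha
    have : IsArtinianRing B := IsArtinianRing.of_finite K B
    obtain ⟨n, y, hy⟩ := IsArtinian.exists_pow_succ_smul_dvd a (1 : B)
    simp only [smul_eq_mul, mul_one, Nat.succ_eq_add_one] at hy
    have hk : ∀ k : ℕ, a ^ (n + 1) = a ^ (n + 1 + k) * y ^ k := by
      intro k
      induction k with
      | zero => simp
      | succ k ih =>
        rw [ih]
        calc a ^ (n + 1 + k) * y ^ k = a ^ n * (a * a ^ k * y ^ k) := by ring
          _ = a ^ (n + 1) * y * (a * a ^ k * y ^ k) := by rw [hy]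
          _ = _ := by ring
    have hk' := hk (n + 1)
    set z := a ^ (n + 1) * y ^ (n + 1) with hz
    have hzz : z * z = z := by
      calc z * z = (a ^ (n + 1 + (n + 1)) * y ^ (n + 1)) * y ^ (n + 1) := by rw [hz]; ring
        _ = z := by rw [← hk', hz]
    rcases hprim (e * z) (by linear_combination z * z * he + e * hzz)
      (by linear_combination z * he) with h0 | h0
    · have h1 : e * a ^ (n + 1) = 0 := by
        calc e * a ^ (n + 1) = e * (a ^ (n + 1 + (n + 1)) * y ^ (n + 1)) := by rw [← hk']
          _ = e * z * a ^ (n + 1) := by rw [hz]; ring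
          _ = 0 := by rw [h0, zero_mul]
      have h2 := congrArg χ' h1
      rw [map_mul, h', one_mul, map_pow, map_zero] at h2
      exact pow_eq_zero_iff (by omega) |>.mp h2
    · have h1 := congrArg χ h0
      rw [map_mul, hz, map_mul, map_pow, ha, h] at h1
      simp at h1
  ext a
  have := key (a - algebraMap K B (χ a)) (by simp)
  simp only [map_sub, AlgHom.commutes, sub_eq_zero] at this
  exact this.symm

end Idempotents

section SquareZero

variable {K B : Type*} [Field K] [IsAlgClosed K] [CommRing B] [Algebra K B]
  [FiniteDimensional K B]

omit [FiniteDimensional K B] in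
/-- A quadratic form on a plane over an algebraically closed field has an isotropic vector. -/
theorem exists_isotropic (τ : B →ₗ[K] K) (v w : B) :
    ∃ x, (x = w ∨ ∃ c : K, x = v + c • w) ∧ τ (x * x) = 0 := by
  by_cases hw : τ (w * w) = 0
  · exact ⟨w, Or.inl rfl, hw⟩
  let p : Polynomial K := Polynomial.C (τ (w * w)) * Polynomial.X ^ 2 +
    Polynomial.C (τ (v * w) + τ (v * w)) * Polynomial.X + Polynomial.C (τ (v * v))
  have hp : p.degree ≠ 0 := by
    rw [Polynomial.degree_quadratic hw]
    decide
  obtain ⟨c, hc⟩ := IsAlgClosed.exists_root p hp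
  refine ⟨v + c • w, Or.inr ⟨c, rfl⟩, ?_⟩
  have h1 : (v + c • w) * (v + c • w) =
      c ^ 2 • (w * w) + c • (v * w) + c • (v * w) + v * v := by
    simp only [Algebra.smul_def, map_pow]
    ring
  rw [h1]
  simp only [map_add, map_smul, smul_eq_mul]
  simp only [p, Polynomial.IsRoot.def, Polynomial.eval_add, Polynomial.eval_mul,
    Polynomial.eval_C, Polynomial.eval_pow, Polynomial.eval_X] at hc
  linear_combination hc

/-- A local Gorenstein algebra over an algebraically closed field contains ideals of square zero
of every dimension up to half its own. This is shown by enlarging an ideal `I` of square zero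
inside `I^⊥ = ann I`, by an isotropic eigenvector of `I^⊥ / I`. -/
theorem exists_square_zero {τ : B →ₗ[K] K} (hτ : IsTrace τ) {e : B} (he : e * e = e)
    (hprim : ∀ f, f * f = f → f * e = f → f = 0 ∨ f = e) (d : ℕ)
    (hd : 2 * d ≤ idim K (Ideal.span {e})) :
    ∃ I : Ideal B, I ≤ Ideal.span {e} ∧ idim K I = d ∧ I ≤ I.annihilator := by
  induction d with
  | zero => exact ⟨⊥, bot_le, idim_bot, bot_le⟩
  | succ d ih =>
    obtain ⟨I, hIe, hId, hII⟩ := ih (by omega)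
    have hann : ∀ {x y}, x ∈ I.annihilator → y ∈ I → x * y = 0 := fun hx hy =>
      Submodule.mem_annihilator.mp hx _ hy
    set Q := I.annihilator ⊓ Ideal.span {e} with hQ
    have hIQ : I ≤ Q := le_inf hII hIe
    have hQdim : d + 2 ≤ idim K Q := by
      have h1 := hτ.idim_annihilator I
      have h2 := idim_idempotent (K := K) he
      have h3 : I.annihilator ≤ Q ⊔ Ideal.span {1 - e} := by
        intro x hx
        rw [show x = x * e + x * (1 - e) by ring]
        refine add_mem (Ideal.mem_sup_left ⟨?_, ?_⟩) (Ideal.mem_sup_right ?_)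
        · exact Ideal.mul_mem_right _ _ hx
        · exact Ideal.mul_mem_left _ _ (Ideal.mem_span_singleton_self e)
        · exact Ideal.mul_mem_left _ _ (Ideal.mem_span_singleton_self _)
      have h4 := idim_mono (K := K) h3
      have h5 := idim_sup_add_idim_inf (K := K) Q (Ideal.span {1 - e})
      omega
    have hχe : ∀ {I' : Ideal B} {v : B} {χ : B →ₐ[K] K}, v ∈ Q → v ∉ I' →
        (∀ a, a * v - χ a • v ∈ I') → χ e = 1 := by
      intro I' v χ hvQ hvI h
      have hev : e * v = v := by
        obtain ⟨b, rfl⟩ := Ideal.mem_span_singleton.mp hvQ.2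
        rw [← mul_assoc, he]
      have h1 := h e
      rw [hev, ← one_smul K v, smul_smul, ← sub_smul, mul_one] at h1
      by_contra hne
      have hne' : 1 - χ e ≠ 0 := sub_ne_zero.mpr (Ne.symm hne)
      have h2 := (I'.restrictScalars K).smul_mem (1 - χ e)⁻¹ h1
      rw [smul_smul, inv_mul_cancel₀ hne', one_smul] at h2
      exact hvI h2
    obtain ⟨v, hvQ, hvI, χ, hχ⟩ := exists_eigenvector (K := K)
      (lt_of_le_of_ne hIQ (by rintro h; rw [← h] at hQdim; omega))
    have hP := idim_sup_span_of_eigenvector hvI hχ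
    set P := I ⊔ Ideal.span {v} with hPdef
    have hPQ : P ≤ Q := sup_le hIQ ((Ideal.span_singleton_le_iff_mem _).mpr hvQ)
    obtain ⟨w, hwQ, hwP, χ', hχ'⟩ := exists_eigenvector (K := K)
      (lt_of_le_of_ne hPQ (by rintro h; rw [h] at hP; omega))
    obtain rfl : χ = χ' := character_eq_of_primitive hprim (hχe hvQ hvI hχ) (hχe hwQ hwP hχ') he
    have hsub : ∀ (a x : B), a * x - χ a • x = (a - algebraMap K B (χ a)) * x := fun a x => by
      rw [sub_mul, Algebra.smul_def]
    suffices h : ∃ x ∈ Q, x ∉ I ∧ x * x = 0 ∧ ∀ a, a * x - χ a • x ∈ I by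
      obtain ⟨x, hxQ, hxI, hxx, hx⟩ := h
      refine ⟨I ⊔ Ideal.span {x}, sup_le hIe ((Ideal.span_singleton_le_iff_mem _).mpr hxQ.2),
        by rw [idim_sup_span_of_eigenvector hxI hx, hId], ?_⟩
      intro y hy
      rw [Submodule.mem_annihilator]
      intro z hz
      obtain ⟨i, hi, _, hy', rfl⟩ := Submodule.mem_sup.mp hy
      obtain ⟨j, hj, _, hz', rfl⟩ := Submodule.mem_sup.mp hz
      obtain ⟨b, rfl⟩ := Ideal.mem_span_singleton.mp hy'
      obtain ⟨c, rfl⟩ := Ideal.mem_span_singleton.mp hz'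
      rw [smul_eq_mul]
      linear_combination hann (hII hi) hj + b * hann hxQ.1 hj + c * hann hxQ.1 hi + b * c * hxx
    by_cases hcase : ∀ a, a * w - χ a • w ∈ I
    · obtain ⟨x, hx, hxx⟩ := exists_isotropic τ v w
      have hwI : w ∉ I := fun h => hwP (Ideal.mem_sup_left h)
      have hxQ : x ∈ Q := by
        rcases hx with rfl | ⟨c, rfl⟩
        · exact hwQ
        · exact add_mem hvQ ((Q.restrictScalars K).smul_mem c hwQ)
      have hxI : x ∉ I := by
        rcases hx with rfl | ⟨c, rfl⟩
        · exact hwI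
        · intro h
          by_cases hc : c = 0
          · rw [hc, zero_smul, add_zero] at h
            exact hvI h
          · have h1 : c • w ∈ P := by
              rw [show c • w = (v + c • w) - v by ring]
              exact sub_mem (Ideal.mem_sup_left h)
                (Ideal.mem_sup_right (Ideal.mem_span_singleton_self v))
            have h2 := (P.restrictScalars K).smul_mem c⁻¹ h1
            rw [smul_smul, inv_mul_cancel₀ hc, one_smul] at h2
            exact hwP h2
      have hxa : ∀ a, a * x - χ a • x ∈ I := by
        intro a
        rcases hx with rfl | ⟨c, rfl⟩
        · exact hcase a
        · rw [hsub, mul_add, mul_smul_comm, ← hsub, ← hsub]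
          exact add_mem (hχ a) ((I.restrictScalars K).smul_mem c (hcase a))
      refine ⟨x, hxQ, hxI, hτ _ fun a => ?_, hxa⟩
      have h1 : (a * x - χ a • x) * x = 0 := by rw [mul_comm]; exact hann hxQ.1 (hxa a)
      rw [sub_mul, sub_eq_zero, smul_mul_assoc] at h1
      rw [show x * x * a = a * x * x by ring, h1, map_smul, hxx, smul_zero]
    · push Not at hcase
      obtain ⟨a, ha⟩ := hcase
      refine ⟨v, hvQ, hvI, ?_, hχ⟩
      -- `(a - χ a) w = i + b v` with `b` a unit modulo the annihilator of `v` in `P / I`.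
      obtain ⟨i, hi, _, hb, hib⟩ := Submodule.mem_sup.mp (hχ' a)
      obtain ⟨b, rfl⟩ := Ideal.mem_span_singleton.mp hb
      have hb0 : χ b ≠ 0 := by
        intro h0
        have := hχ b
        rw [h0, zero_smul, sub_zero, mul_comm] at this
        exact ha (hib ▸ add_mem hi this)
      have h1 : (b * v - χ b • v) * v = 0 := by rw [mul_comm]; exact hann hvQ.1 (hχ b)
      have h2 : w * (a * v - χ a • v) = 0 := hann hwQ.1 (hχ a)
      have h3 : v * i = 0 := hann hvQ.1 hi
      rw [hsub] at h2 hib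
      have h4 : χ b • (v * v) = 0 := by
        rw [sub_mul, smul_mul_assoc] at h1
        linear_combination h2 - h3 + v * hib - h1
      exact (smul_eq_zero.mp h4).resolve_left hb0

end SquareZero

/-! ### Linearly general position and Gale duality -/

section GeneralPosition

variable {K B : Type*} [Field K] [CommRing B] [Algebra K B]

/-- A space `M` of functions on a finite scheme `Γ = Spec B` is in general position if every
closed subscheme `Z` of `Γ` on which some nonzero element of `M` vanishes has degree at most the
rank of the restriction `M → O_Z`. -/
def InGeneralPosition (M : Submodule K B) : Prop :=
  ∀ J : Ideal B, J.restrictScalars K ⊓ M ≠ ⊥ →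
    finrank K B + finrank K ↥(J.restrictScalars K ⊓ M) ≤ finrank K M + idim K J

variable [FiniteDimensional K B]

theorem InGeneralPosition.lt_idim_span {M : Submodule K B} (hM : InGeneralPosition M) {w : B}
    (hw : w ∈ M) (hw0 : w ≠ 0) : finrank K B + 1 ≤ finrank K M + idim K (Ideal.span {w}) := by
  have hmem : w ∈ (Ideal.span {w}).restrictScalars K ⊓ M :=
    ⟨Ideal.mem_span_singleton_self w, hw⟩
  have hne : (Ideal.span {w}).restrictScalars K ⊓ M ≠ ⊥ := fun h =>
    hw0 ((Submodule.mem_bot K).mp (h ▸ hmem))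
  have h1 := hM _ hne
  have h2 : 1 ≤ finrank K ↥((Ideal.span {w}).restrictScalars K ⊓ M) := by
    rw [Nat.one_le_iff_ne_zero]
    exact fun h => hne (Submodule.finrank_eq_zero.mp h)
  omega

/-- Gale duality preserves general position: for `u` in the orthogonal complement of `M`, the
functional `τ (u ·)` kills both `M` and `ann u`, so these do not span `B`. -/
theorem InGeneralPosition.lt_idim_span_of_mem_orth {τ : B →ₗ[K] K} (hτ : IsTrace τ)
    {M : Submodule K B} (hM : InGeneralPosition M) {u : B} (hu : u ∈ orth τ M) (hu0 : u ≠ 0) :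
    finrank K M + 1 ≤ idim K (Ideal.span {u}) := by
  set J := Ideal.torsionOf B B u with hJ
  have h1 := idim_span_add_idim_torsionOf (K := K) u
  rw [← hJ] at h1
  have h2 : J.restrictScalars K ⊔ M ≠ ⊤ := by
    intro h
    refine hu0 (hτ u fun y => ?_)
    obtain ⟨j, hj, w, hw, rfl⟩ := Submodule.mem_sup.mp (h ▸ Submodule.mem_top : y ∈ _)
    have hj' : j * u = 0 := mem_torsionOf.mp hj
    rw [mul_add, mul_comm u j, hj', zero_add, mul_comm]
    exact mem_orth.mp hu w hw
  have h3 := Submodule.finrank_lt h2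
  have h4 := Submodule.finrank_sup_add_finrank_inf_eq (J.restrictScalars K) M
  rw [← idim] at h4
  by_cases h5 : J.restrictScalars K ⊓ M = ⊥
  · rw [h5, finrank_bot] at h4
    omega
  · have := hM J h5
    omega

/-- The Gale dual linear series has no base points: if it lay in a maximal ideal `m`, then the
socle `ann m` would lie in `M`, and its elements vanish in too high a degree. -/
theorem InGeneralPosition.exists_isUnit_mem_orth [IsAlgClosed K] {τ : B →ₗ[K] K} (hτ : IsTrace τ)
    {M : Submodule K B} (hM : InGeneralPosition M) (hlt : finrank K M < finrank K B) :
    ∃ u ∈ orth τ M, IsUnit u := by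
  have : IsArtinianRing B := IsArtinianRing.of_finite K B
  have : Infinite K := IsAlgClosed.instInfinite
  by_contra! hno
  obtain ⟨m, hm⟩ := Subspace.exists_eq_top_of_iUnion_eq_univ (k := K) (E := orth τ M)
    (p := fun m : MaximalSpectrum B =>
      (m.asIdeal.restrictScalars K).comap (orth τ M).subtype) (by
    rw [Set.eq_univ_iff_forall]
    intro u
    obtain ⟨I, hI, huI⟩ := exists_max_ideal_of_mem_nonunits (hno u u.2)
    exact Set.mem_iUnion.mpr ⟨⟨I, hI⟩, huI⟩)
  have := m.isMaximal
  have hle : orth τ M ≤ m.asIdeal.restrictScalars K := fun u hu => by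
    have : (⟨u, hu⟩ : orth τ M) ∈ (m.asIdeal.restrictScalars K).comap (orth τ M).subtype :=
      hm ▸ Submodule.mem_top
    exact this
  have hle' : m.asIdeal.annihilator.restrictScalars K ≤ M := by
    rw [← hτ.orth_ideal, ← hτ.orth_orth M]
    exact LinearMap.BilinForm.orthogonal_le hle
  have h1 := idim_maximal (K := K) m.asIdeal
  have h2 := hτ.idim_annihilator m.asIdeal
  obtain ⟨p, hp, hp0⟩ := Submodule.exists_mem_ne_zero_of_ne_bot (p := m.asIdeal.annihilator) (by
    intro h
    rw [h, idim_bot] at h2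
    omega)
  have h3 := hM.lt_idim_span (hle' hp) hp0
  have h4 := idim_span_add_idim_torsionOf (K := K) p
  have h5 : idim K m.asIdeal ≤ idim K (Ideal.torsionOf B B p) := idim_mono fun x hx => by
    rw [mem_torsionOf, mul_comm]
    exact Submodule.mem_annihilator.mp hp x hx
  omega

end GeneralPosition

section Pencils

variable {K B : Type*} [Field K] [CommRing B] [Algebra K B] [FiniteDimensional K B]

/-- The space `u₀² V + u₀ u₁ V + u₁² V`. -/
noncomputable def quadSpan (V : Submodule K B) (u₀ u₁ : B) : Submodule K B :=
  V.map (LinearMap.mulLeft K (u₀ * u₀)) ⊔ V.map (LinearMap.mulLeft K (u₀ * u₁)) ⊔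
    V.map (LinearMap.mulLeft K (u₁ * u₁))

/-- If the only relations `a u₀² + b u₀ u₁ + c u₁² = 0` with coefficients in `V` are the
Koszul ones, then `u₀² V + u₀ u₁ V + u₁² V` has dimension at least `3 dim V - 2`. -/
theorem finrank_quadSpan {V : Submodule K B} {u₀ u₁ : B} (h₀ : u₀ ∈ V) (h₁ : u₁ ∈ V)
    (h : ∀ a ∈ V, ∀ b ∈ V, ∀ c ∈ V, u₀ * u₀ * a + u₀ * u₁ * b + u₁ * u₁ * c = 0 →
      ∃ α β : K, a = α • u₁ ∧ b = -(α • u₀) - β • u₁ ∧ c = β • u₀) :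
    3 * finrank K V ≤ finrank K (quadSpan V u₀ u₁) + 2 := by
  let f : ((V × V) × V) →ₗ[K] B :=
    LinearMap.coprod (LinearMap.coprod (LinearMap.mulLeft K (u₀ * u₀) ∘ₗ V.subtype)
      (LinearMap.mulLeft K (u₀ * u₁) ∘ₗ V.subtype)) (LinearMap.mulLeft K (u₁ * u₁) ∘ₗ V.subtype)
  have hr : LinearMap.range f = quadSpan V u₀ u₁ := by
    simp only [f, LinearMap.range_coprod, LinearMap.range_comp, Submodule.range_subtype, quadSpan]
  have h1 := LinearMap.finrank_range_add_finrank_ker f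
  let w₀ : V := ⟨u₀, h₀⟩
  let w₁ : V := ⟨u₁, h₁⟩
  let g : (K × K) →ₗ[K] ((V × V) × V) :=
    LinearMap.coprod (LinearMap.toSpanSingleton K _ ((w₁, -w₀), 0))
      (LinearMap.toSpanSingleton K _ ((0, -w₁), w₀))
  have hker : LinearMap.ker f ≤ LinearMap.range g := by
    rintro ⟨⟨a, b⟩, c⟩ hx
    obtain ⟨α, β, ha, hb, hc⟩ := h a a.2 b b.2 c c.2 hx
    refine ⟨(α, β), ?_⟩
    have ha' : a = α • w₁ := Subtype.ext ha
    have hb' : b = -(α • w₀) - β • w₁ := Subtype.ext hb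
    have hc' : c = β • w₀ := Subtype.ext hc
    simp [g, ha', hb', hc', sub_eq_add_neg]
  have h2 : finrank K (LinearMap.ker f) ≤ 2 := by
    refine (Submodule.finrank_mono hker).trans ((LinearMap.finrank_range_le g).trans ?_)
    rw [finrank_prod, finrank_self]
  rw [hr, finrank_prod, finrank_prod] at h1
  omega

variable [IsAlgClosed K] {τ : B →ₗ[K] K} {V : Submodule K B} {m s : ℕ}

omit [IsAlgClosed K] in
/-- Every ideal of colength `s` is generated by an element of the Gale dual series. -/
theorem exists_generator (hB : finrank K B = m + s + 1) (hVdim : finrank K V = s + 1)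
    (hV : ∀ u ∈ V, u ≠ 0 → m + 1 ≤ idim K (Ideal.span {u})) {J : Ideal B}
    (hJ : idim K J = m + 1) : ∃ u ∈ V, J = Ideal.span {u} := by
  have hne : J.restrictScalars K ⊓ V ≠ ⊥ := by
    intro h
    have h1 := Submodule.finrank_sup_add_finrank_inf_eq (J.restrictScalars K) V
    have h2 := Submodule.finrank_le (J.restrictScalars K ⊔ V)
    rw [h, finrank_bot, ← idim] at h1
    omega
  obtain ⟨u, hu, hu0⟩ := Submodule.exists_mem_ne_zero_of_ne_bot hne
  refine ⟨u, hu.2, (eq_of_le_of_idim_le (K := K) ?_ ?_).symm⟩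
  · exact (Ideal.span_singleton_le_iff_mem _).mpr hu.1
  · rw [hJ]
    exact hV u hu.2 hu0

/-- The generator of an ideal of colength `s` in the Gale dual series is unique up to scalars. -/
theorem exists_smul_of_mem_span (hV : ∀ u ∈ V, u ≠ 0 → m + 1 ≤ idim K (Ideal.span {u}))
    {u u' : B} (hu : u ∈ V) (hu' : u' ∈ V) (hJ : idim K (Ideal.span {u}) = m + 1)
    (hmem : u' ∈ Ideal.span {u}) : ∃ c : K, u' = c • u := by
  obtain ⟨a, rfl⟩ := Ideal.mem_span_singleton'.mp hmem
  have hlt : (⊥ : Ideal B) < Ideal.span {u} := by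
    rw [bot_lt_iff_ne_bot]
    rintro h
    rw [h, idim_bot] at hJ
    omega
  -- `a - χ a` has a nonzero kernel on the ideal generated by `u`, so it shrinks this ideal.
  obtain ⟨x, hx, hx0, χ, hχ⟩ := exists_eigenvector (K := K) hlt
  have hxa : a * x - χ a • x = 0 := hχ a
  refine ⟨χ a, ?_⟩
  by_contra hne
  have hmem' : a * u - χ a • u ∈ V := sub_mem hu' (V.smul_mem _ hu)
  have hle : Ideal.span {a * u - χ a • u} ≤ Ideal.span {u} := by
    rw [Ideal.span_singleton_le_iff_mem]
    exact sub_mem hmem ((Ideal.span {u}).restrictScalars K |>.smul_mem _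
      (Ideal.mem_span_singleton_self u))
  have heq := eq_of_le_of_idim_le (K := K) hle (by
    rw [hJ]
    exact hV _ hmem' (sub_ne_zero.mpr hne))
  have hu2 : u ∈ Ideal.span {a * u - χ a • u} := heq ▸ Ideal.mem_span_singleton_self u
  obtain ⟨d, hd⟩ := Ideal.mem_span_singleton'.mp hu2
  obtain ⟨b, rfl⟩ := Ideal.mem_span_singleton'.mp hx
  apply hx0
  rw [Ideal.mem_bot]
  rw [Algebra.smul_def] at hd hxa
  linear_combination d * hxa - b * hd

omit [IsAlgClosed K] in
/-- The product of two elements of the Gale dual series is killed by no third one. -/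
theorem eq_zero_of_mul_mul_eq_zero (hB : finrank K B = m + s + 1) (hs : 2 * s ≤ m)
    (hV : ∀ u ∈ V, u ≠ 0 → m + 1 ≤ idim K (Ideal.span {u})) {u u' v : B} (hv : v ∈ V)
    (hu : idim K (Ideal.span {u}) = m + 1) (hu' : idim K (Ideal.span {u'}) = m + 1)
    (h : u * u' * v = 0) : v = 0 := by
  by_contra hv0
  have h1 := idim_torsionOf_mul_le (K := K) u u'
  have h2 := idim_span_add_idim_torsionOf (K := K) u
  have h3 := idim_span_add_idim_torsionOf (K := K) u'
  have h4 := idim_span_add_idim_torsionOf (K := K) v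
  have h5 := idim_span_add_idim_torsionOf (K := K) (u * u')
  have h6 := hV v hv hv0
  have h7 : idim K (Ideal.span {u * u'}) ≤ idim K (Ideal.torsionOf B B v) := by
    refine idim_mono ((Ideal.span_singleton_le_iff_mem _).mpr ?_)
    rwa [mem_torsionOf]
  omega

/-- Over an algebraically closed field there is a pencil in the Gale dual series `V` for which
`u₀² V + u₀ u₁ V + u₁² V` has the expected dimension. The pencil is spanned either by two
generators of coprime ideals of colength `s`, or by a unit and a generator `u` of an ideal
of colength `s` with `ann u ⊆ (u)`. -/
theorem exists_pencil (hτ : IsTrace τ) (hB : finrank K B = m + s + 1)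
    (hVdim : finrank K V = s + 1) (hs : 2 * s ≤ m)
    (hV : ∀ u ∈ V, u ≠ 0 → m + 1 ≤ idim K (Ideal.span {u})) {e : B} (heV : e ∈ V)
    (he : IsUnit e) : ∃ u₀ ∈ V, ∃ u₁ ∈ V, 3 * s + 1 ≤ finrank K (quadSpan V u₀ u₁) := by
  suffices h : ∃ u₀ ∈ V, ∃ u₁ ∈ V, ∀ a ∈ V, ∀ b ∈ V, ∀ c ∈ V,
      u₀ * u₀ * a + u₀ * u₁ * b + u₁ * u₁ * c = 0 →
      ∃ α β : K, a = α • u₁ ∧ b = -(α • u₀) - β • u₁ ∧ c = β • u₀ by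
    obtain ⟨u₀, h₀, u₁, h₁, h⟩ := h
    have := finrank_quadSpan h₀ h₁ h
    exact ⟨u₀, h₀, u₁, h₁, by omega⟩
  obtain ⟨f, hf, hsf, hcase⟩ := exists_idempotent (K := K) (B := B) (s := s) (by omega)
  have hff := idim_idempotent (K := K) hf
  rcases hcase with hcase | ⟨h2s, hprim⟩
  · obtain ⟨J₀, hJ₀, -, hJ₀d⟩ := exists_ideal_between (K := K)
      (le_top : Ideal.span {1 - f} ≤ ⊤) (m + 1) (by omega) (by rw [idim_top]; omega)
    obtain ⟨J₁, hJ₁, -, hJ₁d⟩ := exists_ideal_between (K := K)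
      (le_top : Ideal.span {f} ≤ ⊤) (m + 1) (by omega) (by rw [idim_top]; omega)
    obtain ⟨u₀, h₀, rfl⟩ := exists_generator hB hVdim hV hJ₀d
    obtain ⟨u₁, h₁, rfl⟩ := exists_generator hB hVdim hV hJ₁d
    obtain ⟨p, hp⟩ := Ideal.mem_span_singleton'.mp (hJ₀ (Ideal.mem_span_singleton_self _))
    obtain ⟨q, hq⟩ := Ideal.mem_span_singleton'.mp (hJ₁ (Ideal.mem_span_singleton_self _))
    have hpq : p * u₀ + q * u₁ = 1 := by rw [hp, hq]; ring
    refine ⟨u₀, h₀, u₁, h₁, fun a ha b hb c hc hrel => ?_⟩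
    obtain ⟨β, hβ⟩ := exists_smul_of_mem_span hV h₀ hc hJ₀d (by
      rw [Ideal.mem_span_singleton']
      exact ⟨c * (p * p * u₀ + 2 * p * q * u₁) - q * q * (u₀ * a + u₁ * b), by
        linear_combination -(q * q) * hrel + c * (p * u₀ + q * u₁ + 1) * hpq⟩)
    obtain ⟨α, hα⟩ := exists_smul_of_mem_span hV h₁ ha hJ₁d (by
      rw [Ideal.mem_span_singleton']
      exact ⟨a * (q * q * u₁ + 2 * p * q * u₀) - p * p * (u₁ * c + u₀ * b), by
        linear_combination -(p * p) * hrel + a * (p * u₀ + q * u₁ + 1) * hpq⟩)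
    have hv : α • u₀ + b + β • u₁ = 0 := by
      refine eq_zero_of_mul_mul_eq_zero hB hs hV
        (add_mem (add_mem (V.smul_mem _ h₀) hb) (V.smul_mem _ h₁)) hJ₀d hJ₁d ?_
      rw [hα, hβ] at hrel
      simp only [Algebra.smul_def] at hrel ⊢
      linear_combination hrel
    exact ⟨α, β, hα, by linear_combination hv, hβ⟩
  · obtain ⟨I, -, hId, hII⟩ := exists_square_zero hτ hf hprim s h2s
    have hann := hτ.idim_annihilator I
    have hJd : idim K I.annihilator = m + 1 := by omega
    obtain ⟨u, hu, hIu⟩ := exists_generator hB hVdim hV hJd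
    have htor : Ideal.torsionOf B B u ≤ Ideal.span {u} := by
      rw [torsionOf_eq_annihilator, ← hIu, hτ.annihilator_annihilator]
      exact hII
    rw [hIu] at hJd
    obtain ⟨e', he'⟩ := he.exists_left_inv
    refine ⟨e, heV, u, hu, fun a ha b hb c hc hrel => ?_⟩
    obtain ⟨α, hα⟩ := exists_smul_of_mem_span hV hu ha hJd (by
      rw [Ideal.mem_span_singleton']
      exact ⟨-(e' * e' * (e * b + u * c)), by
        linear_combination -(e' * e') * hrel + a * (e' * e + 1) * he'⟩)
    rw [hα] at hrel
    have h1 : e * (α • e + b) + u * c ∈ Ideal.span {u} := by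
      apply htor
      rw [mem_torsionOf]
      simp only [Algebra.smul_def] at hrel ⊢
      linear_combination hrel
    obtain ⟨d, hd⟩ := Ideal.mem_span_singleton'.mp h1
    obtain ⟨β, hβ⟩ := exists_smul_of_mem_span hV hu (add_mem (V.smul_mem α heV) hb) hJd (by
      rw [Ideal.mem_span_singleton']
      exact ⟨e' * (d - c), by linear_combination e' * hd + (α • e + b) * he'⟩)
    have hv : β • e + c = 0 := by
      refine eq_zero_of_mul_mul_eq_zero hB hs hV (add_mem (V.smul_mem _ heV) hc) hJd hJd ?_
      have hb' : b = β • u - α • e := by linear_combination hβ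
      rw [hb'] at hrel
      simp only [Algebra.smul_def] at hrel ⊢
      linear_combination hrel
    refine ⟨α, -β, hα, ?_, ?_⟩
    · rw [neg_smul]
      linear_combination hβ
    · rw [neg_smul]
      linear_combination hv

end Pencils

open Module TensorProduct

/-! ### Descent of generic choices to an infinite field -/

section Specialization

theorem exists_minor_ne_zero {L : Type*} [Field L] {N d : ℕ} {X : Matrix (Fin N) (Fin d) L}
    (h : LinearIndependent L X.row) : ∃ g : Fin N → Fin d, (X.submatrix id g).det ≠ 0 := by
  have h1 : finrank L (Submodule.span L (Set.range X.col)) = N := by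
    rw [← Matrix.rank_eq_finrank_span_cols, h.rank_matrix, Fintype.card_fin]
  obtain ⟨f, hf, -, hind⟩ := Submodule.exists_fun_fin_finrank_span_eq L (Set.range X.col)
  choose g hg using hf
  refine ⟨g ∘ Fin.cast h1.symm, ?_⟩
  have h2 : LinearIndependent L (X.submatrix id (g ∘ Fin.cast h1.symm)).col := by
    have h3 := hind.comp (Fin.cast h1.symm) (Fin.cast_injective _)
    have h4 : (X.submatrix id (g ∘ Fin.cast h1.symm)).col = f ∘ Fin.cast h1.symm := by
      ext i j
      exact congrFun (hg (Fin.cast h1.symm i)) j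
    rw [h4]
    exact h3
  rw [Matrix.linearIndependent_cols_iff_isUnit, Matrix.isUnit_iff_isUnit_det] at h2
  exact h2.ne_zero

theorem linearIndependent_of_minor_ne_zero {L : Type*} [Field L] {N d : ℕ}
    {X : Matrix (Fin N) (Fin d) L} {g : Fin N → Fin d} (h : (X.submatrix id g).det ≠ 0) :
    LinearIndependent L X.row := by
  have h1 : LinearIndependent L (X.submatrix id g).row := by
    rw [Matrix.linearIndependent_rows_iff_isUnit, Matrix.isUnit_iff_isUnit_det]
    exact h.isUnit
  exact LinearIndependent.of_comp (LinearMap.funLeft L L g) h1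

variable (k A : Type*) {ι : Type*} [Field k] [CommRing A] [Algebra k A]

/-- Evaluation at `c` of the polynomial coefficients of an element of `k[X_ι] ⊗ A`. -/
noncomputable def specialize {L : Type*} [Field L] [Algebra k L] (c : ι → L) :
    MvPolynomial ι k ⊗[k] A →ₐ[k] L ⊗[k] A :=
  Algebra.TensorProduct.map (MvPolynomial.aeval c) (AlgHom.id k A)

variable {k A}

theorem specialize_tmul {L : Type*} [Field L] [Algebra k L] (c : ι → L) (p : MvPolynomial ι k)
    (a : A) : specialize k A c (p ⊗ₜ[k] a) = MvPolynomial.aeval c p ⊗ₜ[k] a := rfl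

variable (k A) in
/-- Evaluation of polynomial coefficients in the ground field. -/
noncomputable def specializeBase (c : ι → k) : MvPolynomial ι k ⊗[k] A →ₐ[k] A :=
  (Algebra.TensorProduct.lid k A : k ⊗[k] A →ₐ[k] A).comp (specialize k A c)

theorem specializeBase_tmul (c : ι → k) (p : MvPolynomial ι k) (a : A) :
    specializeBase k A c (p ⊗ₜ[k] a) = MvPolynomial.eval c p • a := by
  simp [specializeBase, specialize_tmul]

variable [FiniteDimensional k A]

omit [FiniteDimensional k A] in
theorem repr_specialize {L κ : Type*} [Field L] [Algebra k L] (c : ι → L) (b : Basis κ k A)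
    (x : MvPolynomial ι k ⊗[k] A) (j : κ) :
    (Algebra.TensorProduct.basis L b).repr (specialize k A c x) j =
      MvPolynomial.aeval c ((Algebra.TensorProduct.basis (MvPolynomial ι k) b).repr x j) := by
  induction x with
  | zero => simp
  | add x y hx hy => simp only [map_add, Finsupp.add_apply, hx, hy]
  | tmul p a =>
    rw [specialize_tmul, Algebra.TensorProduct.basis_repr_tmul,
      Algebra.TensorProduct.basis_repr_tmul]
    simp

/-- Linear independence after specialization is the nonvanishing of some polynomial: if it holds
at one point with coordinates in some extension field, it holds generically over `k`. -/
theorem exists_poly_of_linearIndependent {L : Type*} [Field L] [Algebra k L] {N : ℕ}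
    (F : Fin N → MvPolynomial ι k ⊗[k] A) (c : ι → L)
    (h : LinearIndependent L fun l => specialize k A c (F l)) :
    ∃ P : MvPolynomial ι k, P ≠ 0 ∧ ∀ c' : ι → k, MvPolynomial.eval c' P ≠ 0 →
      LinearIndependent k fun l => specializeBase k A c' (F l) := by
  let b := finBasis k A
  let X : Matrix (Fin N) (Fin (finrank k A)) (MvPolynomial ι k) :=
    Matrix.of fun l j => (Algebra.TensorProduct.basis (MvPolynomial ι k) b).repr (F l) j
  have hX : LinearIndependent L (X.map (MvPolynomial.aeval c)).row := by
    have := h.map' (Algebra.TensorProduct.basis L b).equivFun.toLinearMap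
      (LinearEquiv.ker _)
    have h2 : (X.map (MvPolynomial.aeval c)).row = fun l =>
        (Algebra.TensorProduct.basis L b).equivFun (specialize k A c (F l)) := by
      ext l j
      exact (repr_specialize c b (F l) j).symm
    rw [h2]
    exact this
  obtain ⟨g, hg⟩ := exists_minor_ne_zero hX
  refine ⟨(X.submatrix id g).det, fun h0 => hg ?_, fun c' hc' => ?_⟩
  · have := congrArg (MvPolynomial.aeval c) h0
    rw [map_zero, AlgHom.map_det] at this
    exact this
  · have h1 : LinearIndependent k (X.map (MvPolynomial.aeval c')).row := by
      refine linearIndependent_of_minor_ne_zero (g := g) ?_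
      rw [← MvPolynomial.aeval_eq_eval] at hc'
      change MvPolynomial.aeval c' _ ≠ 0 at hc'
      rw [AlgHom.map_det] at hc'
      exact hc'
    have h2 : LinearIndependent k fun l => specialize k A c' (F l) := by
      refine LinearIndependent.of_comp (Algebra.TensorProduct.basis k b).equivFun.toLinearMap ?_
      convert h1 using 1
      ext l j
      exact repr_specialize c' b (F l) j
    exact h2.map' (Algebra.TensorProduct.lid k A).toLinearEquiv.toLinearMap (LinearEquiv.ker _)

theorem exists_eval_ne_zero [Infinite k] {P : MvPolynomial ι k} (hP : P ≠ 0) :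
    ∃ c : ι → k, MvPolynomial.eval c P ≠ 0 := by
  by_contra! h
  exact hP (MvPolynomial.funext fun c => by rw [h c, map_zero])

omit [FiniteDimensional k A] in
theorem exists_coeff_of_mem_baseChange {K κ : Type*} [Field K] [Algebra k K] [Fintype κ]
    (v : κ → A) {x : K ⊗[k] A} (hx : x ∈ (Submodule.span k (Set.range v)).baseChange K) :
    ∃ c : κ → K, x = ∑ i, c i ⊗ₜ[k] v i := by
  rw [Submodule.baseChange_span, ← Set.range_comp] at hx
  obtain ⟨c, rfl⟩ := (Submodule.mem_span_range_iff_exists_fun K).mp hx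
  exact ⟨c, Finset.sum_congr rfl fun i _ => by simp [TensorProduct.smul_tmul']⟩

theorem isUnit_of_linearIndependent {κ : Type*} (b : Basis κ k A) {x : A}
    (h : LinearIndependent k fun j => x * b j) : IsUnit x := by
  have hinj : Function.Injective (LinearMap.mulLeft k x) := by
    rw [← LinearMap.ker_eq_bot]
    have : LinearMap.mulLeft k x = b.constr k fun j => x * b j :=
      b.ext fun j => by simp
    rw [LinearMap.ker_eq_bot', this]
    intro y hy
    rw [Basis.constr_apply] at hy
    exact b.repr.map_eq_zero_iff.mp ((linearIndependent_iff.mp h) _ hy)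
  obtain ⟨y, hy⟩ := (LinearMap.injective_iff_surjective.mp hinj) 1
  exact IsUnit.of_mul_eq_one y hy

/-- A pencil in general position with a unit descends from an extension field to `k`. -/
theorem descend_pencil [Infinite k] (K : Type*) [Field K] [Algebra k K] {V : Submodule k A}
    {N : ℕ} {e u₀ u₁ : K ⊗[k] A} (he : e ∈ V.baseChange K) (heu : IsUnit e)
    (h₀ : u₀ ∈ V.baseChange K) (h₁ : u₁ ∈ V.baseChange K)
    (hN : N ≤ finrank K (quadSpan (V.baseChange K) u₀ u₁)) :
    ∃ u₀ ∈ V, ∃ u₁ ∈ V, IsUnit u₀ ∧ N ≤ finrank k (quadSpan V u₀ u₁) := by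
  let v : Fin (finrank k V) → A := fun i => finBasis k V i
  have hv : Submodule.span k (Set.range v) = V := by
    have := congrArg (Submodule.map V.subtype) (finBasis k V).span_eq
    rwa [Submodule.map_span, Submodule.map_subtype_top, ← Set.range_comp] at this
  rw [← hv] at he h₀ h₁
  obtain ⟨ce, rfl⟩ := exists_coeff_of_mem_baseChange v he
  obtain ⟨c₀, rfl⟩ := exists_coeff_of_mem_baseChange v h₀
  obtain ⟨c₁, rfl⟩ := exists_coeff_of_mem_baseChange v h₁
  let G₀ : MvPolynomial (Fin (finrank k V) ⊕ Fin (finrank k V)) k ⊗[k] A :=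
    ∑ i, MvPolynomial.X (.inl i) ⊗ₜ[k] v i
  let G₁ : MvPolynomial (Fin (finrank k V) ⊕ Fin (finrank k V)) k ⊗[k] A :=
    ∑ i, MvPolynomial.X (.inr i) ⊗ₜ[k] v i
  have hG₀ : ∀ (c : Fin (finrank k V) ⊕ Fin (finrank k V) → K), specialize k A c G₀ =
      ∑ i, c (.inl i) ⊗ₜ[k] v i := fun c => by
    simp [G₀, specialize_tmul]
  have hG₁ : ∀ (c : Fin (finrank k V) ⊕ Fin (finrank k V) → K), specialize k A c G₁ =
      ∑ i, c (.inr i) ⊗ₜ[k] v i := fun c => by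
    simp [G₁, specialize_tmul]
  have hv' : ∀ i, v i ∈ V := fun i => (finBasis k V i).2
  have hG₀' : ∀ c, specializeBase k A c G₀ ∈ V := fun c => by
    simp only [G₀, map_sum, specializeBase_tmul]
    exact sum_mem fun i _ => V.smul_mem _ (hv' i)
  have hG₁' : ∀ c, specializeBase k A c G₁ ∈ V := fun c => by
    simp only [G₁, map_sum, specializeBase_tmul]
    exact sum_mem fun i _ => V.smul_mem _ (hv' i)
  let b := finBasis k A
  obtain ⟨P, hP, hPc⟩ := exists_poly_of_linearIndependent (L := K)
    (fun j => G₀ * (1 : MvPolynomial (Fin (finrank k V) ⊕ Fin (finrank k V)) k) ⊗ₜ[k] b j)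
    (Sum.elim ce 0) (by
      simp only [map_mul, hG₀, Sum.elim_inl, specialize_tmul, map_one]
      have := (Algebra.TensorProduct.basis K b).linearIndependent.map'
        (LinearMap.mulLeft K (∑ i, ce i ⊗ₜ[k] v i))
        (LinearMap.ker_eq_bot.mpr fun x y h => heu.mul_left_cancel h)
      simpa only [Function.comp_def, Algebra.TensorProduct.basis_apply,
        LinearMap.mulLeft_apply] using this)
  set c : Fin (finrank k V) ⊕ Fin (finrank k V) → K := Sum.elim c₀ c₁ with hc
  let S : Set (K ⊗[k] A) := {y | ∃ w : MvPolynomial (Fin (finrank k V) ⊕ Fin (finrank k V)) k ⊗[k] A,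
    specialize k A c w = y ∧
    ∀ c', specializeBase k A c' w ∈
      quadSpan V (specializeBase k A c' G₀) (specializeBase k A c' G₁)}
  have hS : quadSpan (V.baseChange K) (∑ i, c₀ i ⊗ₜ[k] v i) (∑ i, c₁ i ⊗ₜ[k] v i) ≤
      Submodule.span K S := by
    have e₀ : (∑ i, c₀ i ⊗ₜ[k] v i : K ⊗[k] A) = specialize k A c G₀ := by rw [hG₀]; rfl
    have e₁ : (∑ i, c₁ i ⊗ₜ[k] v i : K ⊗[k] A) = specialize k A c G₁ := by rw [hG₁]; rfl
    have hbase : V.baseChange K = Submodule.span K (Set.range fun i => (1 : K) ⊗ₜ[k] v i) := by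
      have := Submodule.baseChange_span (R := k) K (Set.range v)
      rw [hv, ← Set.range_comp] at this
      exact this
    have key : ∀ H : MvPolynomial (Fin (finrank k V) ⊕ Fin (finrank k V)) k ⊗[k] A,
        (∀ c', V.map (LinearMap.mulLeft k (specializeBase k A c' H)) ≤
        quadSpan V (specializeBase k A c' G₀) (specializeBase k A c' G₁)) →
        (V.baseChange K).map (LinearMap.mulLeft K (specialize k A c H)) ≤ Submodule.span K S := by
      intro H hH
      rw [hbase, Submodule.map_span, Submodule.span_le]
      rintro _ ⟨_, ⟨i, rfl⟩, rfl⟩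
      refine Submodule.subset_span ⟨
        H * (1 : MvPolynomial (Fin (finrank k V) ⊕ Fin (finrank k V)) k) ⊗ₜ[k] v i,
        ?_, fun c' => ?_⟩
      · rw [map_mul, specialize_tmul, map_one]
        rfl
      · rw [map_mul, specializeBase_tmul, map_one, one_smul]
        exact hH c' ⟨v i, hv' i, rfl⟩
    rw [quadSpan, e₀, e₁, ← map_mul, ← map_mul, ← map_mul]
    refine sup_le (sup_le (key _ fun c' => ?_) (key _ fun c' => ?_)) (key _ fun c' => ?_) <;>
      rw [map_mul]
    · exact le_sup_left.trans le_sup_left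
    · exact le_sup_right.trans le_sup_left
    · exact le_sup_right
  have hN' : N ≤ finrank K (Submodule.span K S) := hN.trans (Submodule.finrank_mono hS)
  obtain ⟨f, hfS, -, hind⟩ := Submodule.exists_fun_fin_finrank_span_eq K S
  choose w hw hw' using hfS
  obtain ⟨Q, hQ, hQc⟩ := exists_poly_of_linearIndependent (L := K)
    (fun l : Fin N => w (Fin.castLE hN' l)) c (by
      simp only [hw]
      exact hind.comp _ (Fin.castLE_injective hN'))
  obtain ⟨c', hc'⟩ := exists_eval_ne_zero (mul_ne_zero hP hQ)
  rw [map_mul] at hc'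
  refine ⟨specializeBase k A c' G₀, hG₀' c', specializeBase k A c' G₁, hG₁' c', ?_, ?_⟩
  · refine isUnit_of_linearIndependent b ?_
    have := hPc c' (left_ne_zero_of_mul hc')
    simpa only [map_mul, specializeBase_tmul, map_one, one_smul] using this
  · have h1 := hQc c' (right_ne_zero_of_mul hc')
    rw [← Fintype.card_fin N, ← finrank_span_eq_card h1]
    refine Submodule.finrank_mono (Submodule.span_le.mpr ?_)
    rintro _ ⟨l, rfl⟩
    exact hw' _ c'

/-- A primitive element descends from an extension field to `k`. -/
theorem descend_generator [Infinite k] (K : Type*) [Field K] [Algebra k K] {t : K ⊗[k] A}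
    (ht : LinearIndependent K fun l : Fin (finrank k A) => t ^ (l : ℕ)) :
    ∃ t : A, LinearIndependent k fun l : Fin (finrank k A) => t ^ (l : ℕ) := by
  let b := finBasis k A
  obtain ⟨c, rfl⟩ := exists_coeff_of_mem_baseChange (K := K) b (x := t) (by
    rw [b.span_eq, Submodule.baseChange_top]
    exact Submodule.mem_top)
  let G : MvPolynomial (Fin (finrank k A)) k ⊗[k] A := ∑ i, MvPolynomial.X i ⊗ₜ[k] b i
  have hG : specialize k A c G = ∑ i, c i ⊗ₜ[k] b i := by simp [G, specialize_tmul]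
  obtain ⟨P, hP, hPc⟩ := exists_poly_of_linearIndependent (L := K)
    (fun l : Fin (finrank k A) => G ^ (l : ℕ)) c (by simpa only [map_pow, hG] using ht)
  obtain ⟨c', hc'⟩ := exists_eval_ne_zero hP
  exact ⟨specializeBase k A c' G, by simpa only [map_pow] using hPc c' hc'⟩

end Specialization

open Module TensorProduct

/-! ### Block bases from pencils in the Gale dual series -/

section BaseChange

variable {k A : Type*} [Field k] [CommRing A] [Algebra k A] [FiniteDimensional k A]
variable (K : Type*) [Field K] [Algebra k K]

theorem finrank_submodule_baseChange {E : Type*} [AddCommGroup E] [Module k E]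
    (V : Submodule k E) :
    finrank K (V.baseChange K) = finrank k V := by
  rw [← (Submodule.toBaseChange.toLinearEquiv K V).finrank_eq, finrank_baseChange]

/-- The `K`-linear extension of a functional. -/
noncomputable def extendFunctional (τ : A →ₗ[k] k) : K ⊗[k] A →ₗ[K] K :=
  (TensorProduct.AlgebraTensorModule.rid k K K).toLinearMap ∘ₗ τ.baseChange K

omit [FiniteDimensional k A] in
theorem extendFunctional_tmul (τ : A →ₗ[k] k) (c : K) (a : A) :
    extendFunctional K τ (c ⊗ₜ[k] a) = τ a • c := by
  simp [extendFunctional]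

theorem IsTrace.extendFunctional {τ : A →ₗ[k] k} (hτ : IsTrace τ) :
    IsTrace (extendFunctional K τ) := by
  classical
  intro x hx
  let b := finBasis k A
  let d := (traceForm τ).dualBasis hτ.nondegenerate b
  have hd : ∀ i j, τ (d i * b j) = if j = i then 1 else 0 := fun i j =>
    LinearMap.BilinForm.apply_dualBasis_left hτ.nondegenerate b i j
  let D := Algebra.TensorProduct.basis K d
  have hcoord : ∀ j, GaleScroll.extendFunctional K τ (x * (1 : K) ⊗ₜ[k] b j) = D.repr x j := by
    intro j
    conv_lhs => rw [← D.sum_repr x]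
    rw [Finset.sum_mul, map_sum, Finset.sum_eq_single j]
    · rw [smul_mul_assoc, map_smul, Algebra.TensorProduct.basis_apply,
        Algebra.TensorProduct.tmul_mul_tmul, extendFunctional_tmul, hd]
      simp
    · intro i _ hij
      rw [smul_mul_assoc, map_smul, Algebra.TensorProduct.basis_apply,
        Algebra.TensorProduct.tmul_mul_tmul, extendFunctional_tmul, hd, if_neg hij.symm]
      simp
    · simp
  apply D.repr.map_eq_zero_iff.mp
  ext j
  rw [← hcoord, hx]
  rfl

theorem orth_baseChange {τ : A →ₗ[k] k} (hτ : IsTrace τ) (M : Submodule k A) :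
    (orth τ M).baseChange K = orth (extendFunctional K τ) (M.baseChange K) := by
  refine Submodule.eq_of_le_of_finrank_le ?_ ?_
  · rw [Submodule.baseChange_eq_span, Submodule.span_le]
    rintro _ ⟨x, hx, rfl⟩
    refine mem_orth.mpr fun y hy => ?_
    rw [Submodule.baseChange_eq_span] at hy
    induction hy using Submodule.span_induction with
    | mem y hy =>
      obtain ⟨w, hw, rfl⟩ := hy
      rw [TensorProduct.mk_apply, TensorProduct.mk_apply, Algebra.TensorProduct.tmul_mul_tmul,
        extendFunctional_tmul, mem_orth.mp hx w hw, zero_smul]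
    | zero => rw [zero_mul, map_zero]
    | add y z _ _ h h' => rw [add_mul, map_add, h, h', add_zero]
    | smul c y _ h => rw [smul_mul_assoc, map_smul, h, smul_zero]
  · have h1 := (hτ.extendFunctional K).finrank_orth (M.baseChange K)
    have h2 := hτ.finrank_orth M
    rw [finrank_submodule_baseChange, finrank_baseChange] at h1
    rw [finrank_submodule_baseChange]
    omega

end BaseChange

section Strings

variable {k A : Type*} [Field k] [CommRing A] [Algebra k A] [FiniteDimensional k A]

/-- A space in general position over an algebraically closed field contains no subspace stable
under a function `t` whose fibres all have degree at most `dim B - dim M`: an eigenvector would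
be supported on a fibre of `t`. -/
theorem InGeneralPosition.eq_bot_of_stable {K : Type*} [Field K] [IsAlgClosed K] [Algebra k K]
    {M : Submodule k A} (hM : InGeneralPosition (M.baseChange K)) {t : A}
    (ht : ∀ c : K, finrank k M ≤ idim K (Ideal.span {(1 : K) ⊗ₜ[k] t - algebraMap K _ c}))
    {P : Submodule k A} (hPM : P ≤ M) (hP : P.map (LinearMap.mulLeft k t) ≤ P) : P = ⊥ := by
  by_contra hne
  have hstab : ∀ x ∈ P.baseChange K,
      LinearMap.mulLeft K ((1 : K) ⊗ₜ[k] t) x ∈ P.baseChange K := by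
    intro x hx
    rw [Submodule.baseChange_eq_span] at hx
    induction hx using Submodule.span_induction with
    | mem y hy =>
      obtain ⟨w, hw, rfl⟩ := hy
      rw [LinearMap.mulLeft_apply, TensorProduct.mk_apply, Algebra.TensorProduct.tmul_mul_tmul]
      exact Submodule.tmul_mem_baseChange_of_mem _ (hP ⟨w, hw, rfl⟩)
    | zero => rw [map_zero]; exact zero_mem _
    | add y z _ _ h h' => rw [map_add]; exact add_mem h h'
    | smul c y _ h => rw [map_smul]; exact Submodule.smul_mem _ _ h
  have : Nontrivial (P.baseChange K) := by
    rw [← Module.finrank_pos_iff (R := K), finrank_submodule_baseChange, Nat.pos_iff_ne_zero]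
    exact fun h => hne (Submodule.finrank_eq_zero.mp h)
  obtain ⟨c, hc⟩ := Module.End.exists_eigenvalue
    ((LinearMap.mulLeft K ((1 : K) ⊗ₜ[k] t)).restrict hstab)
  obtain ⟨⟨p, hp⟩, hpe⟩ := hc.exists_hasEigenvector
  have hp0 : p ≠ 0 := fun h => hpe.2 (Subtype.ext h)
  have hpc : (1 : K) ⊗ₜ[k] t * p = c • p := congrArg Subtype.val hpe.apply_eq_smul
  have h1 := hM.lt_idim_span (Submodule.baseChange_mono K hPM hp) hp0
  have h2 := idim_span_add_idim_torsionOf (K := K) p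
  have h3 : idim K (Ideal.span {(1 : K) ⊗ₜ[k] t - algebraMap K _ c}) ≤
      idim K (Ideal.torsionOf (K ⊗[k] A) (K ⊗[k] A) p) := by
    refine idim_mono ((Ideal.span_singleton_le_iff_mem _).mpr ?_)
    rw [mem_torsionOf, sub_mul, hpc, Algebra.smul_def, sub_self]
  have h4 := ht c
  rw [finrank_submodule_baseChange] at h1
  omega

/-- The Kronecker normal form of multiplication by `t` on the image of `ρ`, in the absence of
stable subspaces. There are as many strings as the codimension of the subspace that `t` maps into
the image of `ρ`. -/
theorem exists_hasBlocks {E : Type*} [AddCommGroup E] [Module k E] {ρ : E →ₗ[k] A}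
    (hρ : Function.Injective ρ) {t : A}
    (ht : ∀ P ≤ LinearMap.range ρ, P.map (LinearMap.mulLeft k t) ≤ P → P = ⊥) :
    ∃ (n : ℕ) (a : Fin n → ℕ), HasBlocks ρ t a ∧
      n + finrank k (stepIn (LinearMap.mulLeft k t) (LinearMap.range ρ)) = finrank k E ∧
      (stepIn (LinearMap.mulLeft k t) (LinearMap.range ρ) ⊔
        (stepIn (LinearMap.mulLeft k t) (LinearMap.range ρ)).map (LinearMap.mulLeft k t) =
          LinearMap.range ρ → ∀ j, 1 ≤ a j) := by
  have hE : finrank k (LinearMap.range ρ) = finrank k E := LinearMap.finrank_range_of_inj hρ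
  obtain ⟨n, a, x, hspan, hsum, hn, hpos⟩ :=
    exists_strings (LinearMap.mulLeft k t) _ (LinearMap.range ρ) le_rfl ht
  rw [hE] at hsum hn
  refine ⟨n, a, ?_, hn, hpos⟩
  have hmem : ∀ j l, l ≤ a j → ∃ e, ρ e = t ^ l * x j := fun j l hl => by
    have : (LinearMap.mulLeft k t ^ l) (x j) ∈ LinearMap.range ρ := by
      rw [hspan]
      exact Submodule.subset_span ⟨j, l, hl, rfl⟩
    rwa [LinearMap.pow_mulLeft, LinearMap.mulLeft_apply] at this
  classical
  refine ⟨x, fun j l => if h : l ≤ a j then (hmem j l h).choose else 0, fun j l hl => ?_, ?_, hsum⟩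
  · simp only [dif_pos hl]
    exact (hmem j l hl).choose_spec
  · rw [eq_top_iff]
    refine fun e _ => ?_
    have he : ρ e ∈ LinearMap.range ρ := ⟨e, rfl⟩
    rw [hspan] at he
    have hle : Submodule.span k {y | ∃ j l, l ≤ a j ∧ y = (LinearMap.mulLeft k t ^ l) (x j)} ≤
        (Submodule.span k {e | ∃ j l, l ≤ a j ∧
          e = if h : l ≤ a j then (hmem j l h).choose else 0}).map ρ := by
      rw [Submodule.span_le]
      rintro _ ⟨j, l, hl, rfl⟩
      refine ⟨_, Submodule.subset_span ⟨j, l, hl, rfl⟩, ?_⟩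
      rw [dif_pos hl, (hmem j l hl).choose_spec, LinearMap.pow_mulLeft, LinearMap.mulLeft_apply]
    obtain ⟨e', he', heq⟩ := hle he
    rwa [← hρ heq]

omit [FiniteDimensional k A] in
/-- The adjoint of multiplication by `t` is multiplication by `t`. -/
theorem stepIn_orth (τ : A →ₗ[k] k) (V : Submodule k A) (t : A) :
    stepIn (LinearMap.mulLeft k t) (orth τ V) =
      orth τ (V ⊔ V.map (LinearMap.mulLeft k t)) := by
  ext x
  constructor
  · rintro ⟨h1, h2⟩
    refine mem_orth.mpr fun y hy => ?_
    obtain ⟨v, hv, _, ⟨w, hw, rfl⟩, rfl⟩ := Submodule.mem_sup.mp hy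
    have h3 : τ (w * (t * x)) = 0 := mem_orth.mp h2 w hw
    rw [LinearMap.mulLeft_apply, add_mul, map_add, mem_orth.mp h1 v hv, zero_add, ← h3]
    congr 1
    ring
  · intro h
    refine ⟨mem_orth.mpr fun v hv => mem_orth.mp h v (Submodule.mem_sup_left hv),
      mem_orth.mpr fun v hv => ?_⟩
    have := mem_orth.mp h _ (Submodule.mem_sup_right (Submodule.mem_map_of_mem hv))
    rw [LinearMap.mulLeft_apply] at this ⊢
    rw [← this]
    congr 1
    ring

/-- For a pencil `u₀, u₁ = t u₀` in `V = M^⊥`, the space `{n ∈ M | t n ∈ M} = (V + t V)^⊥` has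
codimension at most `dim V - 1` in `M`. -/
theorem finrank_le_finrank_stepIn {τ : A →ₗ[k] k} (hτ : IsTrace τ) {M : Submodule k A}
    {t u₀ : A} (h₀ : u₀ ∈ orth τ M) (h₁ : t * u₀ ∈ orth τ M) (hu : u₀ ≠ 0) :
    finrank k M + 1 ≤
      finrank k (stepIn (LinearMap.mulLeft k t) M) + finrank k (orth τ M) := by
  set V := orth τ M with hV
  have hM : M = orth τ V := (hτ.orth_orth M).symm
  have h1 := hτ.finrank_orth M
  have h2 := hτ.finrank_orth (V ⊔ V.map (LinearMap.mulLeft k t))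
  have h3 := finrank_sup_map_add_finrank_stepIn (LinearMap.mulLeft k t) V
  rw [← stepIn_orth, ← hM] at h2
  have h4 : 1 ≤ finrank k (stepIn (LinearMap.mulLeft k t) V) := by
    rw [Nat.one_le_iff_ne_zero]
    intro h
    have : u₀ ∈ stepIn (LinearMap.mulLeft k t) V := ⟨h₀, h₁⟩
    rw [Submodule.finrank_eq_zero.mp h] at this
    exact hu ((Submodule.mem_bot k).mp this)
  rw [← hV] at h1
  omega

/-- If `V + t V + t² V` has the expected dimension `3 dim V - 2`, then `x, t x ∈ V + t V` forces
`x ∈ V`; dually, `M` is spanned by `N = {n ∈ M | t n ∈ M}` and `t N`. -/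
theorem stepIn_sup_map_eq {τ : A →ₗ[k] k} (hτ : IsTrace τ) {M : Submodule k A}
    {t u₀ : A} (h₀ : u₀ ∈ orth τ M) (h₁ : t * u₀ ∈ orth τ M) (hu : IsUnit u₀) (hu0 : u₀ ≠ 0)
    (hq : 3 * finrank k (orth τ M) ≤ finrank k (quadSpan (orth τ M) u₀ (t * u₀)) + 2) :
    stepIn (LinearMap.mulLeft k t) M ⊔
      (stepIn (LinearMap.mulLeft k t) M).map (LinearMap.mulLeft k t) = M := by
  set T := LinearMap.mulLeft k t with hT
  set V := orth τ M with hV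
  have hM : M = orth τ V := (hτ.orth_orth M).symm
  set Q := V ⊔ V.map T with hQ
  have hN : stepIn T M = orth τ Q := by
    conv_lhs => rw [hM]
    exact stepIn_orth τ V t
  have h1 := finrank_sup_map_add_finrank_stepIn T V
  have h2 := finrank_sup_map_add_finrank_stepIn T Q
  have h3 : 1 ≤ finrank k (stepIn T V) := by
    rw [Nat.one_le_iff_ne_zero]
    intro h
    have : u₀ ∈ stepIn T V := ⟨h₀, h₁⟩
    rw [Submodule.finrank_eq_zero.mp h] at this
    exact hu0 ((Submodule.mem_bot k).mp this)
  have h4 : finrank k (quadSpan V u₀ (t * u₀)) ≤ finrank k ↥(Q ⊔ Q.map T) := by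
    rw [← finrank_map_mulLeft_of_isUnit (K := k) (hu.mul hu) (Q ⊔ Q.map T)]
    refine Submodule.finrank_mono ?_
    rw [quadSpan]
    refine sup_le (sup_le ?_ ?_) ?_ <;> rw [Submodule.map_le_iff_le_comap] <;> intro v hv
    · exact ⟨v, Submodule.mem_sup_left (Submodule.mem_sup_left hv), rfl⟩
    · refine ⟨t * v, Submodule.mem_sup_left (Submodule.mem_sup_right ⟨v, hv, rfl⟩), ?_⟩
      simp only [LinearMap.mulLeft_apply]
      ring
    · refine ⟨t * (t * v), Submodule.mem_sup_right ⟨t * v, Submodule.mem_sup_right ⟨v, hv, rfl⟩,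
        rfl⟩, ?_⟩
      simp only [LinearMap.mulLeft_apply]
      ring
  have hVQ : V ≤ stepIn T Q := fun v hv =>
    ⟨Submodule.mem_sup_left hv, Submodule.mem_sup_right ⟨v, hv, rfl⟩⟩
  have h5 : V = stepIn T Q := Submodule.eq_of_le_of_finrank_le hVQ (by rw [← hQ] at h1; omega)
  have h6 : orth τ (stepIn T M ⊔ (stepIn T M).map T) = V := by
    rw [← stepIn_orth, hN, hτ.orth_orth, ← h5]
  rw [← hτ.orth_orth (stepIn T M ⊔ (stepIn T M).map T), h6, ← hM]

end Strings

section Generators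

variable {k A : Type*} [Field k] [CommRing A] [Algebra k A] [FiniteDimensional k A]

/-- If the powers of `t` form a basis, then the fibres of `t` have degree at most one. -/
theorem finrank_le_idim_of_linearIndependent {t : A}
    (ht : LinearIndependent k fun l : Fin (finrank k A) => t ^ (l : ℕ)) (c : k) :
    finrank k A ≤ idim k (Ideal.span {t - algebraMap k A c}) + 1 := by
  have hspan : Submodule.span k (Set.range fun l : Fin (finrank k A) => t ^ (l : ℕ)) = ⊤ :=
    ht.span_eq_top_of_card_eq_finrank' (by simp)
  have htop : (Ideal.span {t - algebraMap k A c}).restrictScalars k ⊔ Submodule.span k {1} = ⊤ := by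
    rw [eq_top_iff, ← hspan, Submodule.span_le]
    rintro _ ⟨l, rfl⟩
    change t ^ (l : ℕ) ∈ _
    rw [show t ^ (l : ℕ) = (t ^ (l : ℕ) - algebraMap k A c ^ (l : ℕ)) + c ^ (l : ℕ) • 1 by
      rw [Algebra.smul_def, map_pow]; ring]
    exact add_mem (Submodule.mem_sup_left
      (Ideal.mem_span_singleton.mpr (sub_dvd_pow_sub_pow _ _ _)))
      (Submodule.mem_sup_right (Submodule.smul_mem _ _ (Submodule.mem_span_singleton_self 1)))
  have h1 := Submodule.finrank_add_le_finrank_add_finrank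
    ((Ideal.span {t - algebraMap k A c}).restrictScalars k) (Submodule.span k {(1 : A)})
  rw [htop, finrank_top] at h1
  exact h1.trans (Nat.add_le_add_left (finrank_span_le_card ({1} : Set A) |>.trans (by simp)) _)

theorem linearIndependent_pow_tmul (K : Type*) [Field K] [Algebra k K] {t : A}
    (ht : LinearIndependent k fun l : Fin (finrank k A) => t ^ (l : ℕ)) :
    LinearIndependent K
      fun l : Fin (finrank K (K ⊗[k] A)) => ((1 : K) ⊗ₜ[k] t) ^ (l : ℕ) := by
  let b := basisOfLinearIndependentOfCardEqFinrank' _ ht (by simp)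
  have h1 := (Algebra.TensorProduct.basis K b).linearIndependent
  have h2 := h1.comp (Fin.cast (finrank_baseChange (R := K) (S := k) (M' := A)))
    (Fin.cast_injective _)
  convert h2 using 2 with l
  simp [b, Algebra.TensorProduct.tmul_pow]

/-- The block basis in the case where the functions in the image of `ρ` are all functions: it
lifts the powers of a generator `t`. -/
theorem hasBlocks_of_surjective {E : Type*} [AddCommGroup E] [Module k E]
    [FiniteDimensional k E] {ρ : E →ₗ[k] A} (hρ : LinearMap.range ρ = ⊤) {r : ℕ}
    (hE : finrank k E = r + 1) {t : A}
    (ht : LinearIndependent k fun l : Fin (finrank k A) => t ^ (l : ℕ)) :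
    HasBlocks ρ t (fun _ : Fin 1 => r) := by
  obtain ⟨σ, hσ⟩ := ρ.exists_rightInverse_of_surjective hρ
  have hσ' : ∀ x, ρ (σ x) = x := fun x => LinearMap.congr_fun hσ x
  have hdim := LinearMap.finrank_range_add_finrank_ker ρ
  rw [hρ, finrank_top, hE] at hdim
  let κ := finBasis k (LinearMap.ker ρ)
  -- The powers `t ^ l` with `l ≥ dim A` are lifted by adding the basis vectors of the kernel.
  let y : ℕ → E := fun l => σ (t ^ l) +
    if h : finrank k A ≤ l ∧ l < r + 1 then (κ ⟨l - finrank k A, by omega⟩ : E) else 0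
  refine ⟨fun _ => 1, fun _ => y, fun _ l hl => ?_, ?_, by simp [hE]⟩
  · simp only [y, map_add, hσ', mul_one]
    split_ifs with h
    · rw [(κ _).2, add_zero]
    · rw [map_zero, add_zero]
  · set S := Submodule.span k {e | ∃ (_ : Fin 1) (l : ℕ), l ≤ r ∧ e = y l} with hS
    have hy : ∀ l ≤ r, y l ∈ S := fun l hl => Submodule.subset_span ⟨0, l, hl, rfl⟩
    have hspan : Submodule.span k (Set.range fun l : Fin (finrank k A) => t ^ (l : ℕ)) = ⊤ :=
      ht.span_eq_top_of_card_eq_finrank' (by simp)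
    have hσS : ∀ x, σ x ∈ S := by
      intro x
      have hx : x ∈ Submodule.span k (Set.range fun l : Fin (finrank k A) => t ^ (l : ℕ)) :=
        hspan ▸ Submodule.mem_top
      have hle : Submodule.span k (Set.range fun l : Fin (finrank k A) => t ^ (l : ℕ)) ≤
          S.comap σ := by
        rw [Submodule.span_le]
        rintro _ ⟨l, rfl⟩
        have h1 := hy l (by have := l.2; omega)
        simpa [y, Nat.not_le.mpr l.2] using h1
      exact hle hx
    have hκ : LinearMap.ker ρ ≤ S := by
      have h1 : Submodule.span k (Set.range fun j => (κ j : E)) = LinearMap.ker ρ := by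
        have := congrArg (Submodule.map (LinearMap.ker ρ).subtype) κ.span_eq
        rwa [Submodule.map_span, Submodule.map_subtype_top, ← Set.range_comp] at this
      rw [← h1, Submodule.span_le]
      rintro _ ⟨j, rfl⟩
      have h2 := hy (finrank k A + j) (by have := j.2; omega)
      have h3 : finrank k A ≤ finrank k A + j ∧ finrank k A + j < r + 1 := by
        have := j.2; omega
      simp only [y, dif_pos h3] at h2
      have h4 := (Submodule.add_mem_iff_right _ (hσS _)).mp h2
      convert! h4 using 3
      simp
    rw [eq_top_iff]
    intro e _
    rw [← sub_add_cancel e (σ (ρ e))]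
    exact add_mem (hκ (by simp [hσ'])) (hσS _)

end Generators

open Module TensorProduct

/-! ### Curvilinear algebras -/

section Curvilinear

variable {K B : Type*} [Field K] [IsAlgClosed K] [CommRing B] [Algebra K B]
  [FiniteDimensional K B]

omit [IsAlgClosed K] in
theorem finrank_le_natDegree_minpoly_of_splits {t : B} (hsplit : (minpoly K t).Splits)
    (ht : ∀ c : K, finrank K B ≤ idim K (Ideal.span {t - algebraMap K B c}) + 1) :
    finrank K B ≤ (minpoly K t).natDegree := by
  have key : ∀ S : Multiset K,
      idim K (Ideal.torsionOf B B (S.map fun c => t - algebraMap K B c).prod) ≤ S.card := by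
    intro S
    induction S using Multiset.induction with
    | empty =>
      have : Ideal.torsionOf B B 1 = ⊥ := by
        ext x
        simp
      simp [this, idim_bot]
    | cons c S ih =>
      rw [Multiset.map_cons, Multiset.prod_cons, Multiset.card_cons]
      have h1 := idim_torsionOf_mul_le (K := K) (t - algebraMap K B c)
        (S.map fun c => t - algebraMap K B c).prod
      have h2 := idim_span_add_idim_torsionOf (K := K) (t - algebraMap K B c)
      have h3 := ht c
      omega
  have h0 : ((minpoly K t).roots.map fun c => t - algebraMap K B c).prod = 0 := by
    have h := minpoly.aeval K t
    rw [hsplit.eq_prod_roots_of_monic (minpoly.monic (Algebra.IsIntegral.isIntegral t)),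
      map_multiset_prod, Multiset.map_map] at h
    simpa using h
  have h1 := key (minpoly K t).roots
  have h2 : Ideal.torsionOf B B (0 : B) = ⊤ := by
    ext x
    simp
  rw [h0, h2, idim_top] at h1
  exact h1.trans (Polynomial.card_roots' _)

/-- If every maximal ideal is principal modulo its square, the algebra is generated by a single
element: by the Chinese remainder theorem there is `t` taking distinct values at the points and
inducing a generator of each `m / m²`. Then each `B / (t - c)` has dimension at most one. -/
theorem exists_finrank_le_idim
    (hB : ∀ m : Ideal B, m.IsMaximal → ∃ π ∈ m, m ≤ Ideal.span {π} ⊔ m ^ 2) :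
    ∃ t : B, ∀ c : K, finrank K B ≤ idim K (Ideal.span {t - algebraMap K B c}) + 1 := by
  have : IsArtinianRing B := IsArtinianRing.of_finite K B
  have : Infinite K := IsAlgClosed.instInfinite
  have := fun m : MaximalSpectrum B => m.isMaximal
  choose π hπ hmπ using fun m : MaximalSpectrum B => hB m.asIdeal m.isMaximal
  let c : MaximalSpectrum B → K := fun m => Infinite.natEmbedding K (Finite.equivFin _ m)
  have hc : Function.Injective c := fun m m' h => by
    have h1 := (Infinite.natEmbedding K).injective h
    exact (Finite.equivFin _).injective (Fin.ext h1)
  obtain ⟨t, ht⟩ := Ideal.exists_forall_sub_mem_ideal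
    (I := fun m : MaximalSpectrum B => m.asIdeal ^ 2) (fun m m' h => by
      refine IsCoprime.pow ?_
      exact Ideal.isCoprime_of_isMaximal fun h' => h (MaximalSpectrum.ext h'))
    (fun m => algebraMap K B (c m) + π m)
  refine ⟨t, fun d => ?_⟩
  set I := Ideal.span {t - algebraMap K B d} with hI
  have htI : t - algebraMap K B d ∈ I := Ideal.mem_span_singleton_self _
  -- a maximal ideal containing `t - d` is the one with label `d`
  have hlabel : ∀ m : MaximalSpectrum B, I ≤ m.asIdeal → c m = d := by
    intro m hm
    have h1 := hm htI
    have h2 := Ideal.pow_le_self two_ne_zero (ht m)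
    have h3 : algebraMap K B (c m - d) ∈ m.asIdeal := by
      have h4 := sub_mem h1 (add_mem h2 (hπ m))
      rw [map_sub]
      convert h4 using 1
      ring
    by_contra hne
    refine m.isMaximal.ne_top (Ideal.eq_top_of_isUnit_mem _ h3 ?_)
    exact (IsUnit.mk0 _ (sub_ne_zero.mpr hne)).map _
  by_cases hItop : I = ⊤
  · rw [hItop, idim_top]
    omega
  obtain ⟨m, hm, hIm⟩ := Ideal.exists_le_maximal I hItop
  have hlm := hlabel ⟨m, hm⟩ hIm
  have hm2 : m ≤ I ⊔ m • m := by
    refine (hmπ ⟨m, hm⟩).trans (sup_le ?_ ?_)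
    · rw [Ideal.span_singleton_le_iff_mem]
      have h1 := ht ⟨m, hm⟩
      rw [hlm] at h1
      have h2 : π ⟨m, hm⟩ = (t - algebraMap K B d) -
          (t - (algebraMap K B d + π ⟨m, hm⟩)) := by ring
      rw [h2]
      refine sub_mem (Ideal.mem_sup_left htI) (Ideal.mem_sup_right ?_)
      rwa [smul_eq_mul, ← sq]
    · rw [smul_eq_mul, ← sq]
      exact le_sup_right
  obtain ⟨r, hr, hrm⟩ := Submodule.exists_sub_one_mem_and_smul_le_of_fg_of_le_sup
    (I := m) (N := I) (N' := m) (IsNoetherian.noetherian m) le_rfl hm2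
  have hrI : I ⊔ Ideal.span {r} = ⊤ := by
    by_contra hne
    obtain ⟨m', hm', hle⟩ := Ideal.exists_le_maximal _ hne
    have h1 := hlabel ⟨m', hm'⟩ (le_sup_left.trans hle)
    obtain rfl : m = m' := congrArg MaximalSpectrum.asIdeal (hc (hlm.trans h1.symm))
    have h2 : r ∈ m := hle (Ideal.mem_sup_right (Ideal.mem_span_singleton_self r))
    exact hm.ne_top ((Ideal.eq_top_iff_one _).mpr (by simpa using sub_mem h2 hr))
  have hmI : m ≤ I := by
    intro x hx
    obtain ⟨i, hi, y, hy, h1⟩ := Submodule.mem_sup.mp ((Ideal.eq_top_iff_one _).mp hrI)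
    obtain ⟨b, rfl⟩ := Ideal.mem_span_singleton'.mp hy
    have h2 : r * x ∈ I := hrm (Submodule.smul_mem_pointwise_smul x r m hx)
    have h3 : x = x * i + b * (r * x) := by
      linear_combination -x * h1
    rw [h3]
    exact add_mem (I.mul_mem_left _ hi) (I.mul_mem_left _ h2)
  have := idim_maximal (K := K) m
  have := idim_mono (K := K) hmI
  omega

theorem exists_linearIndependent_pow
    (hB : ∀ m : Ideal B, m.IsMaximal → ∃ π ∈ m, m ≤ Ideal.span {π} ⊔ m ^ 2) :
    ∃ t : B, LinearIndependent K fun l : Fin (finrank K B) => t ^ (l : ℕ) := by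
  obtain ⟨t, ht⟩ := exists_finrank_le_idim (K := K) hB
  have h := finrank_le_natDegree_minpoly_of_splits (IsAlgClosed.splits _) ht
  exact ⟨t, (linearIndependent_pow t).comp (Fin.castLE h) (Fin.castLE_injective h)⟩

end Curvilinear

/-! ### Block structures on the space of linear forms -/

section BlockStructure

variable {k A E : Type*} [Field k] [CommRing A] [Algebra k A] [FiniteDimensional k A]
  [AddCommGroup E] [Module k E] [FiniteDimensional k E]
variable (K : Type*) [Field K] [IsAlgClosed K] [Algebra k K]

omit [FiniteDimensional k E] [IsAlgClosed K] in
theorem tmul_ne_smul_tmul {u₀ u₁ : A} (h : ∀ c : k, u₁ ≠ c • u₀) (c : K) :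
    (1 : K) ⊗ₜ[k] u₁ ≠ c • ((1 : K) ⊗ₜ[k] u₀) := by
  intro heq
  obtain ⟨f, hf, hf0⟩ := Submodule.exists_dual_map_eq_bot_of_notMem (p := Submodule.span k {u₀})
    (x := u₁) (fun hmem => by
      obtain ⟨c, hc⟩ := Submodule.mem_span_singleton.mp hmem
      exact h c hc.symm) inferInstance
  have hu₀ : f u₀ = 0 := by
    have : f u₀ ∈ (Submodule.span k {u₀}).map f :=
      Submodule.mem_map_of_mem (Submodule.mem_span_singleton_self _)
    rwa [hf0] at this
  have h1 := congrArg (extendFunctional K f) heq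
  rw [map_smul, extendFunctional_tmul, extendFunctional_tmul, hu₀, zero_smul, smul_zero] at h1
  exact hf (by simpa using h1)

variable {τ : A →ₗ[k] k} {ρ : E →ₗ[k] A}

omit [FiniteDimensional k E] in
/-- Two independent elements `u₀`, `t u₀` of the Gale dual series, the first one a unit, make the
space of linear forms a sum of strings for multiplication by `t`. -/
theorem exists_hasBlocks_of_pencil (hτ : IsTrace τ) (hρ : Function.Injective ρ)
    (hM : InGeneralPosition ((LinearMap.range ρ).baseChange K)) {u₀ t : A}
    (h₀ : u₀ ∈ orth τ (LinearMap.range ρ)) (h₁ : t * u₀ ∈ orth τ (LinearMap.range ρ))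
    (hu : IsUnit u₀) (hne : ∀ c : k, t * u₀ ≠ c • u₀) :
    ∃ (n : ℕ) (a : Fin n → ℕ), HasBlocks ρ t a ∧
      n + 1 ≤ finrank k (orth τ (LinearMap.range ρ)) ∧
      (3 * finrank k (orth τ (LinearMap.range ρ)) ≤
        finrank k (quadSpan (orth τ (LinearMap.range ρ)) u₀ (t * u₀)) + 2 → ∀ j, 1 ≤ a j) := by
  have hu0 : u₀ ≠ 0 := by
    rintro rfl
    exact hne 0 (by simp)
  obtain ⟨n, a, hblocks, hn, hpos⟩ := exists_hasBlocks hρ (t := t) fun P hP hPt =>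
    hM.eq_bot_of_stable (fun c => by
      have hmem : (1 : K) ⊗ₜ[k] (t * u₀) - c • ((1 : K) ⊗ₜ[k] u₀) ∈
          orth (extendFunctional K τ) ((LinearMap.range ρ).baseChange K) := by
        rw [← orth_baseChange K hτ]
        exact sub_mem (Submodule.tmul_mem_baseChange_of_mem _ h₁)
          (Submodule.smul_mem _ _ (Submodule.tmul_mem_baseChange_of_mem _ h₀))
      have h1 := hM.lt_idim_span_of_mem_orth (hτ.extendFunctional K) hmem
        (sub_ne_zero.mpr (tmul_ne_smul_tmul K hne c))
      rw [finrank_submodule_baseChange] at h1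
      refine (Nat.le_of_succ_le h1).trans (idim_mono ?_)
      rw [Ideal.span_singleton_le_iff_mem, Ideal.mem_span_singleton]
      refine ⟨(1 : K) ⊗ₜ[k] u₀, ?_⟩
      rw [sub_mul, Algebra.TensorProduct.tmul_mul_tmul, one_mul, Algebra.smul_def]) hP hPt
  refine ⟨n, a, hblocks, ?_, fun hq => hpos ?_⟩
  · have h1 := finrank_le_finrank_stepIn hτ h₀ h₁ hu0
    have h2 := LinearMap.finrank_range_of_inj hρ
    omega
  · exact stepIn_sup_map_eq hτ h₀ h₁ hu hu0 hq

omit [FiniteDimensional k E] in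
/-- A block structure in codimension one: here the Gale dual series is spanned by a single unit,
and a generator `t` of the algebra plays the role of the missing pencil. -/
theorem exists_hasBlocks_of_generator (hτ : IsTrace τ) (hρ : Function.Injective ρ)
    (hM : InGeneralPosition ((LinearMap.range ρ).baseChange K))
    (hA : finrank k A = finrank k E + 1) {t : A}
    (ht : LinearIndependent k fun l : Fin (finrank k A) => t ^ (l : ℕ)) :
    ∃ (n : ℕ) (a : Fin n → ℕ), HasBlocks ρ t a ∧ n ≤ 1 := by
  have h2 := LinearMap.finrank_range_of_inj hρ
  obtain ⟨n, a, hblocks, hn, -⟩ := exists_hasBlocks hρ (t := t) fun P hP hPt =>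
    hM.eq_bot_of_stable (fun c => by
      have h1 : finrank K (K ⊗[k] A) ≤
          idim K (Ideal.span {(1 : K) ⊗ₜ[k] t - algebraMap K (K ⊗[k] A) c}) + 1 :=
        finrank_le_idim_of_linearIndependent (k := K) (A := K ⊗[k] A)
          (linearIndependent_pow_tmul K ht) c
      rw [finrank_baseChange] at h1
      omega) hP hPt
  refine ⟨n, a, hblocks, ?_⟩
  have h3 := hτ.finrank_orth (LinearMap.range ρ)
  have h4 := stepIn_orth τ (orth τ (LinearMap.range ρ)) t
  rw [hτ.orth_orth] at h4
  have h5 := hτ.finrank_orth (orth τ (LinearMap.range ρ) ⊔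
    (orth τ (LinearMap.range ρ)).map (LinearMap.mulLeft k t))
  rw [← h4] at h5
  have h6 := Submodule.finrank_add_le_finrank_add_finrank (orth τ (LinearMap.range ρ))
    ((orth τ (LinearMap.range ρ)).map (LinearMap.mulLeft k t))
  have h7 := Submodule.finrank_map_le (LinearMap.mulLeft k t) (orth τ (LinearMap.range ρ))
  omega

/-- General position for the extension to `K` of the linear system `ρ`: if `W` is a nonzero space
of forms vanishing modulo the ideal `J`, then `J` has codimension at most `dim E - dim W`. -/
def LinearSystemInGeneralPosition (ρ : E →ₗ[k] A) : Prop :=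
  ∀ (J : Ideal (K ⊗[k] A)) (W : Submodule K (K ⊗[k] E)), W ≠ ⊥ →
    W.map (ρ.baseChange K) ≤ J.restrictScalars K →
      finrank k A + finrank K W ≤ finrank k E + idim K J

variable {K}

omit [FiniteDimensional k A] [IsAlgClosed K] in
theorem LinearSystemInGeneralPosition.finrank_add_finrank_ker_le
    (h : LinearSystemInGeneralPosition K ρ) (hker : LinearMap.ker ρ ≠ ⊥) :
    finrank k A + finrank k (LinearMap.ker ρ) ≤ finrank k E := by
  have h1 := h ⊥ ((LinearMap.ker ρ).baseChange K) (fun hbot => by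
    have h2 := finrank_submodule_baseChange K (LinearMap.ker ρ)
    rw [hbot, finrank_bot] at h2
    exact hker (Submodule.finrank_eq_zero.mp h2.symm)) (by
    rw [Submodule.map_le_iff_le_comap, Submodule.baseChange_eq_span, Submodule.span_le]
    rintro _ ⟨x, hx, rfl⟩
    have hx' : ρ x = 0 := hx
    simp [hx'])
  rwa [idim_bot, finrank_submodule_baseChange] at h1

omit [FiniteDimensional k A] [IsAlgClosed K] in
theorem LinearSystemInGeneralPosition.injective (h : LinearSystemInGeneralPosition K ρ)
    (hA : finrank k E ≤ finrank k A) : Function.Injective ρ := by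
  rw [← LinearMap.ker_eq_bot]
  by_contra hker
  have h1 := h.finrank_add_finrank_ker_le hker
  exact hker (Submodule.finrank_eq_zero.mp (by omega))

omit [IsAlgClosed K] in
theorem LinearSystemInGeneralPosition.range_eq_top (h : LinearSystemInGeneralPosition K ρ)
    (hA : finrank k A ≤ finrank k E) : LinearMap.range ρ = ⊤ := by
  have h2 := LinearMap.finrank_range_add_finrank_ker ρ
  refine Submodule.eq_top_of_finrank_eq (le_antisymm (Submodule.finrank_le _) ?_)
  by_cases hker : LinearMap.ker ρ = ⊥
  · rw [hker, finrank_bot] at h2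
    omega
  · have h1 := h.finrank_add_finrank_ker_le hker
    omega

omit [FiniteDimensional k A] [FiniteDimensional k E] [IsAlgClosed K] in
theorem LinearSystemInGeneralPosition.inGeneralPosition (h : LinearSystemInGeneralPosition K ρ)
    (hρ : Function.Injective ρ) :
    InGeneralPosition ((LinearMap.range ρ).baseChange K) := by
  intro J hJ
  have hinj : Function.Injective (ρ.baseChange K) :=
    Module.Flat.lTensor_preserves_injective_linearMap ρ hρ
  have hrange : (LinearMap.range ρ).baseChange K = LinearMap.range (ρ.baseChange K) := by
    apply le_antisymm
    · rw [Submodule.baseChange_eq_span, Submodule.span_le]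
      rintro _ ⟨_, ⟨x, rfl⟩, rfl⟩
      exact ⟨1 ⊗ₜ x, by simp⟩
    · rintro _ ⟨x, rfl⟩
      induction x with
      | zero => simp
      | add x y hx hy => rw [map_add]; exact add_mem hx hy
      | tmul c x => exact Submodule.tmul_mem_baseChange_of_mem _ ⟨x, rfl⟩
  have hmap : ((J.restrictScalars K).comap (ρ.baseChange K)).map (ρ.baseChange K) =
      J.restrictScalars K ⊓ (LinearMap.range ρ).baseChange K := by
    rw [Submodule.map_comap_eq, hrange, inf_comm]
  have h1 := h J ((J.restrictScalars K).comap (ρ.baseChange K)) (fun hbot => hJ (by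
    rw [← hmap, hbot, Submodule.map_bot])) (Submodule.map_comap_le _ _)
  rw [← hmap, finrank_baseChange, finrank_submodule_baseChange,
    LinearMap.finrank_range_of_inj hρ,
    ← (Submodule.equivMapOfInjective _ hinj _).finrank_eq]
  exact h1

/-- The algebraic core: a Gorenstein algebra `A` with a linear system in general position has a
block structure with `s` blocks, without trivial blocks if `2 s ≤ dim E`. -/
theorem exists_hasBlocks_of_inGeneralPosition [Infinite k] (hτ : IsTrace τ) {s : ℕ} (hs : 1 ≤ s)
    (hsE : s < finrank k E) (h : LinearSystemInGeneralPosition K ρ)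
    (hcurv : finrank k A ≤ finrank k E + 1 → ∀ m : Ideal (K ⊗[k] A), m.IsMaximal →
      ∃ π ∈ m, m ≤ Ideal.span {π} ⊔ m ^ 2)
    (hA : finrank k A ≤ finrank k E + s + 1) :
    (∃ (t : A) (a : Fin s → ℕ), HasBlocks ρ t a) ∧
      (2 * s ≤ finrank k E → ∃ (t : A) (a : Fin s → ℕ), HasBlocks ρ t a ∧ ∀ j, 1 ≤ a j) := by
  have hgen (hle : finrank k A ≤ finrank k E + 1) :
      ∃ t : A, LinearIndependent k fun l : Fin (finrank k A) => t ^ (l : ℕ) := by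
    obtain ⟨t, ht⟩ := exists_linearIndependent_pow (K := K) (hcurv hle)
    rw [finrank_baseChange] at ht
    exact descend_generator K ht
  -- a single block suffices
  have hone {t : A} {n : ℕ} {a : Fin n → ℕ} (hn : n ≤ 1) (hb : HasBlocks ρ t a) :
      (∃ (t : A) (a : Fin s → ℕ), HasBlocks ρ t a) ∧
        (2 * s ≤ finrank k E → ∃ (t : A) (a : Fin s → ℕ), HasBlocks ρ t a ∧ ∀ j, 1 ≤ a j) := by
    have ha : 2 * s ≤ finrank k E → ∀ j, 1 ≤ a j := by
      intro h2 j
      obtain ⟨-, -, -, -, hsum⟩ := hb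
      have h3 : ∑ i, (a i + 1) = a j + 1 := by
        refine Finset.sum_eq_single_of_mem j (Finset.mem_univ _) fun i _ hij => ?_
        exact absurd (Fin.ext (by omega)) hij
      omega
    refine ⟨?_, fun h2 => ?_⟩
    · obtain ⟨a', ha'⟩ := hb.exists_of_le (hn.trans hs) hsE.le
      exact ⟨t, a', ha'⟩
    · obtain ⟨a', ha', hpos⟩ := hb.exists_pos_of_le (ha h2) (hn.trans hs) h2
      exact ⟨t, a', ha', hpos⟩
  rcases le_or_gt (finrank k A) (finrank k E) with hle | hgt
  · obtain ⟨t, ht⟩ := hgen (by omega)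
    exact hone le_rfl (hasBlocks_of_surjective (h.range_eq_top hle)
      (r := finrank k E - 1) (by omega) ht)
  have hρ := h.injective hgt.le
  have hM := h.inGeneralPosition hρ
  rcases Nat.lt_or_ge (finrank k E + 1) (finrank k A) with hgt' | hle
  swap
  · obtain ⟨t, ht⟩ := hgen hle
    obtain ⟨n, a, hb, hn⟩ := exists_hasBlocks_of_generator K hτ hρ hM (by omega) ht
    exact hone hn hb
  have hdimM := LinearMap.finrank_range_of_inj hρ
  have hdimV := hτ.finrank_orth (LinearMap.range ρ)
  set V := orth τ (LinearMap.range ρ) with hV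
  have hVK := orth_baseChange K hτ (LinearMap.range ρ)
  rw [← hV] at hVK
  obtain ⟨e, he, heu⟩ := hM.exists_isUnit_mem_orth (hτ.extendFunctional K) (by
    rw [finrank_submodule_baseChange, finrank_baseChange]
    omega)
  rw [← hVK] at he
  have hfinish {u₀ u₁ : A} (h₀ : u₀ ∈ V) (h₁ : u₁ ∈ V) (hu : IsUnit u₀)
      (hne : ∀ c : k, u₁ ≠ c • u₀) :
      ∃ (t : A) (n : ℕ) (a : Fin n → ℕ), HasBlocks ρ t a ∧ n ≤ s ∧
        (3 * finrank k V ≤ finrank k (quadSpan V u₀ u₁) + 2 → ∀ j, 1 ≤ a j) := by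
    obtain ⟨u, rfl⟩ := hu
    have h2 : (u₁ * ↑u⁻¹ : A) * u = u₁ := by rw [mul_assoc, u.inv_mul, mul_one]
    obtain ⟨n, a, hb, hn, hpos⟩ := exists_hasBlocks_of_pencil K hτ hρ hM
      (t := u₁ * ↑u⁻¹) h₀ (by rwa [h2]) u.isUnit (by rwa [h2])
    rw [h2] at hpos
    exact ⟨_, n, a, hb, by rw [← hV] at hn; omega, hpos⟩
  refine ⟨?_, fun h2 => ?_⟩
  · obtain ⟨u₀, h₀, -, -, hu, -⟩ := descend_pencil (N := 0) K he heu (zero_mem _) (zero_mem _)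
      (Nat.zero_le _)
    obtain ⟨u₁, h₁, hne⟩ : ∃ u₁ ∈ V, u₁ ∉ Submodule.span k {u₀} := by
      by_contra! hall
      have h3 := Submodule.finrank_mono hall
      have h4 := finrank_span_le_card (R := k) ({u₀} : Set A)
      simp only [Set.toFinset_singleton, Finset.card_singleton] at h4
      have := h3.trans h4
      omega
    obtain ⟨t, n, a, hb, hn, -⟩ := hfinish h₀ h₁ hu fun c hc =>
      hne (Submodule.mem_span_singleton.mpr ⟨c, hc.symm⟩)
    obtain ⟨a', ha'⟩ := hb.exists_of_le hn hsE.le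
    exact ⟨t, a', ha'⟩
  · obtain ⟨s', hs'⟩ := Nat.exists_eq_add_of_lt hgt
    obtain ⟨v₀, hv₀, v₁, hv₁, hN⟩ := exists_pencil (K := K) (V := V.baseChange K) (m := finrank k E)
      (s := s') (hτ.extendFunctional K)
      (by rw [finrank_baseChange]; omega) (by rw [finrank_submodule_baseChange]; omega)
      (by omega) (fun u hu hu0 => by
        rw [hVK] at hu
        have := hM.lt_idim_span_of_mem_orth (hτ.extendFunctional K) hu hu0
        rwa [finrank_submodule_baseChange, hdimM] at this) he heu
    obtain ⟨u₀, h₀, u₁, h₁, hu, hN'⟩ := descend_pencil K he heu hv₀ hv₁ hN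
    obtain ⟨t, n, a, hb, hn, hpos⟩ := hfinish h₀ h₁ hu (by
      rintro c rfl
      -- a degenerate pencil has too small a quadratic span
      have hle : quadSpan V u₀ (c • u₀) ≤ V.map (LinearMap.mulLeft k (u₀ * u₀)) := by
        refine sup_le (sup_le le_rfl ?_) ?_ <;> rintro _ ⟨v, hv, rfl⟩
        · exact ⟨c • v, V.smul_mem c hv, by simp [mul_assoc]⟩
        · exact ⟨(c * c) • v, V.smul_mem _ hv, by simp [mul_smul, mul_assoc]⟩
      have h3 := (Submodule.finrank_mono hle).trans (Submodule.finrank_map_le _ _)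
      omega)
    obtain ⟨a', ha', hpos'⟩ := hb.exists_pos_of_le (hpos (by omega)) hn h2
    exact ⟨t, a', ha', hpos'⟩

end BlockStructure

/-! ### Gorenstein and curvilinear local rings -/

section LocalRings

/-- The elements of a ring that are killed by the ideal `m`. -/
def socle {A : Type*} [CommRing A] (m : Ideal A) : Ideal A := m.annihilator

theorem mem_socle {A : Type*} [CommRing A] {m : Ideal A} {x : A} :
    x ∈ socle m ↔ ∀ a ∈ m, a * x = 0 := by
  simp only [socle, Submodule.mem_annihilator, smul_eq_mul, mul_comm x]

theorem eq_zero_of_mem_socle {A : Type*} [CommRing A] {m : Ideal A} (hm : m.IsMaximal) {x c : A}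
    (hx : x ∈ socle m) (hc : c ∉ m) (hcx : c * x = 0) : x = 0 := by
  obtain ⟨b, a, ha, h⟩ := hm.exists_inv hc
  calc x = (b * c + a) * x := by rw [h, one_mul]
    _ = b * (c * x) + a * x := by ring
    _ = 0 := by rw [hcx, mem_socle.mp hx a ha, mul_zero, add_zero]

/-- If the local ring at `m` is self-injective, the socle at `m` is simple. -/
theorem dvd_of_mem_socle {A : Type u} [CommRing A] (m : Ideal A) [hm : m.IsMaximal]
    (hinj : Module.Injective (Localization.AtPrime m) (Localization.AtPrime m)) {x y : A}
    (hx : x ∈ socle m) (hy : y ∈ socle m) (hx0 : x ≠ 0) : x ∣ y := by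
  let R := Localization.AtPrime m
  let X : R := algebraMap A R x
  let Y : R := algebraMap A R y
  have hle : Ideal.torsionOf R R X ≤ LinearMap.ker (LinearMap.toSpanSingleton R R Y) := by
    intro r hr
    obtain ⟨a, s, rfl⟩ := IsLocalization.exists_mk'_eq m.primeCompl r
    have h1 : IsLocalization.mk' R a s * X = 0 := hr
    have h2 : algebraMap A R (a * x) = 0 := by
      rw [map_mul, ← IsLocalization.mk'_spec' R a s, mul_assoc, h1, mul_zero]
    obtain ⟨c, hc⟩ := (IsLocalization.map_eq_zero_iff m.primeCompl R _).mp h2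
    have ha : a ∈ m := by
      by_contra ha
      refine hx0 (eq_zero_of_mem_socle hm hx (c := c * a) ?_ (by rw [mul_assoc, hc]))
      exact fun h => (hm.isPrime.mem_or_mem h).elim c.2 ha
    have h3 : algebraMap A R s * (IsLocalization.mk' R a s * Y) = 0 := by
      rw [← mul_assoc, IsLocalization.mk'_spec', ← map_mul, mem_socle.mp hy a ha, map_zero]
    exact (IsLocalization.map_units R s).mul_right_eq_zero.mp h3
  let f : Ideal.span {X} →ₗ[R] R :=
    (Ideal.torsionOf R R X).liftQ _ hle ∘ₗ
      (Ideal.quotTorsionOfEquivSpanSingleton R R X).symm.toLinearMap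
  obtain ⟨g, hg⟩ := Module.Baer.iff_injective.mpr hinj (Ideal.span {X}) f
  have hX : X ∈ Ideal.span {X} := Ideal.mem_span_singleton_self X
  have h1 : g X = Y := by
    rw [hg X hX]
    have h2 : (Ideal.quotTorsionOfEquivSpanSingleton R R X).symm ⟨X, hX⟩ =
        Submodule.Quotient.mk 1 := by
      rw [LinearEquiv.symm_apply_eq, Ideal.quotTorsionOfEquivSpanSingleton_apply_mk]
      simp
    change (Ideal.torsionOf R R X).liftQ _ hle
      ((Ideal.quotTorsionOfEquivSpanSingleton R R X).symm ⟨X, hX⟩) = Y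
    rw [h2, Submodule.liftQ_apply, LinearMap.toSpanSingleton_apply, one_smul]
  obtain ⟨b, s, hbs⟩ := IsLocalization.exists_mk'_eq m.primeCompl (g 1)
  have h2 : algebraMap A R (s * y - b * x) = 0 := by
    have h3 : Y = X * g 1 := by
      rw [← h1, ← smul_eq_mul, ← map_smul, smul_eq_mul, mul_one]
    rw [map_sub, map_mul, map_mul, sub_eq_zero]
    change algebraMap A R s * Y = algebraMap A R b * X
    rw [h3, ← hbs, mul_left_comm, IsLocalization.mk'_spec', mul_comm]
  obtain ⟨c, hc⟩ := (IsLocalization.map_eq_zero_iff m.primeCompl R _).mp h2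
  have h3 := eq_zero_of_mem_socle hm
    (sub_mem ((socle m).mul_mem_left _ hy) ((socle m).mul_mem_left _ hx)) c.2 hc
  obtain ⟨d, a, ha, h⟩ := hm.exists_inv s.2
  refine ⟨d * b, ?_⟩
  calc y = (d * s + a) * y := by rw [h, one_mul]
    _ = d * (s * y - b * x) + a * y + x * (d * b) := by ring
    _ = x * (d * b) := by rw [h3, mem_socle.mp hy a ha, mul_zero, zero_add, zero_add]

/-- A finite-dimensional algebra with self-injective local rings has a nondegenerate trace: a
functional that is nonzero on each of the finitely many simple socles. -/
theorem exists_isTrace {k : Type*} {A : Type u} [Field k] [Infinite k] [CommRing A] [Algebra k A]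
    [FiniteDimensional k A]
    (hinj : ∀ (m : Ideal A) [m.IsMaximal],
      Module.Injective (Localization.AtPrime m) (Localization.AtPrime m)) :
    ∃ τ : A →ₗ[k] k, IsTrace τ := by
  have : IsArtinianRing A := IsArtinianRing.of_finite k A
  let ι := {m : MaximalSpectrum A // socle m.asIdeal ≠ ⊥}
  have hτ : ∃ τ : A →ₗ[k] k, ∀ m : ι, ∃ y ∈ socle m.1.asIdeal, τ y ≠ 0 := by
    by_contra! hno
    obtain ⟨m, hm⟩ := Subspace.exists_eq_top_of_iUnion_eq_univ (k := k) (E := A →ₗ[k] k)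
      (p := fun m : ι => ((socle m.1.asIdeal).restrictScalars k).dualAnnihilator) (by
      rw [Set.eq_univ_iff_forall]
      intro τ
      obtain ⟨m, hm⟩ := hno τ
      refine Set.mem_iUnion.mpr ⟨m, ?_⟩
      exact (Submodule.mem_dualAnnihilator τ).mpr hm)
    rw [Submodule.dualAnnihilator_eq_top_iff] at hm
    exact m.2 (Submodule.restrictScalars_injective k A A hm)
  obtain ⟨τ, hτ⟩ := hτ
  refine ⟨τ, fun x hx => ?_⟩
  by_contra hx0
  obtain ⟨P, hPass, -⟩ := exists_le_isAssociatedPrime_of_isNoetherianRing A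
    (M := Ideal.span {x}) ⟨x, Ideal.mem_span_singleton_self x⟩ fun h => hx0 (congrArg Subtype.val h)
  obtain ⟨hP, ⟨z, hz⟩, hPz⟩ := isAssociatedPrime_iff.mp hPass
  have hPm : P.IsMaximal := IsArtinianRing.isMaximal_of_isPrime P
  have hPz' : ∀ a, a ∈ P ↔ a * z = 0 := by
    intro a
    rw [hPz]
    simp [Submodule.mem_colon_singleton, Subtype.ext_iff]
  have hz0 : z ≠ 0 := by
    rintro rfl
    exact hP.ne_top ((Ideal.eq_top_iff_one _).mpr ((hPz' 1).mpr (mul_zero 1)))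
  have hzs : z ∈ socle P := mem_socle.mpr fun a ha => (hPz' a).mp ha
  obtain ⟨y, hy, hτy⟩ := hτ ⟨⟨P, hPm⟩, fun h => hz0 (by simpa [h] using hzs)⟩
  obtain ⟨b, rfl⟩ := dvd_of_mem_socle P (hinj P) hzs hy hz0
  obtain ⟨c, rfl⟩ := Ideal.mem_span_singleton'.mp hz
  exact hτy (by rw [mul_comm c, mul_assoc]; exact hx _)

/-- If the local ring at `m` is a principal ideal ring, `m` is principal modulo its square. -/
theorem exists_le_span_sup_sq {A : Type*} [CommRing A] (m : Ideal A) [hm : m.IsMaximal]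
    [IsPrincipalIdealRing (Localization.AtPrime m)] :
    ∃ π ∈ m, m ≤ Ideal.span {π} ⊔ m ^ 2 := by
  let R := Localization.AtPrime m
  obtain ⟨p, hp⟩ := IsPrincipalIdealRing.principal (IsLocalRing.maximalIdeal R)
  obtain ⟨π, s, rfl⟩ := IsLocalization.exists_mk'_eq m.primeCompl p
  refine ⟨π, ?_, fun x hx => ?_⟩
  · rw [← IsLocalization.AtPrime.mk'_mem_maximal_iff (S := R) m π s, hp]
    exact Submodule.mem_span_singleton_self _
  · have h1 : algebraMap A R x ∈ IsLocalRing.maximalIdeal R :=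
      (IsLocalization.AtPrime.to_map_mem_maximal_iff R m x).mpr hx
    rw [hp] at h1
    obtain ⟨q, hq⟩ := Submodule.mem_span_singleton.mp h1
    obtain ⟨b, s', rfl⟩ := IsLocalization.exists_mk'_eq m.primeCompl q
    rw [smul_eq_mul, ← IsLocalization.mk'_mul, IsLocalization.mk'_eq_iff_eq_mul, ← map_mul,
      IsLocalization.eq_iff_exists m.primeCompl] at hq
    obtain ⟨c, hc⟩ := hq
    obtain ⟨d, a, ha, h⟩ := hm.exists_inv (c * (s' * s)).2
    have h2 : x = d * c * b * π + a * x := by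
      have h3 : d * (c * (s' * s) : A) + a = 1 := h
      have h4 : (c * (b * π) : A) = c * (x * (s' * s)) := hc
      linear_combination (-x) * h3 - d * h4
    rw [h2]
    refine add_mem (Ideal.mem_sup_left (Ideal.mul_mem_left _ _ (Ideal.mem_span_singleton_self π)))
      (Ideal.mem_sup_right ?_)
    rw [sq]
    exact Ideal.mul_mem_mul ha hx

end LocalRings

open HomogeneousLocalization

/-! ### Charts of `Proj` and points with values in a ring -/

section Chart

variable {A B C σ τ : Type u} [CommRing A] [SetLike σ A] [AddSubgroupClass σ A]
  [CommRing B] [SetLike τ B] [AddSubgroupClass τ B] [CommRing C]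
  (𝒜 : ℕ → σ) (ℬ : ℕ → τ) [GradedRing 𝒜] [GradedRing ℬ]

/-- The ring homomorphism `x / s ^ n ↦ f x / (f s) ^ n` on the degree zero part of `A[1 / s]`,
for a ring homomorphism `f` that sends `s` to a unit. -/
noncomputable def evalAway (f : A →+* C) (s : A) (h : IsUnit (f s)) : Away 𝒜 s →+* C :=
  (IsLocalization.Away.lift s h).comp (algebraMap (Away 𝒜 s) (Localization.Away s))

variable {𝒜 ℬ}

theorem evalAway_mk_mul {f : A →+* C} {s : A} (h : IsUnit (f s)) {i : ℕ} (hs : s ∈ 𝒜 i) (n : ℕ)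
    (x : A) (hx : x ∈ 𝒜 (n • i)) : evalAway 𝒜 f s h (Away.mk 𝒜 hs n x hx) * f s ^ n = f x := by
  rw [evalAway, RingHom.comp_apply, HomogeneousLocalization.algebraMap_apply, Away.val_mk,
    Localization.mk_eq_mk', ← IsLocalization.Away.lift_eq (S := Localization.Away s) s h, ← map_pow,
    ← map_mul, ← IsLocalization.Away.lift_eq (S := Localization.Away s) s h x]
  congr 1
  rw [← map_pow]
  exact IsLocalization.mk'_spec _ x (⟨s ^ n, n, rfl⟩ : Submonoid.powers s)

theorem evalAway_mk {f : A →+* C} {s : A} (h : IsUnit (f s)) (h1 : f s = 1) {i : ℕ} (hs : s ∈ 𝒜 i)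
    (n : ℕ) (x : A) (hx : x ∈ 𝒜 (n • i)) :
    evalAway 𝒜 f s h (Away.mk 𝒜 hs n x hx) = f x := by
  have := evalAway_mk_mul h hs n x hx
  rwa [h1, one_pow, mul_one] at this

theorem ext_evalAway {f : A →+* C} {s : A} (h : IsUnit (f s)) {i : ℕ} (hs : s ∈ 𝒜 i)
    {g : Away 𝒜 s →+* C}
    (hg : ∀ (n : ℕ) (x : A) (hx : x ∈ 𝒜 (n • i)), g (Away.mk 𝒜 hs n x hx) * f s ^ n = f x) :
    g = evalAway 𝒜 f s h := by
  ext q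
  obtain ⟨n, x, hx, rfl⟩ := Away.mk_surjective 𝒜 hs q
  apply (h.pow n).mul_right_cancel
  rw [hg, evalAway_mk_mul]

variable (𝒜) in
/-- The `C`-valued point of `Proj 𝒜` given by a ring homomorphism `A → C` that sends a
homogeneous element `s` of positive degree to a unit. -/
noncomputable def chartPoint (f : A →+* C) {s : A} {i : ℕ} (hs : s ∈ 𝒜 i) (hi : 0 < i)
    (h : IsUnit (f s)) : Spec (.of C) ⟶ Proj 𝒜 :=
  Spec.map (CommRingCat.ofHom (evalAway 𝒜 f s h)) ≫ Proj.awayι 𝒜 s hs hi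

theorem specMap_chartPoint {D : Type u} [CommRing D] (g : C →+* D) (f : A →+* C) {s : A} {i : ℕ}
    (hs : s ∈ 𝒜 i) (hi : 0 < i) (h : IsUnit (f s)) :
    Spec.map (CommRingCat.ofHom g) ≫ chartPoint 𝒜 f hs hi h =
      chartPoint 𝒜 (g.comp f) hs hi (h.map g) := by
  rw [chartPoint, chartPoint, ← Category.assoc, ← Spec.map_comp, ← CommRingCat.ofHom_comp]
  congr 3
  refine ext_evalAway _ hs fun n x hx => ?_
  rw [RingHom.comp_apply, RingHom.comp_apply, RingHom.comp_apply, ← map_pow, ← map_mul,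
    evalAway_mk_mul]

theorem chartPoint_map (φ : 𝒜 →+*ᵍ ℬ)
    (hφ : HomogeneousIdeal.irrelevant ℬ ≤ (HomogeneousIdeal.irrelevant 𝒜).map φ) (f : B →+* C)
    {s : A} {i : ℕ} (hs : s ∈ 𝒜 i) (hi : 0 < i) (h : IsUnit (f (φ s))) :
    chartPoint ℬ f (φ.2 hs) hi h ≫ Proj.map φ hφ =
      chartPoint 𝒜 (f.comp φ.toRingHom) hs hi h := by
  rw [chartPoint, chartPoint, Category.assoc]
  erw [Proj.awayι_comp_map φ hφ hi s hs]
  rw [← Category.assoc, ← Spec.map_comp, ← CommRingCat.ofHom_comp]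
  congr 3
  refine ext_evalAway _ hs fun n x hx => ?_
  rw [RingHom.comp_apply, Away.map_mk]
  exact evalAway_mk_mul h (φ.2 hs) n (φ x) _

theorem evalAway_comp_fromZeroRingHom (f : A →+* C) {s : A} {i : ℕ} (hs : s ∈ 𝒜 i)
    (h : IsUnit (f s)) :
    (evalAway 𝒜 f s h).comp (fromZeroRingHom 𝒜 (.powers s)) = f.comp (algebraMap (𝒜 0) A) := by
  ext x
  have h1 := evalAway_mk_mul (𝒜 := 𝒜) h hs 0 x (by simp)
  rw [pow_zero, mul_one] at h1
  rw [RingHom.comp_apply, RingHom.comp_apply]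
  refine Eq.trans ?_ h1
  congr 1
  apply HomogeneousLocalization.val_injective
  rw [Away.val_mk]
  change (HomogeneousLocalization.mk _).val = _
  rw [HomogeneousLocalization.val_mk]
  simp

theorem chartPoint_toSpecZero (f : A →+* C) {s : A} {i : ℕ} (hs : s ∈ 𝒜 i) (hi : 0 < i)
    (h : IsUnit (f s)) :
    chartPoint 𝒜 f hs hi h ≫ Proj.toSpecZero 𝒜 =
      Spec.map (CommRingCat.ofHom (f.comp (algebraMap (𝒜 0) A))) := by
  rw [chartPoint, Category.assoc, Proj.awayι_toSpecZero, ← Spec.map_comp,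
    ← CommRingCat.ofHom_comp, evalAway_comp_fromZeroRingHom f hs]

/-- The functions on the chart `D₊(s)`, pulled back to the whole chart. -/
theorem awayι_appLE_awayToSection {s : A} {i : ℕ} (hs : s ∈ 𝒜 i) (hi : 0 < i)
    (h : ⊤ ≤ Proj.awayι 𝒜 s hs hi ⁻¹ᵁ Proj.basicOpen 𝒜 s) :
    Proj.awayToSection 𝒜 s ≫ (Proj.awayι 𝒜 s hs hi).appLE (Proj.basicOpen 𝒜 s) ⊤ h =
      (Scheme.ΓSpecIso _).inv := by
  have h1 := Proj.basicOpenToSpec_app_top 𝒜 s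
  have h2 : Proj.basicOpenToSpec 𝒜 s ≫ Proj.awayι 𝒜 s hs hi = (Proj.basicOpen 𝒜 s).ι := by
    rw [← Proj.basicOpenIsoSpec_hom 𝒜 s hs hi, Proj.awayι, Iso.hom_inv_id_assoc]
  have : IsIso (Proj.basicOpenToSpec 𝒜 s) := by
    rw [← Proj.basicOpenIsoSpec_hom 𝒜 s hs hi]
    infer_instance
  rw [← cancel_mono ((Proj.basicOpenToSpec 𝒜 s).app ⊤)]
  have h4 : Proj.basicOpenToSpec 𝒜 s ⁻¹ᵁ ⊤ ≤
      (Proj.basicOpenToSpec 𝒜 s ≫ Proj.awayι 𝒜 s hs hi) ⁻¹ᵁ Proj.basicOpen 𝒜 s := by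
    rw [h2, Scheme.Opens.ι_preimage_self]
    exact le_top
  have h3 : (Proj.awayι 𝒜 s hs hi).appLE (Proj.basicOpen 𝒜 s) ⊤ h ≫
      (Proj.basicOpenToSpec 𝒜 s).appLE ⊤ (Proj.basicOpenToSpec 𝒜 s ⁻¹ᵁ ⊤) le_rfl =
      (Proj.basicOpenToSpec 𝒜 s ≫ Proj.awayι 𝒜 s hs hi).appLE (Proj.basicOpen 𝒜 s)
        (Proj.basicOpenToSpec 𝒜 s ⁻¹ᵁ ⊤) h4 :=
    Scheme.Hom.appLE_comp_appLE (Proj.basicOpenToSpec 𝒜 s) (Proj.awayι 𝒜 s hs hi)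
      (Proj.basicOpen 𝒜 s) ⊤ (Proj.basicOpenToSpec 𝒜 s ⁻¹ᵁ ⊤) h le_rfl
  rw [Category.assoc, Scheme.Hom.app_eq_appLE, h3, ← Scheme.Hom.app_eq_appLE, h1]
  refine Eq.trans ?_ (Iso.inv_hom_id_assoc (Scheme.ΓSpecIso _) _).symm
  simp only [h2]
  congr 1

/-- Whether a form `p` of degree `d` vanishes can be tested in a single chart. -/
theorem app_awayToSection_eq_zero {Z : Scheme.{u}} (z : Z ⟶ Proj 𝒜) {s t : A} (hs : s ∈ 𝒜 1)
    (ht : t ∈ 𝒜 1) {d : ℕ} {p : A} (hp : p ∈ 𝒜 (d • 1))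
    (hz : ⊤ ≤ z ⁻¹ᵁ Proj.basicOpen 𝒜 s)
    (h : z.appLE (Proj.basicOpen 𝒜 s) ⊤ hz (Proj.awayToSection 𝒜 s (Away.mk 𝒜 hs d p hp)) = 0) :
    z.app (Proj.basicOpen 𝒜 t) (Proj.awayToSection 𝒜 t (Away.mk 𝒜 ht d p hp)) = 0 := by
  have hst : s ^ d * s ^ d ∈ 𝒜 (d • (1 + 1)) := by
    have := SetLike.mul_mem_graded (SetLike.pow_mem_graded d hs) (SetLike.pow_mem_graded d hs)
    rwa [← smul_add] at this
  have hx : t * s = s * t := mul_comm t s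
  have hmul : awayMap 𝒜 hs rfl (Away.mk 𝒜 ht d p hp) = awayMap 𝒜 ht hx (Away.mk 𝒜 hs d p hp) *
      Away.mk 𝒜 (SetLike.mul_mem_graded ht hs) d (s ^ d * s ^ d) hst := by
    apply HomogeneousLocalization.val_injective
    rw [HomogeneousLocalization.val_mul, awayMap_mk, awayMap_mk, Away.val_mk, Away.val_mk,
      Away.val_mk, Localization.mk_mul, Localization.mk_eq_mk_iff, Localization.r_iff_exists]
    refine ⟨1, ?_⟩
    simp only [OneMemClass.coe_one, one_mul, Submonoid.coe_mul]
    ring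
  set V := z ⁻¹ᵁ Proj.basicOpen 𝒜 t with hV
  have e : V ≤ z ⁻¹ᵁ Proj.basicOpen 𝒜 (t * s) := by
    rw [Proj.basicOpen_mul]
    exact fun y hy => ⟨hy, hz trivial⟩
  have h1 : Proj.awayToSection 𝒜 (t * s) (awayMap 𝒜 hs rfl (Away.mk 𝒜 ht d p hp)) =
      (Proj 𝒜).presheaf.map (homOfLE (Proj.basicOpen_mono 𝒜 t (t * s) ⟨s, rfl⟩)).op
        (Proj.awayToSection 𝒜 t (Away.mk 𝒜 ht d p hp)) :=
    congr($(Proj.awayMap_awayToSection 𝒜 hs (f := t) rfl) (Away.mk 𝒜 ht d p hp))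
  have h2 : Proj.awayToSection 𝒜 (t * s) (awayMap 𝒜 ht hx (Away.mk 𝒜 hs d p hp)) =
      (Proj 𝒜).presheaf.map (homOfLE (Proj.basicOpen_mono 𝒜 s (t * s) ⟨t, hx⟩)).op
        (Proj.awayToSection 𝒜 s (Away.mk 𝒜 hs d p hp)) :=
    congr($(Proj.awayMap_awayToSection 𝒜 ht hx) (Away.mk 𝒜 hs d p hp))
  have h3 := congr($(Scheme.Hom.map_appLE z (V := V) e
    (homOfLE (Proj.basicOpen_mono 𝒜 t (t * s) ⟨s, rfl⟩)).op)
    (Proj.awayToSection 𝒜 t (Away.mk 𝒜 ht d p hp)))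
  have h4 := congr($(Scheme.Hom.map_appLE z (V := V) e
    (homOfLE (Proj.basicOpen_mono 𝒜 s (t * s) ⟨t, hx⟩)).op)
    (Proj.awayToSection 𝒜 s (Away.mk 𝒜 hs d p hp)))
  have h5 := congr($(Scheme.Hom.appLE_map z hz (homOfLE (le_top : V ≤ ⊤)).op)
    (Proj.awayToSection 𝒜 s (Away.mk 𝒜 hs d p hp)))
  simp only [CommRingCat.comp_apply] at h3 h4 h5
  rw [Scheme.Hom.app_eq_appLE, ← h3, ← h1, hmul, map_mul, map_mul, h2, h4, ← h5, h, map_zero,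
    zero_mul]

theorem isPullback_awayι (φ : 𝒜 →+*ᵍ ℬ)
    (hφ : HomogeneousIdeal.irrelevant ℬ ≤ (HomogeneousIdeal.irrelevant 𝒜).map φ)
    {s : A} {i : ℕ} (hs : s ∈ 𝒜 i) (hφs : φ s ∈ ℬ i) (hi : 0 < i) :
    IsPullback (Spec.map (CommRingCat.ofHom (Away.map φ s)))
      (Proj.awayι ℬ (φ s) hφs hi) (Proj.awayι 𝒜 s hs hi) (Proj.map φ hφ) := by
  refine IsOpenImmersion.isPullback _ _ _ _ (Proj.awayι_comp_map φ hφ hi s hs) ?_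
  rw [Proj.opensRange_awayι, Proj.opensRange_awayι, Proj.map_preimage_basicOpen]

/-- A surjective homomorphism of graded rings induces a closed immersion. -/
theorem isClosedImmersion_map (φ : 𝒜 →+*ᵍ ℬ)
    (hφ : HomogeneousIdeal.irrelevant ℬ ≤ (HomogeneousIdeal.irrelevant 𝒜).map φ)
    (hsurj : ∀ d, ∀ y ∈ ℬ d, ∃ x ∈ 𝒜 d, φ x = y) : IsClosedImmersion (Proj.map φ hφ) := by
  rw [IsZariskiLocalAtTarget.iff_of_openCover (P := @IsClosedImmersion)
    (Proj.affineOpenCover 𝒜).openCover]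
  rintro ⟨i, ⟨s, hs⟩⟩
  have hφs : φ s ∈ ℬ i := φ.map_mem hs
  have hpb := (isPullback_awayι φ hφ hs hφs i.2).flip
  have : IsClosedImmersion (Spec.map (CommRingCat.ofHom (Away.map φ s))) := by
    refine IsClosedImmersion.spec_of_surjective _ fun q => ?_
    obtain ⟨n, y, hy, rfl⟩ := Away.mk_surjective ℬ hφs q
    obtain ⟨x, hx, rfl⟩ := hsurj _ y hy
    exact ⟨Away.mk 𝒜 hs n x hx, Away.map_mk φ s hs n x hx⟩
  have h1 := hpb.isoPullback_inv_snd
  change IsClosedImmersion (Limits.pullback.snd (Proj.map φ hφ) (Proj.awayι 𝒜 s hs i.2))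
  rw [← h1]
  infer_instance

end Chart

attribute [local instance] MvPolynomial.gradedAlgebra

/-! ### Points of projective space in coordinates -/

section Homogeneity

theorem eval₂_mul_of_isHomogeneous {σ R S : Type*} [CommRing R] [CommRing S]
    {p : MvPolynomial σ R} {n : ℕ} (hp : p.IsHomogeneous n) (f : R →+* S) (g : σ → S) (c : S) :
    p.eval₂ f (fun i => c * g i) = c ^ n * p.eval₂ f g := by
  rw [MvPolynomial.eval₂_eq, MvPolynomial.eval₂_eq, Finset.mul_sum]
  refine Finset.sum_congr rfl fun d hd => ?_
  have h1 : ∑ i ∈ d.support, d i = n := by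
    rw [← hp (MvPolynomial.mem_support_iff.mp hd), Finsupp.weight_apply, Finsupp.sum]
    simp
  simp only [mul_pow, Finset.prod_mul_distrib, Finset.prod_pow_eq_pow_sum, h1]
  ring

end Homogeneity

section Coordinates

variable {r : ℕ} {k : Type u} [Field k]

/-- The linear form with coefficients `c`. -/
noncomputable def linearForm (c : Fin (r + 1) → k) : MvPolynomial (Fin (r + 1)) k :=
  ∑ m, c m • MvPolynomial.X m

theorem linearForm_mem (c : Fin (r + 1) → k) : linearForm c ∈ forms r k 1 :=
  sum_mem fun m _ => Submodule.smul_mem _ _ (X_mem_forms r k m)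

variable {A : Type u} [CommRing A] [Algebra k A]

theorem aeval_linearForm (ρ : Fin (r + 1) → A) (c : Fin (r + 1) → k) :
    MvPolynomial.aeval ρ (linearForm c) = ∑ m, c m • ρ m := by
  simp [linearForm]

theorem isUnit_aeval_linearForm {ρ : Fin (r + 1) → A} {c : Fin (r + 1) → k}
    (h : ∑ m, c m • ρ m = 1) :
    IsUnit ((MvPolynomial.aeval ρ : _ →ₐ[k] A).toRingHom (linearForm c)) := by
  change IsUnit (MvPolynomial.aeval ρ (linearForm c))
  rw [aeval_linearForm, h]
  exact isUnit_one

/-- The `A`-valued point of `P^r_k` with homogeneous coordinates `ρ`, normalized by a linear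
form with value `1`. -/
noncomputable def coordPoint (ρ : Fin (r + 1) → A) (c : Fin (r + 1) → k)
    (h : ∑ m, c m • ρ m = 1) : Spec (.of A) ⟶ PSpace r k :=
  chartPoint (forms r k) (MvPolynomial.aeval ρ : _ →ₐ[k] A).toRingHom (linearForm_mem c)
    one_pos (isUnit_aeval_linearForm h)

theorem chartPoint_congr {R C σ : Type u} [CommRing R] [SetLike σ R] [AddSubgroupClass σ R]
    [CommRing C] {𝒜 : ℕ → σ} [GradedRing 𝒜] {f f' : R →+* C} {s s' : R} {i : ℕ} {hs : s ∈ 𝒜 i}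
    {hs' : s' ∈ 𝒜 i} {hi : 0 < i} {h : IsUnit (f s)} {h' : IsUnit (f' s')} (hf : f = f')
    (hss : s = s') : chartPoint 𝒜 f hs hi h = chartPoint 𝒜 f' hs' hi h' := by
  subst hf hss
  rfl

theorem coordPoint_toSpec {ρ : Fin (r + 1) → A} {c : Fin (r + 1) → k}
    (h : ∑ m, c m • ρ m = 1) :
    coordPoint ρ c h ≫ PSpace.toSpec r k = Spec.map (CommRingCat.ofHom (algebraMap k A)) := by
  rw [coordPoint, PSpace.toSpec, ← Category.assoc, chartPoint_toSpecZero, ← Spec.map_comp,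
    ← CommRingCat.ofHom_comp]
  congr 2
  ext x
  exact (MvPolynomial.aeval ρ : _ →ₐ[k] A).commutes x

theorem specMap_coordPoint {B : Type u} [CommRing B] [Algebra k B] (g : A →ₐ[k] B)
    {ρ : Fin (r + 1) → A} {c : Fin (r + 1) → k} (h : ∑ m, c m • ρ m = 1)
    (h' : ∑ m, c m • g (ρ m) = 1) :
    Spec.map (CommRingCat.ofHom g.toRingHom) ≫ coordPoint ρ c h =
      coordPoint (fun m => g (ρ m)) c h' := by
  rw [coordPoint, specMap_chartPoint, coordPoint]
  refine chartPoint_congr ?_ rfl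
  exact congrArg AlgHom.toRingHom (MvPolynomial.comp_aeval ρ g)

theorem coordPoint_baseChange (K : Type u) [Field K] [Algebra k K] [Algebra K A]
    [IsScalarTower k K A] {ρ : Fin (r + 1) → A} {c : Fin (r + 1) → k}
    (h : ∑ m, c m • ρ m = 1) (h' : ∑ m, algebraMap k K (c m) • ρ m = 1) :
    coordPoint ρ (fun m => algebraMap k K (c m)) h' ≫ PSpace.baseChange r k K =
      coordPoint ρ c h := by
  have hL : extendScalars r k K (linearForm c) = linearForm fun m => algebraMap k K (c m) := by
    change MvPolynomial.map (algebraMap k K) (linearForm c) = _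
    simp only [linearForm, map_sum, MvPolynomial.smul_eq_C_mul, map_mul, MvPolynomial.map_C,
      MvPolynomial.map_X]
  have hu : IsUnit ((MvPolynomial.aeval ρ : _ →ₐ[K] A).toRingHom
      (extendScalars r k K (linearForm c))) := by
    rw [hL]
    exact isUnit_aeval_linearForm h'
  have h1 := chartPoint_map (extendScalars r k K) (irrelevant_le_extendScalars r k K)
    (MvPolynomial.aeval ρ : _ →ₐ[K] A).toRingHom (linearForm_mem c) one_pos hu
  have h2 : coordPoint ρ (fun m => algebraMap k K (c m)) h' =
      chartPoint (forms r K) (MvPolynomial.aeval ρ : _ →ₐ[K] A).toRingHom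
        ((extendScalars r k K).map_mem (linearForm_mem c)) one_pos hu :=
    chartPoint_congr rfl hL.symm
  rw [h2]
  refine h1.trans (chartPoint_congr ?_ rfl)
  refine MvPolynomial.ringHom_ext (fun x => ?_) fun m => ?_
  · change MvPolynomial.aeval ρ (MvPolynomial.map (algebraMap k K) (MvPolynomial.C x)) =
      MvPolynomial.aeval ρ (MvPolynomial.C x)
    rw [MvPolynomial.map_C, MvPolynomial.aeval_C, MvPolynomial.aeval_C,
      ← IsScalarTower.algebraMap_apply]
  · change MvPolynomial.aeval ρ (MvPolynomial.map (algebraMap k K) (MvPolynomial.X m)) =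
      MvPolynomial.aeval ρ (MvPolynomial.X m)
    rw [MvPolynomial.map_X, MvPolynomial.aeval_X, MvPolynomial.aeval_X]

theorem vanishes_coordPoint {ρ : Fin (r + 1) → A} {c : Fin (r + 1) → k}
    (h : ∑ m, c m • ρ m = 1) {d : ℕ} (p : forms r k d) (hp : MvPolynomial.aeval ρ p.1 = 0) :
    Vanishes (coordPoint ρ c h) p := by
  intro j
  have hz' : ⊤ ≤ Proj.awayι (forms r k) (linearForm c) (linearForm_mem c) one_pos ⁻¹ᵁ
      Proj.basicOpen (forms r k) (linearForm c) := by
    rw [← Proj.opensRange_awayι (forms r k) (linearForm c) (linearForm_mem c) one_pos]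
    simp
  have hz : ⊤ ≤ coordPoint ρ c h ⁻¹ᵁ Proj.basicOpen (forms r k) (linearForm c) :=
    fun y _ => hz' trivial
  refine app_awayToSection_eq_zero (coordPoint ρ c h) (linearForm_mem c) (X_mem_forms r k j)
    (form_mem_forms_smul p) hz ?_
  set q := Away.mk (forms r k) (linearForm_mem c) d p.1 (form_mem_forms_smul p) with hq
  have h1 := Scheme.Hom.appLE_comp_appLE (Spec.map (CommRingCat.ofHom
      (evalAway (forms r k) (MvPolynomial.aeval ρ : _ →ₐ[k] A).toRingHom (linearForm c)
        (isUnit_aeval_linearForm h))))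
    (Proj.awayι (forms r k) (linearForm c) (linearForm_mem c) one_pos)
    (Proj.basicOpen (forms r k) (linearForm c)) ⊤ ⊤ hz' le_top
  have h2 := congr($h1 (Proj.awayToSection (forms r k) (linearForm c) q))
  refine h2.symm.trans ?_
  have h3 := congr($(awayι_appLE_awayToSection (linearForm_mem c) one_pos hz') q)
  rw [CommRingCat.comp_apply] at h3 ⊢
  rw [h3]
  have h6 : (Spec.map (CommRingCat.ofHom (evalAway (forms r k)
      (MvPolynomial.aeval ρ : _ →ₐ[k] A).toRingHom (linearForm c)
        (isUnit_aeval_linearForm h)))).appLE ⊤ ⊤ le_top = (Spec.map _).appTop :=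
    (Scheme.Hom.app_eq_appLE _).symm
  refine congr($h6 _).trans ?_
  have h4 := congr($(Scheme.ΓSpecIso_inv_naturality (CommRingCat.ofHom
      (evalAway (forms r k) (MvPolynomial.aeval ρ : _ →ₐ[k] A).toRingHom (linearForm c)
        (isUnit_aeval_linearForm h)))) q)
  rw [CommRingCat.comp_apply, CommRingCat.comp_apply] at h4
  refine h4.symm.trans ?_
  have h5 : evalAway (forms r k) (MvPolynomial.aeval ρ : _ →ₐ[k] A).toRingHom (linearForm c)
      (isUnit_aeval_linearForm h) q = 0 :=
    (evalAway_mk _ ((aeval_linearForm ρ c).trans h) _ d p.1 (form_mem_forms_smul p)).trans hp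
  exact (congrArg _ h5).trans (map_zero _)

/-- A fraction `p / L ^ d` is the value of `p` at the fractions `x_m / L`. -/
theorem awayMk_eq_eval₂ (c : Fin (r + 1) → k) (d : ℕ) (p : MvPolynomial (Fin (r + 1)) k)
    (hp : p ∈ forms r k (d • 1)) :
    Away.mk (forms r k) (linearForm_mem c) d p hp =
      p.eval₂ ((fromZeroRingHom (forms r k) (.powers (linearForm c))).comp
        (algebraMap k (forms r k 0)))
        (fun m => Away.mk (forms r k) (linearForm_mem c) 1 (MvPolynomial.X m)
          (by simpa using X_mem_forms r k m)) := by
  apply HomogeneousLocalization.val_injective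
  rw [← HomogeneousLocalization.algebraMap_apply, ← HomogeneousLocalization.algebraMap_apply,
    MvPolynomial.hom_eval₂]
  set Λ := Localization.Away (linearForm c)
  set δ : Λ := Localization.mk 1 ⟨linearForm c, 1, pow_one _⟩ with hδ
  have h1 : (fun m => δ * algebraMap (MvPolynomial (Fin (r + 1)) k) Λ (MvPolynomial.X m)) =
      (algebraMap (Away (forms r k) (linearForm c)) Λ) ∘ (fun m => Away.mk (forms r k)
        (linearForm_mem c) 1 (MvPolynomial.X m) (by simpa using X_mem_forms r k m)) := by
    funext m
    rw [Function.comp_apply, HomogeneousLocalization.algebraMap_apply, Away.val_mk, hδ,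
      ← Localization.mk_one_eq_algebraMap, Localization.mk_mul, Localization.mk_eq_mk_iff,
      Localization.r_iff_exists]
    exact ⟨1, by simp⟩
  have h2 : ((algebraMap (Away (forms r k) (linearForm c)) Λ).comp
      ((fromZeroRingHom (forms r k) (.powers (linearForm c))).comp
        (algebraMap k (forms r k 0)))) =
      (algebraMap (MvPolynomial (Fin (r + 1)) k) Λ).comp MvPolynomial.C := by
    ext x
    simp only [RingHom.comp_apply]
    rw [← Localization.mk_one_eq_algebraMap]
    rfl
  have hp' : p.IsHomogeneous d := by simpa using hp
  rw [h2]
  refine Eq.trans ?_ (congrArg (fun g => p.eval₂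
    ((algebraMap (MvPolynomial (Fin (r + 1)) k) Λ).comp MvPolynomial.C) g) h1)
  have h3 : p.eval₂ ((algebraMap (MvPolynomial (Fin (r + 1)) k) Λ).comp MvPolynomial.C)
      (fun m => algebraMap (MvPolynomial (Fin (r + 1)) k) Λ (MvPolynomial.X m)) =
      algebraMap (MvPolynomial (Fin (r + 1)) k) Λ p :=
    (MvPolynomial.hom_eval₂ p MvPolynomial.C (algebraMap _ Λ) MvPolynomial.X).symm.trans
      (congrArg _ (MvPolynomial.eval₂_eta p))
  rw [eval₂_mul_of_isHomogeneous hp', h3, HomogeneousLocalization.algebraMap_apply,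
    Away.val_mk, hδ, Localization.mk_pow, ← Localization.mk_one_eq_algebraMap,
    Localization.mk_mul, Localization.mk_eq_mk_iff, Localization.r_iff_exists]
  exact ⟨1, by simp⟩

theorem irrelevant_forms_le_span_X (r : ℕ) (k : Type u) [Field k] :
    (HomogeneousIdeal.irrelevant (forms r k)).toIdeal ≤ Ideal.span (Set.range MvPolynomial.X) := by
  refine (HomogeneousIdeal.toIdeal_irrelevant_le _).mpr ?_
  intro d hd p hp
  have hp' : MvPolynomial.IsHomogeneous p d := hp
  change p ∈ Ideal.span _
  rw [p.as_sum]
  refine Ideal.sum_mem _ fun m hm => ?_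
  have hm0 : m ≠ 0 := by
    rintro rfl
    have h := hp' (MvPolynomial.mem_support_iff.mp hm)
    rw [map_zero] at h
    omega
  obtain ⟨j, hj⟩ := Finsupp.ne_iff.mp hm0
  exact Ideal.mem_of_dvd _ (MvPolynomial.X_dvd_monomial.mpr (Or.inr hj))
    (Ideal.subset_span ⟨j, rfl⟩)

theorem iSup_basicOpen_X (r : ℕ) (k : Type u) [Field k] :
    ⨆ m, Proj.basicOpen (forms r k) (MvPolynomial.X m) = ⊤ :=
  Proj.iSup_basicOpen_eq_top _ _ (irrelevant_forms_le_span_X r k)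

variable [FiniteDimensional k A]

/-- A finite scheme over an infinite field avoids some hyperplane. -/
theorem exists_linearForm_ne_zero [Infinite k] (i : Spec (.of A) ⟶ PSpace r k) :
    ∃ c, Set.range i ⊆ Proj.basicOpen (forms r k) (linearForm c) := by
  have : IsArtinianRing A := IsArtinianRing.of_finite k A
  have : Finite (Spec (.of A)) := inferInstanceAs (Finite (PrimeSpectrum A))
  by_contra! hno
  let T (y : Spec (.of A)) : Submodule k (Fin (r + 1) → k) :=
    ((i y).asHomogeneousIdeal.toIdeal.restrictScalars k).comap
      (Fintype.linearCombination k (MvPolynomial.X : Fin (r + 1) → MvPolynomial _ k))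
  have hT (y) (c) : c ∈ T y ↔ linearForm c ∈ (i y).asHomogeneousIdeal := by
    simp [T, Fintype.linearCombination_apply, linearForm, HomogeneousIdeal.mem_iff]
  obtain ⟨y, hy⟩ := Subspace.exists_eq_top_of_iUnion_eq_univ (p := T) (by
    rw [Set.eq_univ_iff_forall]
    intro c
    obtain ⟨_, ⟨y, rfl⟩, hy⟩ := Set.not_subset.mp (hno c)
    refine Set.mem_iUnion.mpr ⟨y, (hT y c).mpr ?_⟩
    simpa using hy)
  have hm := (iSup_basicOpen_X r k).ge (Set.mem_univ (i y))
  obtain ⟨m, hm⟩ := TopologicalSpace.Opens.mem_iSup.mp hm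
  have h1 := (hT y (Pi.single m 1)).mp (hy ▸ Submodule.mem_top)
  have h2 : linearForm (Pi.single m 1) = (MvPolynomial.X m : MvPolynomial (Fin (r + 1)) k) := by
    simp [linearForm, Pi.single_apply]
  rw [h2] at h1
  exact hm h1

/-- Every morphism from a finite scheme to projective space over an infinite field is given by
homogeneous coordinates. -/
theorem exists_eq_coordPoint [Infinite k] (i : Spec (.of A) ⟶ PSpace r k)
    (hi : i ≫ PSpace.toSpec r k = Spec.map (CommRingCat.ofHom (algebraMap k A))) :
    ∃ (ρ : Fin (r + 1) → A) (c : Fin (r + 1) → k) (h : ∑ m, c m • ρ m = 1),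
      i = coordPoint ρ c h := by
  obtain ⟨c, hc⟩ := exists_linearForm_ne_zero i
  let ι := Proj.awayι (forms r k) (linearForm c) (linearForm_mem c) one_pos
  have hrange : Set.range i ⊆ Set.range ι := by
    have h1 := Proj.opensRange_awayι (forms r k) (linearForm c) (linearForm_mem c) one_pos
    rwa [← Scheme.Hom.coe_opensRange ι, h1]
  let ψ := IsOpenImmersion.lift ι i hrange
  have hψ : ψ ≫ ι = i := IsOpenImmersion.lift_fac _ _ _
  let θ := (Spec.preimage ψ).hom
  have hθ : Spec.map (CommRingCat.ofHom θ) = ψ := Spec.map_preimage ψ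
  have hk : θ.comp ((fromZeroRingHom (forms r k) (.powers (linearForm c))).comp
      (algebraMap k (forms r k 0))) = algebraMap k A := by
    rw [← hψ, ← hθ, PSpace.toSpec, Category.assoc] at hi
    change _ ≫ Proj.awayι (forms r k) (linearForm c) (linearForm_mem c) one_pos ≫ _ ≫ _ = _ at hi
    rw [Proj.awayι_toSpecZero_assoc, ← Spec.map_comp, ← Spec.map_comp,
      ← CommRingCat.ofHom_comp, ← CommRingCat.ofHom_comp] at hi
    exact congrArg CommRingCat.Hom.hom (Spec.map_injective hi)
  let ρ : Fin (r + 1) → A := fun m => θ (Away.mk (forms r k) (linearForm_mem c) 1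
    (MvPolynomial.X m) (by simpa using X_mem_forms r k m))
  have hval : ∀ (d : ℕ) (p : MvPolynomial (Fin (r + 1)) k) (hp : p ∈ forms r k (d • 1)),
      θ (Away.mk (forms r k) (linearForm_mem c) d p hp) = MvPolynomial.aeval ρ p := by
    intro d p hp
    rw [awayMk_eq_eval₂, MvPolynomial.hom_eval₂, hk]
    rfl
  have h1 : MvPolynomial.aeval ρ (linearForm c) = 1 := by
    rw [← hval 1 (linearForm c) (by simpa using linearForm_mem c), ← map_one θ]
    congr 1
    apply HomogeneousLocalization.val_injective
    rw [Away.val_mk, HomogeneousLocalization.val_one, ← Localization.mk_one,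
      Localization.mk_eq_mk_iff, Localization.r_iff_exists]
    exact ⟨1, by simp⟩
  have h : ∑ m, c m • ρ m = 1 := (aeval_linearForm ρ c).symm.trans h1
  refine ⟨ρ, c, h, ?_⟩
  rw [← hψ, ← hθ, coordPoint, chartPoint]
  congr 3
  refine ext_evalAway (isUnit_aeval_linearForm h) (linearForm_mem c) fun d p hp => ?_
  rw [hval]
  change _ * (MvPolynomial.aeval ρ (linearForm c)) ^ d = _
  rw [h1, one_pow, mul_one]
  rfl

omit [FiniteDimensional k A] in
theorem surjective_evalAway_iff {ρ : Fin (r + 1) → A} {c : Fin (r + 1) → k}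
    (h : ∑ m, c m • ρ m = 1) :
    Function.Surjective (evalAway (forms r k) (MvPolynomial.aeval ρ : _ →ₐ[k] A).toRingHom
      (linearForm c) (isUnit_aeval_linearForm h)) ↔
    Function.Surjective (MvPolynomial.aeval ρ : MvPolynomial (Fin (r + 1)) k →ₐ[k] A) := by
  have h1 : (MvPolynomial.aeval ρ : _ →ₐ[k] A).toRingHom (linearForm c) = 1 :=
    (aeval_linearForm ρ c).trans h
  constructor <;> intro hsurj a
  · obtain ⟨q, rfl⟩ := hsurj a
    obtain ⟨d, p, hp, rfl⟩ := Away.mk_surjective (forms r k) (linearForm_mem c) q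
    exact ⟨p, (evalAway_mk _ h1 (linearForm_mem c) d p hp).symm⟩
  · obtain ⟨p, rfl⟩ := hsurj a
    refine ⟨p.eval₂ ((fromZeroRingHom (forms r k) (.powers (linearForm c))).comp
        (algebraMap k (forms r k 0)))
        (fun m => Away.mk (forms r k) (linearForm_mem c) 1 (MvPolynomial.X m)
          (by simpa using X_mem_forms r k m)), ?_⟩
    rw [MvPolynomial.hom_eval₂, ← RingHom.comp_assoc,
      evalAway_comp_fromZeroRingHom _ (linearForm_mem c), MvPolynomial.aeval_def]
    congr 1
    · ext x
      exact (MvPolynomial.aeval ρ : _ →ₐ[k] A).commutes x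
    · funext m
      refine (evalAway_mk _ h1 (linearForm_mem c) 1 (MvPolynomial.X m) _).trans ?_
      exact MvPolynomial.aeval_X ρ m

theorem surjective_of_isClosedImmersion_specMap {R S : CommRingCat.{u}} (f : R ⟶ S)
    [IsClosedImmersion (Spec.map f)] : Function.Surjective f := by
  intro a
  obtain ⟨y, hy⟩ := (IsClosedImmersion.isAffine_surjective_of_isAffine (Spec.map f)).2
    ((Scheme.ΓSpecIso S).inv a)
  refine ⟨(Scheme.ΓSpecIso R).hom y, ?_⟩
  have h1 := congr($(Scheme.ΓSpecIso_naturality f) y)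
  rw [CommRingCat.comp_apply, CommRingCat.comp_apply] at h1
  rw [← h1, hy, ← CommRingCat.comp_apply, Iso.inv_hom_id, CommRingCat.id_apply]

omit [FiniteDimensional k A] in
theorem surjective_aeval_of_isClosedImmersion {ρ : Fin (r + 1) → A} {c : Fin (r + 1) → k}
    (h : ∑ m, c m • ρ m = 1) [hcl : IsClosedImmersion (coordPoint ρ c h)] :
    Function.Surjective (MvPolynomial.aeval ρ : MvPolynomial (Fin (r + 1)) k →ₐ[k] A) := by
  rw [← surjective_evalAway_iff h]
  rw [coordPoint, chartPoint] at hcl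
  have h1 := IsClosedImmersion.of_comp (Spec.map (CommRingCat.ofHom (evalAway (forms r k)
    (MvPolynomial.aeval ρ : _ →ₐ[k] A).toRingHom (linearForm c) (isUnit_aeval_linearForm h))))
    (Proj.awayι (forms r k) (linearForm c) (linearForm_mem c) one_pos)
  exact @surjective_of_isClosedImmersion_specMap _ _ (CommRingCat.ofHom _) h1

theorem isClosedImmersion_coordPoint {ρ : Fin (r + 1) → A} {c : Fin (r + 1) → k}
    (h : ∑ m, c m • ρ m = 1)
    (hρ : Function.Surjective (MvPolynomial.aeval ρ : MvPolynomial (Fin (r + 1)) k →ₐ[k] A)) :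
    IsClosedImmersion (coordPoint ρ c h) := by
  have : IsFinite (coordPoint ρ c h ≫ PSpace.toSpec r k) := by
    rw [coordPoint_toSpec, IsFinite.SpecMap_iff]
    exact RingHom.finite_algebraMap.mpr inferInstance
  have : IsSeparated (PSpace.toSpec r k) := by
    rw [PSpace.toSpec]
    infer_instance
  have := IsFinite.of_comp (coordPoint ρ c h) (PSpace.toSpec r k)
  have h1 := IsClosedImmersion.spec_of_surjective (CommRingCat.ofHom (evalAway (forms r k)
    (MvPolynomial.aeval ρ : _ →ₐ[k] A).toRingHom (linearForm c) (isUnit_aeval_linearForm h)))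
    ((surjective_evalAway_iff h).mpr hρ)
  rw [IsClosedImmersion.iff_isFinite_and_mono]
  refine ⟨inferInstance, ?_⟩
  rw [coordPoint, chartPoint]
  exact @mono_comp _ _ _ _ _ _ inferInstance _ inferInstance

end Coordinates

open HomogeneousLocalization TensorProduct

/-! ### Finite subschemes of projective space and linear systems on Artinian rings -/

section Model

variable {r : ℕ} {k : Type u} [Field k]

theorem degree_specMap (C : Type u) [CommRing C] [Algebra k C] :
    degree (Spec.map (CommRingCat.ofHom (algebraMap k C))) = Module.finrank k C := by
  let f := Spec.map (CommRingCat.ofHom (algebraMap k C))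
  let _ : Algebra k Γ(Spec (.of C), ⊤) :=
    ((Scheme.ΓSpecIso (.of k)).inv ≫ f.appTop).hom.toAlgebra
  change Module.finrank k Γ(Spec (.of C), ⊤) = Module.finrank k C
  let j := (Scheme.ΓSpecIso (.of C)).commRingCatIsoToRingEquiv
  refine Algebra.finrank_eq_of_equiv_equiv (RingEquiv.refl k) j ?_
  ext x
  have h1 := congr($(Scheme.ΓSpecIso_inv_naturality (CommRingCat.ofHom (algebraMap k C))) x)
  change algebraMap k C x = (Scheme.ΓSpecIso (.of C)).hom
    (((Scheme.ΓSpecIso (.of k)).inv ≫ f.appTop) x)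
  have h2 := congrArg (Scheme.ΓSpecIso (.of C)).hom h1
  refine Eq.trans ?_ h2
  exact congr($((Scheme.ΓSpecIso (.of C)).inv_hom_id) (algebraMap k C x)).symm

/-- A finite subscheme of projective space over an infinite field is the spectrum of a
finite-dimensional algebra, with a coordinate vector normalized by a linear form that does not
vanish on it. -/
theorem exists_spec_model [Infinite k] {Y : Scheme.{u}} (i : Y ⟶ PSpace r k)
    [IsFinite (i ≫ PSpace.toSpec r k)] :
    ∃ (A : Type u) (_ : CommRing A) (_ : Algebra k A) (_ : FiniteDimensional k A)
      (e : Y ≅ Spec (.of A)) (ρ : Fin (r + 1) → A) (c : Fin (r + 1) → k)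
      (h : ∑ m, c m • ρ m = 1), e.inv ≫ i = coordPoint ρ c h ∧
      degree (i ≫ PSpace.toSpec r k) = Module.finrank k A := by
  set f := i ≫ PSpace.toSpec r k with hf
  have : IsAffine Y := isAffine_of_isAffineHom f
  let _ : Algebra k Γ(Y, ⊤) := ((Scheme.ΓSpecIso (.of k)).inv ≫ f.appTop).hom.toAlgebra
  have he : Y.isoSpec.inv ≫ f =
      Spec.map (CommRingCat.ofHom (algebraMap k Γ(Y, ⊤))) := by
    have h1 : Spec.map (CommRingCat.ofHom (algebraMap k Γ(Y, ⊤))) =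
      Spec.map ((Scheme.ΓSpecIso (.of k)).inv ≫ f.appTop) := rfl
    rw [h1, Spec.map_comp, ← Scheme.isoSpec_Spec_inv]
    exact (Scheme.isoSpec_inv_naturality f).symm
  have : FiniteDimensional k Γ(Y, ⊤) := by
    have : IsFinite (Y.isoSpec.inv ≫ f) := inferInstance
    rw [he, IsFinite.SpecMap_iff] at this
    exact RingHom.finite_algebraMap.mp this
  obtain ⟨ρ, c, h, h1⟩ := exists_eq_coordPoint (A := Γ(Y, ⊤)) (Y.isoSpec.inv ≫ i)
    (by rw [Category.assoc]; exact he)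
  exact ⟨Γ(Y, ⊤), inferInstance, inferInstance, inferInstance, Y.isoSpec, ρ, c, h, h1, rfl⟩

variable {A : Type u} [CommRing A] [Algebra k A] [FiniteDimensional k A]
variable {Y : Scheme.{u}} {i : Y ⟶ PSpace r k} {e : Y ≅ Spec (.of A)}
  {ρ : Fin (r + 1) → A} {c : Fin (r + 1) → k} {h : ∑ m, c m • ρ m = 1}

omit [FiniteDimensional k A] in
theorem surjective_aeval_of_model [IsClosedImmersion i] (he : e.inv ≫ i = coordPoint ρ c h) :
    Function.Surjective (MvPolynomial.aeval ρ : MvPolynomial (Fin (r + 1)) k →ₐ[k] A) := by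
  have : IsClosedImmersion (coordPoint ρ c h) := he ▸ inferInstance
  exact surjective_aeval_of_isClosedImmersion h

theorem isClosedImmersion_geometricFiberMap {Y : Scheme.{u}} (i : Y ⟶ PSpace r k)
    [IsClosedImmersion i] : IsClosedImmersion (geometricFiberMap i) :=
  IsClosedImmersion.isStableUnderBaseChange.of_isPullback (IsPullback.of_hasPullback i _)
    inferInstance

/-- A quotient of `K ⊗ A` defines a closed subscheme of the base change of `Spec A` to `K`. -/
theorem exists_isClosedImmersion_geometricFiber [IsClosedImmersion i]
    (he : e.inv ≫ i = coordPoint ρ c h) {C : Type u} [CommRing C] [Algebra k C]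
    [Algebra (AlgebraicClosure k) C] [IsScalarTower k (AlgebraicClosure k) C]
    (g : AlgebraicClosure k ⊗[k] A →ₐ[AlgebraicClosure k] C) (hg : Function.Surjective g) :
    ∃ (z : Spec (.of C) ⟶ geometricFiber i)
      (h' : ∑ m, algebraMap k (AlgebraicClosure k) (c m) • g (1 ⊗ₜ ρ m) = 1),
      IsClosedImmersion z ∧ z ≫ geometricFiberMap i =
        coordPoint (fun m => g (1 ⊗ₜ ρ m))
          (fun m => algebraMap k (AlgebraicClosure k) (c m)) h' := by
  set K := AlgebraicClosure k
  let g' : A →ₐ[k] C := (g.restrictScalars k).comp Algebra.TensorProduct.includeRight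
  have hk : ∑ m, c m • g' (ρ m) = 1 := by
    rw [← map_one g', ← h, map_sum]
    simp
  have hK : ∑ m, algebraMap k K (c m) • g' (ρ m) = 1 := by
    rw [← hk]
    simp
  have : FiniteDimensional K C := Module.Finite.of_surjective g.toLinearMap hg
  have hsurj : Function.Surjective
      (MvPolynomial.aeval (fun m => g' (ρ m)) : MvPolynomial (Fin (r + 1)) K →ₐ[K] C) := by
    rw [← AlgHom.range_eq_top, eq_top_iff]
    rintro y -
    obtain ⟨x, rfl⟩ := hg y
    induction x with
    | zero => rw [map_zero]; exact zero_mem _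
    | add x y hx hy => rw [map_add]; exact add_mem hx hy
    | tmul κ a =>
      have h1 : κ ⊗ₜ[k] a = κ • ((1 : K) ⊗ₜ[k] a) := by
        rw [TensorProduct.smul_tmul', smul_eq_mul, mul_one]
      rw [h1, map_smul]
      refine Subalgebra.smul_mem _ ?_ κ
      obtain ⟨p, rfl⟩ := surjective_aeval_of_model he a
      refine ⟨MvPolynomial.map (algebraMap k K) p, ?_⟩
      change MvPolynomial.aeval _ _ = g' _
      rw [MvPolynomial.aeval_map_algebraMap]
      exact congr($(MvPolynomial.comp_aeval ρ g') p).symm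
  have hcl := isClosedImmersion_coordPoint hK hsurj
  let zK := coordPoint (fun m => g' (ρ m)) (fun m => algebraMap k K (c m)) hK
  have hcomm : (Spec.map (CommRingCat.ofHom g'.toRingHom) ≫ e.inv) ≫ i =
      zK ≫ PSpace.baseChange r k K := by
    rw [Category.assoc, he, specMap_coordPoint g' h hk, coordPoint_baseChange K hk hK]
  let z : Spec (.of C) ⟶ geometricFiber i := Limits.pullback.lift _ _ hcomm
  have hz : z ≫ geometricFiberMap i = zK := Limits.pullback.lift_snd _ _ hcomm
  refine ⟨z, hK, ?_, hz⟩
  have : IsClosedImmersion (geometricFiberMap i) := by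
    exact isClosedImmersion_geometricFiberMap i
  have : IsClosedImmersion (z ≫ geometricFiberMap i) := hz ▸ hcl
  exact IsClosedImmersion.of_comp z (geometricFiberMap i)

/-- The linear forms with coefficients in `K` in terms of vectors in `K ⊗ k ^ (r + 1)`. -/
noncomputable def tensorForm (r : ℕ) (k K : Type u) [Field k] [Field K] [Algebra k K] :
    K ⊗[k] (Fin (r + 1) → k) →ₗ[K] forms r K 1 :=
  ((Fintype.linearCombination K
      (MvPolynomial.X : Fin (r + 1) → MvPolynomial (Fin (r + 1)) K)).codRestrict (forms r K 1)
    fun c => by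
      rw [Fintype.linearCombination_apply]
      exact linearForm_mem c).comp
    (TensorProduct.piScalarRight k K K (Fin (r + 1))).toLinearMap

theorem injective_tensorForm (r : ℕ) (k K : Type u) [Field k] [Field K] [Algebra k K] :
    Function.Injective (tensorForm r k K) := by
  intro x y hxy
  exact (TensorProduct.piScalarRight k K K (Fin (r + 1))).injective
    (LinearIndependent.fintypeLinearCombination_injective
      (MvPolynomial.linearIndependent_X (Fin (r + 1)) K) (congrArg Subtype.val hxy))

omit [FiniteDimensional k A] in
theorem aeval_tensorForm {K : Type u} [Field K] [Algebra k K] {C : Type u} [CommRing C]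
    [Algebra K C] (ρ : Fin (r + 1) → A) (g : K ⊗[k] A →ₐ[K] C)
    (w : K ⊗[k] (Fin (r + 1) → k)) :
    MvPolynomial.aeval (fun m => g (1 ⊗ₜ ρ m)) (tensorForm r k K w).1 =
      g ((Fintype.linearCombination k ρ).baseChange K w) := by
  induction w with
  | zero => simp
  | add x y hx hy => simp only [map_add, Submodule.coe_add, hx, hy]
  | tmul κ x =>
    have h1 : (tensorForm r k K (κ ⊗ₜ x)).1 = linearForm fun m => x m • κ := by
      change Fintype.linearCombination K _ (TensorProduct.piScalarRight k K K _ (κ ⊗ₜ x)) = _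
      rw [TensorProduct.piScalarRight_apply, TensorProduct.piScalarRightHom_tmul,
        Fintype.linearCombination_apply, linearForm]
    rw [h1, aeval_linearForm, LinearMap.baseChange_tmul, Fintype.linearCombination_apply,
      TensorProduct.tmul_sum, map_sum]
    refine Finset.sum_congr rfl fun m _ => ?_
    rw [← map_smul, TensorProduct.smul_tmul', smul_eq_mul, mul_one, TensorProduct.tmul_smul,
      TensorProduct.smul_tmul']

/-- Linearly general position of a finite subscheme says that the linear system of its
homogeneous coordinates is in general position: an ideal `J` cuts out a closed subscheme of
degree `dim A - dim J`. -/
theorem linearSystemInGeneralPosition_of_model [IsClosedImmersion i]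
    (he : e.inv ≫ i = coordPoint ρ c h)
    (hpos : InLinearlyGeneralPosition (geometricFiberMap i)) :
    LinearSystemInGeneralPosition (AlgebraicClosure k) (Fintype.linearCombination k ρ) := by
  intro J W hW hWJ
  have hE : Module.finrank (AlgebraicClosure k) (AlgebraicClosure k ⊗[k] (Fin (r + 1) → k)) =
      r + 1 := by
    rw [Module.finrank_baseChange, Module.finrank_fin_fun]
  have hA : Module.finrank (AlgebraicClosure k) (AlgebraicClosure k ⊗[k] A) =
      Module.finrank k A := Module.finrank_baseChange
  rw [Module.finrank_fin_fun]
  have hWle := Submodule.finrank_le W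
  by_cases hJ : J = ⊤
  · rw [hJ, idim_top]
    omega
  have hWlt : Module.finrank (AlgebraicClosure k) W < r + 1 := by
    refine lt_of_le_of_ne (by omega) fun heq => hJ ?_
    have hWtop : W = ⊤ := Submodule.eq_top_of_finrank_eq (by omega)
    rw [Ideal.eq_top_iff_one]
    refine hWJ ⟨1 ⊗ₜ c, hWtop ▸ Submodule.mem_top, ?_⟩
    rw [LinearMap.baseChange_tmul, Fintype.linearCombination_apply, h]
    rfl
  have hWpos : 0 < Module.finrank (AlgebraicClosure k) W :=
    Nat.pos_of_ne_zero fun h0 => hW (Submodule.finrank_eq_zero.mp h0)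
  obtain ⟨z, h', hz, hzi⟩ := exists_isClosedImmersion_geometricFiber he
    (Ideal.Quotient.mkₐ (AlgebraicClosure k) J)
    (Ideal.Quotient.mkₐ_surjective (AlgebraicClosure k) J)
  have hfin : Module.finrank (AlgebraicClosure k) (W.map (tensorForm r k (AlgebraicClosure k))) =
      Module.finrank (AlgebraicClosure k) W :=
    (W.equivMapOfInjective _ (injective_tensorForm r k (AlgebraicClosure k))).finrank_eq.symm
  have hmain := hpos (Spec (.of ((AlgebraicClosure k ⊗[k] A) ⧸ J))) z
    (r - Module.finrank (AlgebraicClosure k) W)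
    (W.map (tensorForm r k (AlgebraicClosure k))) (by omega) (by rw [hfin]; omega) (by
      rintro _ ⟨w, hw, rfl⟩
      rw [hzi]
      refine vanishes_coordPoint h' _ ?_
      rw [aeval_tensorForm ρ (Ideal.Quotient.mkₐ (AlgebraicClosure k) J)]
      exact Ideal.Quotient.eq_zero_iff_mem.mpr (hWJ ⟨w, hw, rfl⟩))
  rw [← Category.assoc, hzi, coordPoint_toSpec, degree_specMap] at hmain
  have hJfin := (J.restrictScalars (AlgebraicClosure k)).finrank_quotient_add_finrank
  have hJfin' : Module.finrank (AlgebraicClosure k) ((AlgebraicClosure k ⊗[k] A) ⧸ J) +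
      idim (AlgebraicClosure k) J = Module.finrank (AlgebraicClosure k) (AlgebraicClosure k ⊗[k] A) :=
    hJfin
  omega

/-- The local rings of a geometrically curvilinear subscheme have principal maximal ideals, which
is all that is used of curvilinearity. -/
theorem exists_le_span_sup_sq_of_model [IsClosedImmersion i]
    (he : e.inv ≫ i = coordPoint ρ c h) (hcurv : IsCurvilinear (geometricFiber i))
    (m : Ideal (AlgebraicClosure k ⊗[k] A)) [hm : m.IsMaximal] :
    ∃ π ∈ m, m ≤ Ideal.span {π} ⊔ m ^ 2 := by
  obtain ⟨z, -, hz, -⟩ := exists_isClosedImmersion_geometricFiber he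
    (AlgHom.id (AlgebraicClosure k) _) Function.surjective_id
  let x : Spec (.of (AlgebraicClosure k ⊗[k] A)) := ⟨m, hm.isPrime⟩
  obtain ⟨F, _, n, ⟨f⟩⟩ := hcurv (z x)
  have h1 := (z.stalkMap_surjective x)
  have hsurj : Function.Surjective (((Spec.stalkIso _ x).commRingCatIsoToRingEquiv.toRingHom).comp
      ((z.stalkMap x).hom.comp
        (f.symm.toRingHom.comp
          (Ideal.Quotient.mk (Ideal.span {(Polynomial.X : Polynomial F) ^ n}))))) :=
    (Spec.stalkIso _ x).commRingCatIsoToRingEquiv.surjective.comp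
      (h1.comp (f.symm.surjective.comp Ideal.Quotient.mk_surjective))
  have : IsPrincipalIdealRing (Localization.AtPrime m) :=
    IsPrincipalIdealRing.of_surjective _ hsurj
  exact exists_le_span_sup_sq m

omit [FiniteDimensional k A] in
theorem injective_localization_of_iso {Y : Scheme.{u}} (e : Y ≅ Spec (.of A))
    (hGor : IsGorenstein Y) (m : Ideal A) [hm : m.IsMaximal] :
    Module.Injective (Localization.AtPrime m) (Localization.AtPrime m) := by
  let x : Spec (.of A) := ⟨m, hm.isPrime⟩
  let f : Y.presheaf.stalk (e.inv x) ≃+* Localization.AtPrime m :=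
    (asIso (e.inv.stalkMap x) ≪≫ Spec.stalkIso _ x).commRingCatIsoToRingEquiv
  have := hGor (e.inv x)
  exact Module.Injective.of_ringEquiv f f.toSemilinearEquiv

end Model

/-! ### The homogeneous coordinate ring of a rational normal scroll -/

section SectionRing

variable {r : ℕ} {k : Type u} [Field k] {s : ℕ} {a : Fin s → ℕ}
  (ℓ : Module.Basis (Fin (r + 1)) k (scrollSections k a))

/-- The subring of `k[u, v, t_1, …, t_s]` generated by the sections of `O(1)`. -/
abbrev SectionRing : Type u :=
  (MvPolynomial.aeval (R := k) fun m => (ℓ m : MvPolynomial (Fin 2 ⊕ Fin s) k)).range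

/-- The substitution of a basis of the sections of `O(1)` for the variables. -/
noncomputable def evalSections : MvPolynomial (Fin (r + 1)) k →ₐ[k] SectionRing ℓ :=
  AlgHom.rangeRestrict _

/-- The piece of degree `d` of the ring of sections consists of the values of the forms of
degree `d`. -/
noncomputable def sectionGrading (d : ℕ) : Submodule k (SectionRing ℓ) :=
  (forms r k d).map (evalSections ℓ).toLinearMap

/-- The weights of `u, v, t_1, …, t_s` that measure the degree in `t_1, …, t_s`. -/
def fiberWeight (s : ℕ) : Fin 2 ⊕ Fin s → ℕ := Sum.elim 0 1

theorem isWeightedHomogeneous_of_mem_scrollSections {x : MvPolynomial (Fin 2 ⊕ Fin s) k}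
    (hx : x ∈ scrollSections k a) : x.IsWeightedHomogeneous (fiberWeight s) 1 := by
  rw [← MvPolynomial.mem_weightedHomogeneousSubmodule k]
  refine (Submodule.span_le.mpr ?_ : scrollSections k a ≤ _) hx
  rintro _ ⟨i, b, c, -, rfl⟩
  have h := ((MvPolynomial.isWeightedHomogeneous_X k (fiberWeight s) (.inr i)).mul
    ((MvPolynomial.isWeightedHomogeneous_X k (fiberWeight s) (.inl 0)).pow b)).mul
    ((MvPolynomial.isWeightedHomogeneous_X k (fiberWeight s) (.inl 1)).pow c)
  simpa [fiberWeight] using h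

theorem isWeightedHomogeneous_of_mem_sectionGrading {d : ℕ} {x : SectionRing ℓ}
    (hx : x ∈ sectionGrading ℓ d) : x.1.IsWeightedHomogeneous (fiberWeight s) d := by
  obtain ⟨p, hp, rfl⟩ := hx
  change MvPolynomial.IsWeightedHomogeneous _ (MvPolynomial.aeval _ p) _
  rw [MvPolynomial.aeval_def, MvPolynomial.eval₂_eq]
  refine MvPolynomial.IsWeightedHomogeneous.sum _ _ _ fun e he => ?_
  have h1 : ∑ i ∈ e.support, e i = d := by
    rw [← (show p.IsHomogeneous d from hp) (MvPolynomial.mem_support_iff.mp he),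
      Finsupp.weight_apply, Finsupp.sum]
    simp
  have h2 := (MvPolynomial.isWeightedHomogeneous_C (fiberWeight s) (p.coeff e)).mul
    (MvPolynomial.IsWeightedHomogeneous.prod e.support
      (fun i => (ℓ i : MvPolynomial (Fin 2 ⊕ Fin s) k) ^ e i) (fun i => e i • 1)
      (fun i _ => (isWeightedHomogeneous_of_mem_scrollSections (ℓ i).2).pow (e i)))
  simpa [h1] using h2

instance : SetLike.GradedMonoid (sectionGrading ℓ) where
  one_mem := ⟨1, SetLike.GradedOne.one_mem, map_one (evalSections ℓ)⟩
  mul_mem := by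
    rintro d e _ _ ⟨p, hp, rfl⟩ ⟨q, hq, rfl⟩
    exact ⟨p * q, SetLike.GradedMul.mul_mem hp hq, map_mul (evalSections ℓ) p q⟩

theorem isInternal_sectionGrading : DirectSum.IsInternal (sectionGrading ℓ) := by
  refine DirectSum.isInternal_submodule_of_iSupIndep_of_iSup_eq_top (fun d => ?_) ?_
  · rw [Submodule.disjoint_def]
    intro x hx hx'
    have h1 : ⨆ e, ⨆ (_ : e ≠ d), sectionGrading ℓ e ≤ LinearMap.ker
        ((MvPolynomial.weightedHomogeneousComponent (fiberWeight s) d).comp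
          (Subalgebra.val (MvPolynomial.aeval (R := k)
            fun m => (ℓ m : MvPolynomial (Fin 2 ⊕ Fin s) k)).range).toLinearMap) := by
      refine iSup₂_le fun e he y hy => ?_
      exact (isWeightedHomogeneous_of_mem_sectionGrading ℓ hy).weightedHomogeneousComponent_ne d
        he.symm
    have h2 : MvPolynomial.weightedHomogeneousComponent (fiberWeight s) d x.1 = 0 := h1 hx'
    rw [MvPolynomial.weightedHomogeneousComponent_eq_self
      (isWeightedHomogeneous_of_mem_sectionGrading ℓ hx)] at h2
    exact Subtype.ext h2
  · have h1 : ⨆ d, forms r k d = ⊤ :=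
      (DirectSum.Decomposition.isInternal (forms r k)).submodule_iSup_eq_top
    have h2 := Submodule.map_iSup (evalSections ℓ).toLinearMap (forms r k)
    rw [h1, Submodule.map_top] at h2
    refine h2.symm.trans ?_
    rw [LinearMap.range_eq_top]
    exact AlgHom.rangeRestrict_surjective _

noncomputable instance : DirectSum.Decomposition (sectionGrading ℓ) :=
  (isInternal_sectionGrading ℓ).chooseDecomposition

noncomputable instance : GradedRing (sectionGrading ℓ) where

/-- The substitution of sections for variables as a homomorphism of graded rings. -/
noncomputable def gradedEvalSections : forms r k →+*ᵍ sectionGrading ℓ where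
  toRingHom := (evalSections ℓ).toRingHom
  map_mem hp := Submodule.mem_map_of_mem hp

theorem irrelevant_le_gradedEvalSections : HomogeneousIdeal.irrelevant (sectionGrading ℓ) ≤
    (HomogeneousIdeal.irrelevant (forms r k)).map (gradedEvalSections ℓ) := by
  rw [HomogeneousIdeal.irrelevant_le]
  rintro d hd _ ⟨p, hp, rfl⟩
  change gradedEvalSections ℓ p ∈
    Ideal.map (gradedEvalSections ℓ) (HomogeneousIdeal.irrelevant (forms r k)).toIdeal
  exact Ideal.mem_map_of_mem _ (HomogeneousIdeal.mem_irrelevant_of_mem _ hd hp)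

/-- The embedding of the scroll in projective space by the sections `ℓ_0, …, ℓ_r`. -/
noncomputable def scrollEmbedding : Proj (sectionGrading ℓ) ⟶ PSpace r k :=
  Proj.map (gradedEvalSections ℓ) (irrelevant_le_gradedEvalSections ℓ)

instance : IsClosedImmersion (scrollEmbedding ℓ) :=
  isClosedImmersion_map _ _ fun _ _ ⟨p, hp, h⟩ => ⟨p, hp, h⟩

theorem injective_awayToSection {A σ : Type u} [CommRing A] [SetLike σ A] [AddSubgroupClass σ A]
    {𝒜 : ℕ → σ} [GradedRing 𝒜] {f : A} {m : ℕ} (hf : f ∈ 𝒜 m) (hm : 0 < m) :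
    Function.Injective (Proj.awayToSection 𝒜 f) := by
  exact (Proj.basicOpenIsoAway 𝒜 f hf hm).commRingCatIsoToRingEquiv.injective

theorem vanishes_scrollEmbedding_iff {d : ℕ} (p : forms r k d) :
    Vanishes (scrollEmbedding ℓ) p ↔
      MvPolynomial.aeval (fun m => (ℓ m : MvPolynomial (Fin 2 ⊕ Fin s) k)) p.1 = 0 := by
  have key (j : Fin (r + 1)) : (scrollEmbedding ℓ).app
      (Proj.basicOpen (forms r k) (MvPolynomial.X j))
      (Proj.awayToSection (forms r k) (MvPolynomial.X j) (dehomogenize p j)) =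
      Proj.awayToSection (sectionGrading ℓ) (gradedEvalSections ℓ (MvPolynomial.X j))
        (Away.map (gradedEvalSections ℓ) (MvPolynomial.X j) (dehomogenize p j)) := by
    have h1 := congr($(Proj.awayToSection_comp_appLE (gradedEvalSections ℓ)
      (irrelevant_le_gradedEvalSections ℓ) (X_mem_forms r k j)) (dehomogenize p j))
    rw [Scheme.Hom.app_eq_appLE]
    exact h1
  have hmap (j : Fin (r + 1)) := Away.map_mk (gradedEvalSections ℓ) (MvPolynomial.X j)
    (X_mem_forms r k j) d p.1 (form_mem_forms_smul p)
  constructor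
  · intro h
    have h1 := (key 0).symm.trans (h 0)
    have h2 := injective_awayToSection ((gradedEvalSections ℓ).map_mem (X_mem_forms r k 0)) one_pos
      (h1.trans (map_zero _).symm)
    have h3 := congrArg HomogeneousLocalization.val ((hmap 0).symm.trans h2)
    rw [Away.val_mk, HomogeneousLocalization.val_zero, ← Localization.mk_zero 1,
      Localization.mk_eq_mk_iff, Localization.r_iff_exists] at h3
    obtain ⟨⟨_, n, rfl⟩, hn⟩ := h3
    have h4 : gradedEvalSections ℓ (MvPolynomial.X 0) ≠ 0 := by
      intro h0
      have h5 : MvPolynomial.aeval (fun m => (ℓ m : MvPolynomial (Fin 2 ⊕ Fin s) k))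
        (MvPolynomial.X 0) = 0 := congrArg Subtype.val h0
      rw [MvPolynomial.aeval_X] at h5
      exact ℓ.ne_zero 0 (Subtype.ext h5)
    have h6 : gradedEvalSections ℓ p.1 = 0 := by
      simpa [h4] using hn
    exact congrArg Subtype.val h6
  · intro h j
    rw [key j]
    have h1 : gradedEvalSections ℓ p.1 = 0 := Subtype.ext h
    have h2 : Away.map (gradedEvalSections ℓ) (MvPolynomial.X j) (dehomogenize p j) = 0 := by
      refine (hmap j).trans ?_
      apply HomogeneousLocalization.val_injective
      rw [Away.val_mk, h1, HomogeneousLocalization.val_zero, Localization.mk_zero]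
    exact (congrArg _ h2).trans (map_zero _)

end SectionRing

/-! ### Points and charts of a rational normal scroll -/

section ScrollPoint

variable {r : ℕ} {k : Type u} [Field k] {s : ℕ} {a : Fin s → ℕ}
  (ℓ : Module.Basis (Fin (r + 1)) k (scrollSections k a))

theorem isRationalNormalScroll_scrollEmbedding (ha : ∃ i, 0 < a i) :
    IsRationalNormalScroll s (scrollEmbedding ℓ) :=
  ⟨inferInstance, a, ℓ, ha, fun _ p => vanishes_scrollEmbedding_iff ℓ p⟩

theorem coe_gradedEvalSections (p : MvPolynomial (Fin (r + 1)) k) :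
    (gradedEvalSections ℓ p).1 =
      MvPolynomial.aeval (fun m => (ℓ m : MvPolynomial (Fin 2 ⊕ Fin s) k)) p :=
  rfl

/-- A section of `O(1)` as an element of degree `1` of the ring of sections. -/
noncomputable def ofSection (x : scrollSections k a) : SectionRing ℓ :=
  gradedEvalSections ℓ (linearForm (ℓ.repr x))

theorem sum_repr_smul_coe (x : scrollSections k a) :
    ∑ m, ℓ.repr x m • (ℓ m : MvPolynomial (Fin 2 ⊕ Fin s) k) = x := by
  conv_rhs => rw [← ℓ.sum_repr x, Submodule.coe_sum]
  rfl

theorem coe_ofSection (x : scrollSections k a) : (ofSection ℓ x).1 = x := by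
  rw [ofSection, coe_gradedEvalSections, aeval_linearForm]
  exact sum_repr_smul_coe ℓ x

theorem ofSection_mem (x : scrollSections k a) : ofSection ℓ x ∈ sectionGrading ℓ 1 :=
  (gradedEvalSections ℓ).map_mem (linearForm_mem _)

variable {C : Type u} [CommRing C] [Algebra k C]

/-- The restriction to the ring of sections of a `k`-algebra homomorphism. -/
noncomputable abbrev restrictSections (Ψ : MvPolynomial (Fin 2 ⊕ Fin s) k →ₐ[k] C) :
    SectionRing ℓ →+* C :=
  (Ψ.comp (Subalgebra.val _)).toRingHom

theorem restrictSections_apply (Ψ : MvPolynomial (Fin 2 ⊕ Fin s) k →ₐ[k] C)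
    (y : SectionRing ℓ) : restrictSections ℓ Ψ y = Ψ y.1 :=
  rfl

theorem restrictSections_comp (Ψ : MvPolynomial (Fin 2 ⊕ Fin s) k →ₐ[k] C) :
    (restrictSections ℓ Ψ).comp (gradedEvalSections ℓ).toRingHom =
      (MvPolynomial.aeval fun m => Ψ (ℓ m) : _ →ₐ[k] C).toRingHom :=
  congrArg AlgHom.toRingHom (MvPolynomial.comp_aeval
    (fun m => (ℓ m : MvPolynomial (Fin 2 ⊕ Fin s) k)) Ψ)

/-- A point of projective space whose coordinates are values of the sections of `O(1)` at
some `u, v, t_1, …, t_s` lies on the scroll. -/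
theorem chartPoint_scrollEmbedding (Ψ : MvPolynomial (Fin 2 ⊕ Fin s) k →ₐ[k] C)
    (c : Fin (r + 1) → k) (h : ∑ m, c m • Ψ (ℓ m) = 1)
    (hu : IsUnit (restrictSections ℓ Ψ (gradedEvalSections ℓ (linearForm c)))) :
    chartPoint (sectionGrading ℓ) (restrictSections ℓ Ψ)
      ((gradedEvalSections ℓ).map_mem (linearForm_mem c)) one_pos hu ≫ scrollEmbedding ℓ =
      coordPoint (fun m => Ψ (ℓ m)) c h :=
  (chartPoint_map (gradedEvalSections ℓ) (irrelevant_le_gradedEvalSections ℓ)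
    (restrictSections ℓ Ψ) (linearForm_mem c) one_pos hu).trans
    (chartPoint_congr (restrictSections_comp ℓ Ψ) rfl)

theorem exists_comp_scrollEmbedding_eq (Ψ : MvPolynomial (Fin 2 ⊕ Fin s) k →ₐ[k] C)
    (c : Fin (r + 1) → k) (h : ∑ m, c m • Ψ (ℓ m) = 1) :
    ∃ g, g ≫ scrollEmbedding ℓ = coordPoint (fun m => Ψ (ℓ m)) c h := by
  have hu : IsUnit (restrictSections ℓ Ψ (gradedEvalSections ℓ (linearForm c))) := by
    have h1 := congr($(restrictSections_comp ℓ Ψ) (linearForm c))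
    have h2 := isUnit_aeval_linearForm h
    rwa [← h1] at h2
  exact ⟨_, chartPoint_scrollEmbedding ℓ Ψ c h hu⟩

theorem chartPoint_ofSection_toSpec (Ψ : MvPolynomial (Fin 2 ⊕ Fin s) k →ₐ[k] C)
    (x : scrollSections k a) (hx : Ψ x = 1) (hu : IsUnit (restrictSections ℓ Ψ (ofSection ℓ x))) :
    chartPoint (sectionGrading ℓ) (restrictSections ℓ Ψ) (ofSection_mem ℓ x) one_pos hu ≫
      scrollEmbedding ℓ ≫ PSpace.toSpec r k =
      Spec.map (CommRingCat.ofHom (algebraMap k C)) := by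
  have h : ∑ m, ℓ.repr x m • Ψ (ℓ m) = 1 := by
    rw [← hx, ← sum_repr_smul_coe ℓ x, map_sum]
    exact Finset.sum_congr rfl fun m _ => (map_smul Ψ _ _).symm
  have h2 := chartPoint_scrollEmbedding ℓ Ψ (ℓ.repr x) h hu
  rw [← coordPoint_toSpec h, ← h2, Category.assoc]
  rfl

theorem X_mul_pow_mul_pow_mem (i : Fin s) {ε ε' : Fin 2} (hε : ε ≠ ε') (b c : ℕ)
    (hbc : b + c = a i) :
    MvPolynomial.X (.inr i) * MvPolynomial.X (.inl ε) ^ b * MvPolynomial.X (.inl ε') ^ c ∈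
      scrollSections k a := by
  have h : ε = 0 ∧ ε' = 1 ∨ ε = 1 ∧ ε' = 0 := by omega
  obtain ⟨rfl, rfl⟩ | ⟨rfl, rfl⟩ := h
  · exact Submodule.subset_span ⟨i, b, c, hbc, rfl⟩
  · exact Submodule.subset_span ⟨i, c, b, by omega, by ring⟩

/-- The section `t_j u ^ a_j` or `t_j v ^ a_j`. -/
noncomputable def cornerSection (k : Type u) [Field k] {s : ℕ} (a : Fin s → ℕ) (j : Fin s)
    (ε : Fin 2) : scrollSections k a :=
  ⟨MvPolynomial.X (.inr j) * MvPolynomial.X (.inl ε) ^ a j, by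
    have h := X_mul_pow_mul_pow_mem (k := k) j (show ε ≠ ε + 1 by omega) (a j) 0 rfl
    rwa [pow_zero, mul_one] at h⟩

/-- If all `a_j` are positive then the scroll is covered by the open sets `t_j u ^ a_j ≠ 0` and
`t_j v ^ a_j ≠ 0`. -/
theorem iSup_basicOpen_cornerSection (ha : ∀ j, 1 ≤ a j) :
    ⨆ q : Fin s × Fin 2, Proj.basicOpen (sectionGrading ℓ)
      (ofSection ℓ (cornerSection k a q.1 q.2)) = ⊤ := by
  refine top_le_iff.mp fun x _ => TopologicalSpace.Opens.mem_iSup.mpr ?_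
  by_contra! H
  have H' (j : Fin s) (ε : Fin 2) :
      ofSection ℓ (cornerSection k a j ε) ∈ x.asHomogeneousIdeal := by
    have h1 := H (j, ε)
    rwa [Proj.mem_basicOpen, not_not] at h1
  -- The monomial `t_i u ^ b v ^ c` has the power `(t_i u ^ a_i) ^ b (t_i v ^ a_i) ^ c`.
  have hmono (y : scrollSections k a) : ofSection ℓ y ∈ x.asHomogeneousIdeal := by
    obtain ⟨y, hy⟩ := y
    induction hy using Submodule.span_induction with
    | mem y hy =>
      obtain ⟨i, b, c, hbc, rfl⟩ := hy
      have h1 : ofSection ℓ ⟨_, Submodule.subset_span ⟨i, b, c, hbc, rfl⟩⟩ ^ a i =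
          ofSection ℓ (cornerSection k a i 0) ^ b * ofSection ℓ (cornerSection k a i 1) ^ c := by
        apply Subtype.ext
        simp only [SubmonoidClass.coe_pow, MulMemClass.coe_mul, coe_ofSection, cornerSection]
        rw [← hbc]
        ring
      refine x.isPrime.mem_of_pow_mem (a i) ?_
      rw [h1]
      have h2 := ha i
      by_cases hb : b = 0
      · exact Ideal.mul_mem_left _ _ (Ideal.pow_mem_of_mem _ (H' i 1) c (by omega))
      · exact Ideal.mul_mem_right _ _ (Ideal.pow_mem_of_mem _ (H' i 0) b (by omega))
    | zero =>
      have h1 : ofSection ℓ ⟨0, zero_mem _⟩ = 0 := Subtype.ext (coe_ofSection ℓ _)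
      exact h1 ▸ zero_mem x.asHomogeneousIdeal.toIdeal
    | add y z hy hz ihy ihz =>
      have h1 : ofSection ℓ ⟨y + z, add_mem hy hz⟩ = ofSection ℓ ⟨y, hy⟩ + ofSection ℓ ⟨z, hz⟩ := by
        apply Subtype.ext
        simp only [AddMemClass.coe_add, coe_ofSection]
      exact h1 ▸ add_mem (S := Ideal _) ihy ihz
    | smul t y hy ih =>
      have h1 : ofSection ℓ ⟨t • y, Submodule.smul_mem _ t hy⟩ = t • ofSection ℓ ⟨y, hy⟩ := by
        apply Subtype.ext
        rw [coe_ofSection]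
        exact congrArg (t • ·) (coe_ofSection ℓ ⟨y, hy⟩).symm
      rw [h1, Algebra.smul_def]
      exact Ideal.mul_mem_left _ _ ih
  have hgen (m : Fin (r + 1)) : gradedEvalSections ℓ (MvPolynomial.X m) ∈
      x.asHomogeneousIdeal := by
    have h1 : gradedEvalSections ℓ (MvPolynomial.X m) = ofSection ℓ (ℓ m) := by
      apply Subtype.ext
      rw [coe_gradedEvalSections, coe_ofSection, MvPolynomial.aeval_X]
    rw [h1]
    exact hmono _
  refine x.not_irrelevant_le ?_
  refine (irrelevant_le_gradedEvalSections ℓ).trans ?_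
  change Ideal.map (gradedEvalSections ℓ) (HomogeneousIdeal.irrelevant (forms r k)).toIdeal ≤
    x.asHomogeneousIdeal.toIdeal
  rw [Ideal.map_le_iff_le_comap]
  refine (irrelevant_forms_le_span_X r k).trans (Ideal.span_le.mpr ?_)
  rintro _ ⟨m, rfl⟩
  exact hgen m

/-- The coordinates of the chart `t_j u_ε ^ a_j ≠ 0` of the scroll: the `j`-th one is the
quotient of the coordinates of the projective line, the `i`-th one is the quotient of
`t_i u_ε ^ a_i` by `t_j u_ε ^ a_j`. -/
noncomputable def cornerChart (k : Type u) [Field k] {s : ℕ} (j : Fin s) (ε : Fin 2) :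
    MvPolynomial (Fin 2 ⊕ Fin s) k →ₐ[k] MvPolynomial (Fin s) k :=
  MvPolynomial.aeval (Sum.elim (fun δ => if δ = ε then 1 else MvPolynomial.X j)
    (fun i => if i = j then 1 else MvPolynomial.X i))

theorem cornerChart_cornerSection (j : Fin s) (ε : Fin 2) :
    cornerChart k j ε (cornerSection k a j ε) = 1 := by
  simp [cornerChart, cornerSection]

section Fractions

variable {Q : Type u} [Field Q] [Algebra k Q] (ι : MvPolynomial (Fin 2 ⊕ Fin s) k →ₐ[k] Q)

/-- The fractions in `u, v, t_1, …, t_s` that the coordinates of the chart stand for. -/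
noncomputable def cornerFraction (a : Fin s → ℕ) (j : Fin s) (ε : Fin 2) :
    MvPolynomial (Fin s) k →ₐ[k] Q :=
  MvPolynomial.aeval fun i =>
    if i = j then ι (MvPolynomial.X (.inl (ε + 1))) / ι (MvPolynomial.X (.inl ε))
    else ι (MvPolynomial.X (.inr i) * MvPolynomial.X (.inl ε) ^ a i) /
      ι (MvPolynomial.X (.inr j) * MvPolynomial.X (.inl ε) ^ a j)

variable {ι}

theorem cornerFraction_cornerChart (hι : Function.Injective ι) (j : Fin s) (ε : Fin 2)
    (x : scrollSections k a) :
    cornerFraction ι a j ε (cornerChart k j ε x) = (ι (cornerSection k a j ε))⁻¹ * ι x := by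
  obtain ⟨x, hx⟩ := x
  have hX (m : Fin 2 ⊕ Fin s) : ι (MvPolynomial.X m) ≠ 0 :=
    (map_ne_zero_iff ι hι).mpr (MvPolynomial.X_ne_zero m)
  induction hx using Submodule.span_induction with
  | mem x hx =>
    obtain ⟨i, b, c, hbc, rfl⟩ := hx
    have h0 := hX (.inl 0)
    have h1 := hX (.inl 1)
    have hj := hX (.inr j)
    by_cases hij : i = j
    · subst hij
      fin_cases ε <;>
        simp [cornerFraction, cornerChart, cornerSection, ← hbc, div_pow, pow_add] <;> field_simp
    · fin_cases ε <;>
        simp [cornerFraction, cornerChart, cornerSection, hij, ← hbc, div_pow, pow_add] <;>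
        field_simp
  | zero => simp
  | add x y hx hy ihx ihy =>
    simp only [map_add, mul_add] at ihx ihy ⊢
    rw [ihx, ihy]
  | smul t x hx ih =>
    simp only [map_smul] at ih ⊢
    rw [ih, mul_smul_comm]

/-- On forms of degree `d` the chart followed by `cornerFraction` is the division by the `d`-th
power of the corner section. -/
theorem cornerFraction_cornerChart_form (hι : Function.Injective ι) (j : Fin s) (ε : Fin 2)
    {d : ℕ} {p : MvPolynomial (Fin (r + 1)) k} (hp : p ∈ forms r k d) :
    cornerFraction ι a j ε (cornerChart k j ε (gradedEvalSections ℓ p).1) =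
      (ι (cornerSection k a j ε))⁻¹ ^ d * ι (gradedEvalSections ℓ p).1 := by
  have h1 := congr($(MvPolynomial.comp_aeval
    (fun m => (ℓ m : MvPolynomial (Fin 2 ⊕ Fin s) k))
    ((cornerFraction ι a j ε).comp (cornerChart k j ε))) p)
  have h2 := congr($(MvPolynomial.comp_aeval
    (fun m => (ℓ m : MvPolynomial (Fin 2 ⊕ Fin s) k)) ι) p)
  refine h1.trans ?_
  rw [coe_gradedEvalSections]
  refine Eq.trans ?_ (congrArg _ h2.symm)
  have h3 : (fun m => ((cornerFraction ι a j ε).comp (cornerChart k j ε)) (ℓ m)) =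
      fun m => (ι (cornerSection k a j ε))⁻¹ * ι (ℓ m) :=
    funext fun m => cornerFraction_cornerChart hι j ε (ℓ m)
  rw [h3]
  exact eval₂_mul_of_isHomogeneous hp (algebraMap k Q) (fun m => ι (ℓ m)) _

end Fractions

theorem injective_evalAway_cornerChart (j : Fin s) (ε : Fin 2)
    (hu : IsUnit (restrictSections ℓ (cornerChart k j ε) (ofSection ℓ (cornerSection k a j ε)))) :
    Function.Injective
      (evalAway (sectionGrading ℓ) (restrictSections ℓ (cornerChart k j ε)) _ hu) := by
  rw [injective_iff_map_eq_zero]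
  intro q hq
  obtain ⟨n, x, ⟨p, hp, rfl⟩, rfl⟩ :=
    Away.mk_surjective (sectionGrading ℓ) (ofSection_mem ℓ (cornerSection k a j ε)) q
  have h1 := evalAway_mk hu (by
    rw [restrictSections_apply, coe_ofSection, cornerChart_cornerSection])
    (ofSection_mem ℓ (cornerSection k a j ε)) n _ ⟨p, hp, rfl⟩
  have h2 : cornerChart k j ε (gradedEvalSections ℓ p).1 = 0 := h1.symm.trans hq
  let ι : MvPolynomial (Fin 2 ⊕ Fin s) k →ₐ[k] FractionRing (MvPolynomial (Fin 2 ⊕ Fin s) k) :=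
    IsScalarTower.toAlgHom k _ _
  have hι : Function.Injective ι := IsFractionRing.injective _ _
  have h3 := cornerFraction_cornerChart_form ℓ hι j ε hp
  have h4 : (cornerSection k a j ε : MvPolynomial (Fin 2 ⊕ Fin s) k) ≠ 0 := by
    simp [cornerSection]
  rw [h2, map_zero, eq_comm, mul_eq_zero_iff_left (pow_ne_zero _ (inv_ne_zero
    ((map_ne_zero_iff ι hι).mpr h4))), map_eq_zero_iff ι hι] at h3
  have h5 : (evalSections ℓ).toLinearMap p = 0 := Subtype.ext h3
  apply HomogeneousLocalization.val_injective
  refine (Away.val_mk _ n (ofSection_mem ℓ (cornerSection k a j ε)) _ _).trans ?_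
  rw [h5, HomogeneousLocalization.val_zero, Localization.mk_zero]

theorem surjective_evalAway_cornerChart (ha : ∀ j, 1 ≤ a j) (j : Fin s) (ε : Fin 2)
    (hu : IsUnit (restrictSections ℓ (cornerChart k j ε) (ofSection ℓ (cornerSection k a j ε)))) :
    Function.Surjective
      (evalAway (sectionGrading ℓ) (restrictSections ℓ (cornerChart k j ε)) _ hu) := by
  have hsec (x : scrollSections k a) : cornerChart k j ε x ∈
      (evalAway (sectionGrading ℓ) (restrictSections ℓ (cornerChart k j ε)) _ hu).rangeS := by
    have h1 := evalAway_mk hu (by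
      rw [restrictSections_apply, coe_ofSection, cornerChart_cornerSection])
      (ofSection_mem ℓ (cornerSection k a j ε)) 1 (ofSection ℓ x)
      (by simpa using ofSection_mem ℓ x)
    refine ⟨_, h1.trans ?_⟩
    rw [restrictSections_apply, coe_ofSection]
  intro f
  change f ∈ (evalAway (sectionGrading ℓ) (restrictSections ℓ (cornerChart k j ε)) _ hu).rangeS
  induction f using MvPolynomial.induction_on with
  | C x =>
    have h1 := congr($(evalAway_comp_fromZeroRingHom (restrictSections ℓ (cornerChart k j ε))
      (ofSection_mem ℓ (cornerSection k a j ε)) hu) (algebraMap k _ x))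
    refine ⟨_, h1.trans ?_⟩
    exact (cornerChart k j ε).commutes x
  | add f g hf hg => exact add_mem hf hg
  | mul_X f i hf =>
    refine mul_mem hf ?_
    by_cases hij : i = j
    · subst hij
      have h1 := hsec ⟨_, X_mul_pow_mul_pow_mem (k := k) i (show ε ≠ ε + 1 by omega) (a i - 1) 1
        (Nat.sub_add_cancel (ha i))⟩
      simpa [cornerChart] using h1
    · have h1 := hsec (cornerSection k a i ε)
      simpa [cornerChart, cornerSection, hij] using h1

/-- If all `a_j` are positive, the corner charts `t_j u ^ a_j ≠ 0` and `t_j v ^ a_j ≠ 0` are affine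
spaces that cover the scroll. -/
theorem smooth_scrollEmbedding_toSpec (ha : ∀ j, 1 ≤ a j) :
    Smooth (scrollEmbedding ℓ ≫ PSpace.toSpec r k) := by
  have hloc : IsZariskiLocalAtSource @Smooth.{u} :=
    HasRingHomProperty.instIsZariskiLocalAtSource (P := @Smooth.{u}) (Q := RingHom.Smooth)
  refine IsZariskiLocalAtSource.of_iSup_eq_top (P := @Smooth.{u}) _
    (iSup_basicOpen_cornerSection ℓ ha) ?_
  rintro ⟨j, ε⟩
  have h1 : restrictSections ℓ (cornerChart k j ε) (ofSection ℓ (cornerSection k a j ε)) = 1 := by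
    rw [restrictSections_apply, coe_ofSection, cornerChart_cornerSection]
  have hu : IsUnit (restrictSections ℓ (cornerChart k j ε)
    (ofSection ℓ (cornerSection k a j ε))) := h1 ▸ isUnit_one
  have hiso : IsIso (CommRingCat.ofHom (evalAway (sectionGrading ℓ)
      (restrictSections ℓ (cornerChart k j ε)) _ hu)) :=
    (ConcreteCategory.isIso_iff_bijective _).mpr
      ⟨injective_evalAway_cornerChart ℓ j ε hu, surjective_evalAway_cornerChart ℓ ha j ε hu⟩
  have h2 := chartPoint_ofSection_toSpec ℓ (cornerChart k j ε) (cornerSection k a j ε)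
    (cornerChart_cornerSection j ε) hu
  have h3 : Smooth (Spec.map (CommRingCat.ofHom (algebraMap k (MvPolynomial (Fin s) k)))) := by
    rw [HasRingHomProperty.Spec_iff (P := @Smooth)]
    exact RingHom.smooth_algebraMap.mpr
      (⟨inferInstance, inferInstance⟩ : Algebra.Smooth k (MvPolynomial (Fin s) k))
  rw [← h2, chartPoint, Category.assoc] at h3
  have h5 := IsZariskiLocalAtSource.comp (P := @Smooth.{u}) h3 (inv (Spec.map
    (CommRingCat.ofHom
      (evalAway (sectionGrading ℓ) (restrictSections ℓ (cornerChart k j ε)) _ hu))))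
  rw [IsIso.inv_hom_id_assoc] at h5
  have h4 : (Proj.basicOpenIsoSpec (sectionGrading ℓ) _ (ofSection_mem ℓ (cornerSection k a j ε))
      one_pos).hom ≫ Proj.awayι (sectionGrading ℓ) _ (ofSection_mem ℓ (cornerSection k a j ε))
      one_pos = (Proj.basicOpen (sectionGrading ℓ) (ofSection ℓ (cornerSection k a j ε))).ι := by
    rw [Proj.awayι, Iso.hom_inv_id_assoc]
  change Smooth ((Proj.basicOpen (sectionGrading ℓ) (ofSection ℓ (cornerSection k a j ε))).ι ≫ _)
  rw [← h4, Category.assoc]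
  exact IsZariskiLocalAtSource.comp (P := @Smooth.{u}) h5 _

end ScrollPoint

/-! ### Strings of vectors and scrolls -/

section Blocks

variable {k : Type u} [Field k] {s : ℕ} (a : Fin s → ℕ)

/-- The section `t_j u ^ (a_j - l) v ^ l` of `O(1)`. -/
noncomputable def monomialSection (j : Fin s) (l : ℕ) (hl : l ≤ a j) : scrollSections k a :=
  ⟨MvPolynomial.X (.inr j) * MvPolynomial.X (.inl 0) ^ (a j - l) * MvPolynomial.X (.inl 1) ^ l,
    by
      have h := X_mul_pow_mul_pow_mem (k := k) (a := a) j Fin.zero_ne_one (a j - l) l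
        (Nat.sub_add_cancel hl)
      exact h⟩

theorem linearIndependent_monomialSection :
    LinearIndependent k (fun q : Σ j : Fin s, Fin (a j + 1) =>
      (monomialSection a q.1 q.2 (Nat.lt_succ_iff.mp q.2.2) : scrollSections k a)) := by
  apply LinearIndependent.of_comp (scrollSections k a).subtype
  let e (q : Σ j : Fin s, Fin (a j + 1)) : (Fin 2 ⊕ Fin s) →₀ ℕ :=
    Finsupp.single (.inr q.1) 1 + Finsupp.single (.inl 0) (a q.1 - q.2) +
      Finsupp.single (.inl 1) (q.2 : ℕ)
  have he : Function.Injective e := by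
    rintro ⟨j, l⟩ ⟨j', l'⟩ h
    have h1 := DFunLike.congr_fun h (.inr j)
    have h2 := DFunLike.congr_fun h (.inl 1)
    have hj : j' = j := by
      by_contra hne
      simp [e, hne] at h1
    subst hj
    have hl : l = l' := by
      simp [e] at h2
      omega
    rw [hl]
  have h := (MvPolynomial.basisMonomials (Fin 2 ⊕ Fin s) k).linearIndependent.comp e he
  have hfun : (scrollSections k a).subtype ∘ (fun q : Σ j : Fin s, Fin (a j + 1) =>
      (monomialSection a q.1 q.2 (Nat.lt_succ_iff.mp q.2.2) : scrollSections k a)) =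
      MvPolynomial.basisMonomials (Fin 2 ⊕ Fin s) k ∘ e := by
    funext q
    change MvPolynomial.X (.inr q.1) * MvPolynomial.X (.inl 0) ^ (a q.1 - q.2) *
      MvPolynomial.X (.inl 1) ^ (q.2 : ℕ) = MvPolynomial.basisMonomials (Fin 2 ⊕ Fin s) k (e q)
    rw [MvPolynomial.coe_basisMonomials, MvPolynomial.X_pow_eq_monomial,
      MvPolynomial.X_pow_eq_monomial, MvPolynomial.X, MvPolynomial.monomial_mul,
      MvPolynomial.monomial_mul, one_mul, one_mul]
  rw [hfun]
  exact h

theorem span_monomialSection :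
    Submodule.span k (Set.range (fun q : Σ j : Fin s, Fin (a j + 1) =>
      (monomialSection a q.1 q.2 (Nat.lt_succ_iff.mp q.2.2) : scrollSections k a))) = ⊤ := by
  rw [eq_top_iff]
  rintro ⟨x, hx⟩ -
  induction hx using Submodule.span_induction with
  | mem x hx =>
    obtain ⟨i, b, c, hbc, rfl⟩ := hx
    refine Submodule.subset_span ⟨⟨i, c, by omega⟩, Subtype.ext ?_⟩
    have hb : a i - c = b := by omega
    simp [monomialSection, hb]
  | zero => exact zero_mem _
  | add x y hx hy ihx ihy => exact add_mem ihx ihy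
  | smul t x hx ih => exact Submodule.smul_mem _ t ih

variable {a} {r : ℕ} {A : Type u} [CommRing A] [Algebra k A]

/-- A basis of strings for the linear system `ρ` exhibits the `ρ_m` as the values at some
`u = 1, v = t, t_j = x_j` of a basis of the sections of `O(1)` on a scroll. -/
theorem HasBlocks.exists_basis_scrollSections {ρ : Fin (r + 1) → A} {t : A}
    (h : HasBlocks (Fintype.linearCombination k ρ) t a) :
    ∃ (Ψ : MvPolynomial (Fin 2 ⊕ Fin s) k →ₐ[k] A)
      (ℓ : Module.Basis (Fin (r + 1)) k (scrollSections k a)), ∀ m, Ψ (ℓ m) = ρ m := by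
  obtain ⟨x, y, hxy, hspan, hsum⟩ := h
  let Y (q : Σ j : Fin s, Fin (a j + 1)) : Fin (r + 1) → k := y q.1 q.2
  have hY : ⊤ ≤ Submodule.span k (Set.range Y) := by
    rw [← hspan]
    refine Submodule.span_mono ?_
    rintro _ ⟨j, l, hl, rfl⟩
    exact ⟨⟨j, l, by omega⟩, rfl⟩
  have hcard : Fintype.card (Σ j : Fin s, Fin (a j + 1)) =
      Module.finrank k (Fin (r + 1) → k) := by
    rw [← hsum, Fintype.card_sigma]
    simp
  let bY := basisOfTopLeSpanOfCardEqFinrank Y hY hcard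
  let bM : Module.Basis (Σ j : Fin s, Fin (a j + 1)) k (scrollSections k a) :=
    Module.Basis.mk (linearIndependent_monomialSection a) (span_monomialSection a).ge
  let e := bY.equiv bM (Equiv.refl _)
  let Ψ : MvPolynomial (Fin 2 ⊕ Fin s) k →ₐ[k] A := MvPolynomial.aeval (Sum.elim ![1, t] x)
  have hΨ : (Ψ.toLinearMap.comp (scrollSections k a).subtype).comp e.toLinearMap =
      Fintype.linearCombination k ρ := by
    refine bY.ext fun q => ?_
    have h1 : e (bY q) = monomialSection a q.1 q.2 (Nat.lt_succ_iff.mp q.2.2) := by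
      rw [Module.Basis.equiv_apply, Equiv.refl_apply, Module.Basis.mk_apply]
    have h2 : bY q = Y q := congrFun (coe_basisOfTopLeSpanOfCardEqFinrank Y hY hcard) q
    change Ψ (e (bY q)) = _
    rw [h1, h2, hxy q.1 q.2 (by omega)]
    simp [Ψ, monomialSection, mul_comm]
  refine ⟨Ψ, (Pi.basisFun k (Fin (r + 1))).map e, fun m => ?_⟩
  have h1 := congr($hΨ (Pi.single m 1))
  rw [Fintype.linearCombination_apply_single, one_smul] at h1
  rw [← h1, Module.Basis.map_apply, Pi.basisFun_apply]
  rfl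

/-- A finite subscheme whose linear system of coordinates has a basis of strings lies on a
scroll. -/
theorem HasBlocks.exists_scrollEmbedding {ρ : Fin (r + 1) → A} {t : A} {c : Fin (r + 1) → k}
    (h : ∑ m, c m • ρ m = 1) (hb : HasBlocks (Fintype.linearCombination k ρ) t a) :
    ∃ (ℓ : Module.Basis (Fin (r + 1)) k (scrollSections k a))
      (g : Spec (.of A) ⟶ AlgebraicGeometry.Proj (sectionGrading ℓ)),
      g ≫ scrollEmbedding ℓ = coordPoint ρ c h := by
  obtain ⟨Ψ, ℓ, hΨ⟩ := hb.exists_basis_scrollSections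
  obtain rfl : (fun m => Ψ (ℓ m)) = ρ := funext hΨ
  obtain ⟨g, hg⟩ := exists_comp_scrollEmbedding_eq ℓ Ψ c h
  exact ⟨ℓ, g, hg⟩

theorem HasBlocks.exists_pos {ρ : Fin (r + 1) → A} {t : A}
    (hb : HasBlocks (Fintype.linearCombination k ρ) t a) (hsr : s < r + 1) : ∃ i, 0 < a i := by
  obtain ⟨-, -, -, -, hsum⟩ := hb
  by_contra! h0
  have h1 : ∑ j, (a j + 1) = s := by
    rw [Finset.sum_congr rfl fun j _ => congrArg (· + 1) (Nat.le_zero.mp (h0 j))]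
    simp
  rw [h1, Module.finrank_fin_fun] at hsum
  omega

end Blocks

end GaleScroll

open GaleScroll in
theorem theorem4p5 {k : Type u} [Field k] [Infinite k] (r s : ℕ) (hr : 3 ≤ r) (hs : 1 ≤ s)
    (hsr : s + 2 ≤ r) (Y : Scheme.{u}) (i : Y ⟶ GaleScroll.PSpace r k) [IsClosedImmersion i]
    [IsFinite (i ≫ GaleScroll.PSpace.toSpec r k)]
    (hGor : GaleScroll.IsGorenstein Y)
    (hpos : GaleScroll.InLinearlyGeneralPosition (GaleScroll.geometricFiberMap i))
    (hcurv : GaleScroll.degree (i ≫ GaleScroll.PSpace.toSpec r k) ≤ r + 2 →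
      GaleScroll.IsCurvilinear (GaleScroll.geometricFiber i))
    (hdeg : GaleScroll.degree (i ≫ GaleScroll.PSpace.toSpec r k) ≤ r + s + 2) :
    (∃ (X : Scheme.{u}) (j : X ⟶ GaleScroll.PSpace r k),
      GaleScroll.IsRationalNormalScroll s j ∧ ∃ g : Y ⟶ X, g ≫ j = i) ∧
    (2 * s ≤ r + 1 →
      ∃ (X : Scheme.{u}) (j : X ⟶ GaleScroll.PSpace r k),
        GaleScroll.IsRationalNormalScroll s j ∧ Smooth (j ≫ GaleScroll.PSpace.toSpec r k) ∧
        ∃ g : Y ⟶ X, g ≫ j = i) := by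
  obtain ⟨A, _, _, _, e, ρ, c, h, he, hA⟩ := exists_spec_model i
  have hE : Module.finrank k (Fin (r + 1) → k) = r + 1 := Module.finrank_fin_fun k
  rw [hA] at hcurv hdeg
  obtain ⟨τ, hτ⟩ := exists_isTrace (k := k) (A := A) fun m _ =>
    injective_localization_of_iso e hGor m
  obtain ⟨hB, hB'⟩ := exists_hasBlocks_of_inGeneralPosition (s := s) hτ hs (by omega)
    (linearSystemInGeneralPosition_of_model he hpos)
    (fun hle m hm => exists_le_span_sup_sq_of_model he (hcurv (by omega)) m) (by omega)
  constructor
  · obtain ⟨t, a, hb⟩ := hB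
    obtain ⟨ℓ, g, hg⟩ := hb.exists_scrollEmbedding h
    refine ⟨_, scrollEmbedding ℓ,
      isRationalNormalScroll_scrollEmbedding ℓ (hb.exists_pos (by omega)), e.hom ≫ g, ?_⟩
    rw [Category.assoc, hg, ← he, Iso.hom_inv_id_assoc]
  · intro hsr'
    obtain ⟨t, a, hb, ha⟩ := hB' (by omega)
    obtain ⟨ℓ, g, hg⟩ := hb.exists_scrollEmbedding h
    refine ⟨_, scrollEmbedding ℓ,
      isRationalNormalScroll_scrollEmbedding ℓ (hb.exists_pos (by omega)),
      smooth_scrollEmbedding_toSpec ℓ ha, e.hom ≫ g, ?_⟩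
    rw [Category.assoc, hg, ← he, Iso.hom_inv_id_assoc]
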